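/- **Setting.** Let $n\ge 1$, $m\ge 0$ be integers, $\nu\in\mathbb C$ with $\operatorname{Re}\nu>0$, $p>1+(m+3)/n$, and let $f:\mathbb C\to\mathbb C$ satisfy $f(0)=0$ and, for some $K>0$, $|f(\xi)-f(\eta)|\le K(|\xi|^{p-1}+|\eta|^{p-1})|\xi-\eta|$ for all $\xi,\eta\in\mathbb C$. For $u_0\in L^1\cap L^\infty(\mathbb R^n;\mathbb C)$ consider $$\partial_t u-\nu\Delta u=f(u)\ \text{ in }(0,\infty)\times\mathbb R^n,\qquad u(0)=u_0 .\tag{P}$$ Let $G_{t\nu}(x)=(4\pi t\nu)^{-n/2}e^{-|x|^2/(4t\nu)}$ (principal branch), and let $e^{t\nu\Delta}\varphi=G_{t\nu}*\varphi$ for $t>0$, $e^{0\nu\Delta}\varphi=\varphi$. A *global solution* of (P) is a function $u$ that is bounded and continuous from $[0,\infty)$ to $L^1(\mathbb R^n)$ and bounded and continuous from $(0,\infty)$ to $L^\infty(\mathbb R^n)$, such that $u(t)=e^{t\nu\Delta}u_0+\int_0^t e^{(t-s)\nu\Delta}f(u(s))\,ds$ for all $t>0$. For an integer $k\ge0$,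 $L^1_k$ is the space of $\varphi\in L^1(\mathbb R^n)$ with $x^\alpha\varphi\in L^1(\mathbb R^n)$ for all multi-indices $|\alpha|\le k$. Put $\mathcal M_\beta(\varphi)=\frac1{\beta!}\int_{\mathbb R^n}y^\beta\varphi(y)\,dy$, $(\delta_t\varphi)(x)=t^{-n/2}\varphi(t^{-1/2}x)$, $$h_{\nu,\alpha}(x)=\sum_{2\beta\le\alpha}\frac{(-1)^{|\beta|}\alpha!}{\beta!(\alpha-2\beta)!}\nu^{-|\alpha-\beta|}x^{\alpha-2\beta},\qquad \psi_k=\int_0^\infty s^kf(u(s))\,ds,$$ $$\Lambda_{\alpha,N}(t;\varphi)=(-2)^{-|\alpha|}t^{-|\alpha|/2}\sum_{k=0}^N2^{-k}t^{-k/2}\sum_{|\beta|=k}\mathcal M_\beta(\varphi)\,\delta_t(h_{\nu,\alpha+\beta}G_\nu),$$ $$\mathcal A_k(t)=\Lambda_{0,k}(t;u_0)+\sum_{|\gamma|\le k/2}\frac{(-\nu)^{|\gamma|}}{\gamma!}\Lambda_{2\gamma,k-2|\gamma|}(t;\psi_{|\gamma|}).$$ **Proposition.** Let $\varphi\in L^1_{m+1}\cap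 L^\infty$ satisfy $\mathcal M_\alpha(\varphi)\ne0$ for some $|\alpha|=m+1$. Then there is $\varepsilon_\varphi>0$ such that for every $\varepsilon\in(0,\varepsilon_\varphi]$ the problem (P) with $u_0=\varepsilon\varphi$ has exactly one global solution $u$; all integrals defining $\mathcal A_m$ and $\mathcal A_{m+1}$ converge, that is, for $M\in\{m,m+1\}$ and $2k\le M$ the integral $\psi_k$ converges in $L^1$ and $\psi_k\in L^1_{M-2k}$; and $$\mathcal A_{m+1}(1)-\mathcal A_m(1)\not\equiv0 .$$ Hence the decay rate $t^{-1/2}$ of the rescaled remainder $t^{\frac n2(1-\frac1q)+\frac m2}\|u(t)-\mathcal A_m(t)\|_q$ is optimal: for every $q\in[1,\infty]$ one has $0<\|\mathcal A_{m+1}(1)-\mathcal A_m(1)\|_q<\infty$, and for every $\delta\in(0,1)$ there is $t_0>0$ such that for all $t>t_0$ $$t^{-\frac12}(1-\delta)\|\mathcal A_{m+1}(1)-\mathcal A_m(1)\|_q\le t^{\frac n2(1-\frac1q)+\frac m2}\|u(t)-\mathcal A_m(t)\|_q\le t^{-\frac12}(1+\delta)\|\mathcal A_{m+1}(1)-\mathcal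 A_m(1)\|_q .$$ -/

import Mathlib

open MeasureTheory Set Filter Topology
open scoped ENNReal

noncomputable section

namespace CGL

variable {n : ℕ}

/-! ### Multi-indices -/

/-- Length `|α|` of a multi-index. -/
def len (α : Fin n → ℕ) : ℕ := ∑ j, α j

/-- Factorial `α!` of a multi-index. -/
def mfact (α : Fin n → ℕ) : ℕ := ∏ j, (α j).factorial

/-- The monomial `x ^ α`, as a complex number. -/
def monom (α : Fin n → ℕ) (x : EuclideanSpace ℝ (Fin n)) : ℂ := ∏ j, ((x j : ℝ) : ℂ) ^ α j

/-- The finite set of multi-indices of length exactly `k`. -/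
def multiIndices (n k : ℕ) : Finset (Fin n → ℕ) := Finset.piAntidiag Finset.univ k

theorem mem_multiIndices {k : ℕ} {α : Fin n → ℕ} : α ∈ multiIndices n k ↔ len α = k := by
  simp [multiIndices, len]

/-! ### Function spaces, moments -/

/-- Membership in the weighted space `L¹_m(ℝⁿ)`. -/
def MemWeightedL1 (m : ℕ) (φ : EuclideanSpace ℝ (Fin n) → ℂ) : Prop :=
  Integrable φ ∧ ∀ α : Fin n → ℕ, len α ≤ m → Integrable (fun x => monom α x * φ x)

/-- The moment `M_β(φ) = (1/β!) ∫ y^β φ(y) dy`. -/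
def moment (β : Fin n → ℕ) (φ : EuclideanSpace ℝ (Fin n) → ℂ) : ℂ :=
  ((mfact β : ℂ))⁻¹ * ∫ y, monom β y * φ y

open Classical in
/-- The class in `L¹(ℝⁿ)` of an integrable function (`0` for a function that is not integrable;
it is only applied to integrable functions, see `integrable_cglSemigroup` and
`integrable_nonlinearity`). -/
def toL1 (g : EuclideanSpace ℝ (Fin n) → ℂ) : EuclideanSpace ℝ (Fin n) →₁[volume] ℂ :=
  if h : Integrable g then h.toL1 g else 0

/-! ### The CGL semigroup -/

/-- The kernel `G_ν(x) = (4πν)^(-n/2) exp(-|x|²/(4ν))` (principal branch of the power); the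
fundamental solution at time `t` is `gaussian (t * ν)`. -/
def gaussian (ν : ℂ) (x : EuclideanSpace ℝ (Fin n)) : ℂ :=
  (4 * (Real.pi : ℂ) * ν) ^ (-(n : ℂ) / 2) * Complex.exp (-((‖x‖ : ℂ) ^ 2) / (4 * ν))

/-- The CGL semigroup `e^{tνΔ}`: convolution with `G_{tν}` for `t > 0`, the identity at `t = 0`. -/
def cglSemigroup (ν : ℂ) (t : ℝ) (φ : EuclideanSpace ℝ (Fin n) → ℂ) :
    EuclideanSpace ℝ (Fin n) → ℂ :=
  if 0 < t then fun x => ∫ y, gaussian ((t : ℂ) * ν) (x - y) * φ y else φ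

/-! ### Nonlinearity and global solutions -/

/-- The nonlinear term: `f(0) = 0` and the power-type local Lipschitz estimate of order `p`. -/
def IsNonlinearity (p : ℝ) (f : ℂ → ℂ) : Prop :=
  f 0 = 0 ∧ ∃ K : ℝ, 0 < K ∧ ∀ ξ η : ℂ,
    ‖f ξ - f η‖ ≤ K * (‖ξ‖ ^ (p - 1) + ‖η‖ ^ (p - 1)) * ‖ξ - η‖

/-- The space `X = (C ∩ L^∞)([0,∞); L¹) ∩ (C ∩ L^∞)((0,∞); L^∞)`. Only the values `u t` with
`t ≥ 0` matter. -/
structure MemX (u : ℝ → (EuclideanSpace ℝ (Fin n) →₁[volume] ℂ)) : Prop where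
  continuous_L1 : ContinuousOn u (Ici 0)
  bounded_L1 : ∃ C : ℝ, ∀ t, 0 ≤ t → ‖u t‖ ≤ C
  continuous_bounded_Linfty :
    ∃ v : ℝ → Lp ℂ ∞ (volume : Measure (EuclideanSpace ℝ (Fin n))),
      ContinuousOn v (Ioi 0) ∧ (∃ C : ℝ, ∀ t, 0 < t → ‖v t‖ ≤ C) ∧
      ∀ t, 0 < t → (v t : EuclideanSpace ℝ (Fin n) → ℂ) =ᵐ[volume] u t

/-- Global mild solutions: `u ∈ X` and
`u(t) = e^{tνΔ} u₀ + ∫₀ᵗ e^{(t-s)νΔ} f(u(s)) ds` for all `t > 0`, with a convergent (Bochner)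
integral. Both sides are elements of `L¹`, i.e. the identity is one of functions
modulo almost everywhere equality. -/
structure IsGlobalSolution (ν : ℂ) (f : ℂ → ℂ) (u₀ : EuclideanSpace ℝ (Fin n) → ℂ)
    (u : ℝ → (EuclideanSpace ℝ (Fin n) →₁[volume] ℂ)) : Prop where
  memX : MemX u
  integrable_duhamel : ∀ t, 0 < t → IntervalIntegrable
    (fun s => toL1 (cglSemigroup ν (t - s) (fun x => f (u s x)))) volume 0 t
  integral_eq : ∀ t, 0 < t →
    u t = toL1 (cglSemigroup ν t u₀) +
      ∫ s in (0 : ℝ)..t, toL1 (cglSemigroup ν (t - s) (fun x => f (u s x)))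

/-! ### Asymptotic profiles -/

/-- The Hermite polynomial
`h_{ν,α}(x) = ∑_{2β ≤ α} (-1)^|β| α! / (β! (α-2β)!) ν^{-|α-β|} x^{α-2β}`; the condition
`2β ≤ α` is written as `β j ≤ ⌊α j / 2⌋` for all `j`. -/
def hermite (ν : ℂ) (α : Fin n → ℕ) (x : EuclideanSpace ℝ (Fin n)) : ℂ :=
  ∑ β ∈ Finset.Iic (fun j => α j / 2),
    (-1) ^ len β * (mfact α : ℂ) / ((mfact β : ℂ) * (mfact (α - 2 • β) : ℂ)) *
      (ν ^ len (α - β))⁻¹ * monom (α - 2 • β) x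

/-- The dilation `(δ_t φ)(x) = t^(-n/2) φ(t^(-1/2) x)`. -/
def dilation (t : ℝ) (φ : EuclideanSpace ℝ (Fin n) → ℂ) (x : EuclideanSpace ℝ (Fin n)) : ℂ :=
  ((t ^ (-(n : ℝ) / 2) : ℝ) : ℂ) * φ (t ^ (-(1 : ℝ) / 2) • x)

/-- The profile
`Λ_{α,N}(t;φ) = (-2)^{-|α|} t^{-|α|/2} ∑_{k ≤ N} 2^{-k} t^{-k/2} ∑_{|β| = k} M_β(φ) δ_t(h_{ν,α+β} G_ν)`. -/
def Lam (ν : ℂ) (α : Fin n → ℕ) (N : ℕ) (t : ℝ) (φ : EuclideanSpace ℝ (Fin n) → ℂ)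
    (x : EuclideanSpace ℝ (Fin n)) : ℂ :=
  ((-2 : ℂ) ^ len α)⁻¹ * ((t ^ (-(len α : ℝ) / 2) : ℝ) : ℂ) *
    ∑ k ∈ Finset.range (N + 1), ((2 : ℂ) ^ k)⁻¹ * ((t ^ (-(k : ℝ) / 2) : ℝ) : ℂ) *
      ∑ β ∈ multiIndices n k,
        moment β φ * dilation t (fun z => hermite ν (α + β) z * gaussian ν z) x

/-- The function `ψ_k = ∫₀^∞ s^k f(u(s)) ds`, as an `L¹`-valued Bochner integral. -/
def psi (f : ℂ → ℂ) (u : ℝ → (EuclideanSpace ℝ (Fin n) →₁[volume] ℂ)) (k : ℕ) :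
    EuclideanSpace ℝ (Fin n) →₁[volume] ℂ :=
  ∫ s in Ioi (0 : ℝ), s ^ k • toL1 (fun x => f (u s x))

/-- The `m`-th order asymptotic profile
`A_m(t) = Λ_{0,m}(t;u₀) + ∑_{|γ| ≤ m/2} (-ν)^|γ| / γ! Λ_{2γ,m-2|γ|}(t;ψ_|γ|)`. -/
def profile (ν : ℂ) (f : ℂ → ℂ) (u₀ : EuclideanSpace ℝ (Fin n) → ℂ)
    (u : ℝ → (EuclideanSpace ℝ (Fin n) →₁[volume] ℂ)) (m : ℕ) (t : ℝ)
    (x : EuclideanSpace ℝ (Fin n)) : ℂ :=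
  Lam ν 0 m t u₀ x +
    ∑ k ∈ Finset.range (m / 2 + 1), ∑ γ ∈ multiIndices n k,
      (-ν) ^ k / (mfact γ : ℂ) * Lam ν (2 • γ) (m - 2 * k) t (psi f u k) x

/-- The function `A_{m+1}(1) - A_m(1)`. -/
def profileGap (ν : ℂ) (f : ℂ → ℂ) (u₀ : EuclideanSpace ℝ (Fin n) → ℂ)
    (u : ℝ → (EuclideanSpace ℝ (Fin n) →₁[volume] ℂ)) (m : ℕ)
    (x : EuclideanSpace ℝ (Fin n)) : ℂ :=
  profile ν f u₀ u (m + 1) 1 x - profile ν f u₀ u m 1 x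

/-- The rescaled norm `t^{(n/2)(1 - 1/q) + m/2} ‖u(t) - A_m(t)‖_q` of the remainder. -/
def scaledRemainder (ν : ℂ) (f : ℂ → ℂ) (u₀ : EuclideanSpace ℝ (Fin n) → ℂ)
    (u : ℝ → (EuclideanSpace ℝ (Fin n) →₁[volume] ℂ)) (m : ℕ) (q : ℝ≥0∞) (t : ℝ) : ℝ≥0∞ :=
  ENNReal.ofReal (t ^ ((n : ℝ) / 2 * (1 - (q⁻¹).toReal) + (m : ℝ) / 2)) *
    eLpNorm (fun x => u t x - profile ν f u₀ u m t x) q volume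

/-- All the integrals in the definition of `A_m` converge: for `k ≤ m/2`, the `L¹`-valued integral
`ψ_k` converges and `ψ_k` lies in `L¹_{m-2k}`. -/
def ProfileConverges (f : ℂ → ℂ) (u : ℝ → (EuclideanSpace ℝ (Fin n) →₁[volume] ℂ))
    (m : ℕ) : Prop :=
  ∀ k : ℕ, 2 * k ≤ m →
    IntegrableOn (fun s : ℝ => s ^ k • toL1 (fun x => f (u s x))) (Ioi 0) ∧
    MemWeightedL1 (m - 2 * k) (psi f u k : EuclideanSpace ℝ (Fin n) → ℂ)

/-! ### `toL1` is only applied to integrable functions -/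

theorem integrable_gaussian {ν : ℂ} (hν : 0 < ν.re) :
    Integrable (gaussian ν : EuclideanSpace ℝ (Fin n) → ℂ) := by
  have hb : 0 < ((4 * ν)⁻¹).re := by
    rw [Complex.inv_re]
    apply div_pos
    · simpa using hν
    · rw [Complex.normSq_pos]
      intro h
      have := congrArg Complex.re h
      simp at this
      linarith
  have h := GaussianFourier.integrable_cexp_neg_mul_sq_norm_add
    (V := EuclideanSpace ℝ (Fin n)) hb 0 0
  refine (h.const_mul ((4 * (Real.pi : ℂ) * ν) ^ (-(n : ℂ) / 2))).congr ?_
  refine Eventually.of_forall fun x => ?_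
  simp only [gaussian, zero_mul, add_zero]
  congr 2
  rw [div_eq_mul_inv]
  ring

theorem integrable_cglSemigroup {ν : ℂ} (hν : 0 < ν.re) (t : ℝ)
    {φ : EuclideanSpace ℝ (Fin n) → ℂ} (hφ : Integrable φ) :
    Integrable (cglSemigroup ν t φ) := by
  unfold cglSemigroup
  split_ifs with ht
  · have hG : Integrable (gaussian ((t : ℂ) * ν) : EuclideanSpace ℝ (Fin n) → ℂ) :=
      integrable_gaussian (by simpa using mul_pos ht hν)
    have h := Integrable.integrable_convolution (ContinuousLinearMap.mul ℝ ℂ) hφ hG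
    refine h.congr (Eventually.of_forall fun x => ?_)
    simp only [convolution, ContinuousLinearMap.mul_apply']
    exact integral_congr_ae (Eventually.of_forall fun y => mul_comm _ _)
  · exact hφ

theorem continuous_nonlinearity {p : ℝ} (hp : 1 < p) {f : ℂ → ℂ} (hf : IsNonlinearity p f) :
    Continuous f := by
  obtain ⟨_, K, _, hK⟩ := hf
  rw [continuous_iff_continuousAt]
  intro η
  rw [ContinuousAt, tendsto_iff_norm_sub_tendsto_zero]
  have hp' : 0 ≤ p - 1 := by linarith
  have hc : Continuous fun ξ : ℂ => K * (‖ξ‖ ^ (p - 1) + ‖η‖ ^ (p - 1)) * ‖ξ - η‖ := by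
    have : Continuous fun ξ : ℂ => ‖ξ‖ ^ (p - 1) :=
      continuous_norm.rpow_const fun _ => Or.inr hp'
    fun_prop
  refine squeeze_zero (fun _ => norm_nonneg _) (fun ξ => hK ξ η) ?_
  simpa using hc.tendsto η

theorem integrable_nonlinearity {p : ℝ} (hp : 1 < p) {f : ℂ → ℂ} (hf : IsNonlinearity p f)
    {φ : EuclideanSpace ℝ (Fin n) → ℂ} (h1 : Integrable φ) (hinf : MemLp φ ∞) :
    Integrable (fun x => f (φ x)) := by
  have hcont := continuous_nonlinearity hp hf
  obtain ⟨h0, K, hK0, hK⟩ := hf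
  have hp' : 0 ≤ p - 1 := by linarith
  refine (h1.norm.const_mul (K * (eLpNormEssSup φ volume).toReal ^ (p - 1))).mono'
    (hcont.comp_aestronglyMeasurable h1.aestronglyMeasurable) ?_
  have hfin : eLpNormEssSup φ volume ≠ ∞ := by
    have := hinf.2.ne
    rwa [eLpNorm_exponent_top] at this
  filter_upwards [enorm_ae_le_eLpNormEssSup φ volume] with x hx
  have hx' : ‖φ x‖ ≤ (eLpNormEssSup φ volume).toReal := by
    have := ENNReal.toReal_mono hfin hx
    simpa using this
  have h := hK (φ x) 0
  rw [h0, sub_zero, sub_zero, norm_zero, Real.zero_rpow (by linarith), add_zero] at h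
  refine h.trans ?_
  gcongr

end CGL

end

/-! Put `M = m + 1` and `σ = n(p-1)/2`. The hypothesis on `p` says exactly that `M/2 + 1 < σ`.

Small solutions. For small data a solution is found by contraction among curves in `L¹` that obey
three bounds (`Sized`): `L¹` norm at most `R`, sup norm at most `R(1+t)^(-n/2)`, and `|x|^M`-moment
at most `R(1+t)^(M/2)`. Since `|f(u)| ≤ K‖u‖_∞^(p-1)|u|`, the source `f(u(s))` obeys the same bounds
with `R` replaced by `K R^p (1+s)^(-σ)`. As `σ > 1`, the Duhamel integral preserves the class
(`exists_fixedPoint`). The bounds are closed conditions in `L¹`, so only the `L¹` distance has to be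
contracted. By Gronwall in `L¹` any global solution equals this one (`IsGlobalSolution.unique`) and
inherits its decay. Since `σ - M/2 > 1`, all integrals of `s^k y^β f(u(s,y))` with `2k + |β| ≤ M`
converge, and so do the profiles.

Expansion. After rescaling by `t` the kernel `G_{(t-s)ν}(x-y)` becomes `G_{(1-s/t)ν}` at a point
shifted by `y/√t`. It is expanded in the small quantities `s/t` and `y/√t`, the former counted
twice. Because `∂_μ G_μ = ΔG_μ`, the expansion is that of `exp(Aθ² + Bθ)` with `A = -σνΔ` and `B =
-y·∇`, where here `σ` stands for `s/t`; the coefficients are derivatives `∂^{2γ+β} G_ν`, that is,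
Hermite polynomials times `G_ν`. Integrating the polynomial part over `y` and `s` produces the
moments of `u₀` and of `ψ_k`, hence the profile of order `M`. The remainder is bounded by `r^M
min(1, r)` with `r = √(s/t) + |y|/√t` (`exists_norm_gaussian_sub_taylorPoly_le`). This uses moments
of order `M` only, and the factor `min(1, r)` makes the error `o(t^(-M/2))` by dominated convergence
(`DecaySource.exists_rescaledSize_sub`).

Optimal rate. The terms of degree `m + 1` are homogeneous: the difference of the two profiles at
time `t` is `t^(-(m+1)/2) δ_t` applied to the difference at time one. So `u - A_m` is this term plus
a smaller error, and the triangle inequality in `L^q` gives both bounds (`scaledRemainder_bounds`).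

Nonvanishing. If the difference at time one vanished, dividing by `G_ν` and comparing coefficients
of `x^α`, `|α| = m + 1`, would force a cancellation between `ε M_α(φ)` and finitely many moments of
the `ψ_k`. The latter are `O(ε^p)`, which is too small when `ε` is small
(`exists_profileGap_ne_zero`). -/

noncomputable section

namespace CGL

/-! ### Bochner integrals with values in `L¹` -/

section LOne

variable {α : Type*} [MeasurableSpace α] {μ : Measure α}

/-- A sequence converging in `L¹` has a subsequence converging almost everywhere. -/
theorem exists_subseq_tendsto_ae {F : ℕ → α →₁[μ] ℂ} {h : α →₁[μ] ℂ}
    (hF : Tendsto F atTop (𝓝 h)) :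
    ∃ φ : ℕ → ℕ, ∀ᵐ x ∂μ, Tendsto (fun i => F (φ i) x) atTop (𝓝 (h x)) := by
  obtain ⟨φ, _, hφ⟩ := (tendstoInMeasure_of_tendsto_Lp hF).exists_seq_tendsto_ae
  exact ⟨φ, hφ⟩

/-- The weighted norm `∫ k |h|`. -/
def wnorm (k : α → ℝ≥0∞) (h : α →₁[μ] ℂ) : ℝ≥0∞ := ∫⁻ x, k x * ‖h x‖ₑ ∂μ

/-- Fatou's lemma along an almost everywhere convergent subsequence. Decay conditions therefore
survive `L¹` limits, and the weighted norm is lower semicontinuous on `L¹`, hence Borel. -/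
theorem isClosed_wnorm_le {k : α → ℝ≥0∞} (hk : Measurable k) (c : ℝ≥0∞) :
    IsClosed {h : α →₁[μ] ℂ | wnorm k h ≤ c} := by
  refine isClosed_of_closure_subset fun h hh => ?_
  obtain ⟨F, hFm, hF⟩ := mem_closure_iff_seq_limit.1 hh
  obtain ⟨φ, hφ⟩ := exists_subseq_tendsto_ae hF
  have hm : ∀ i, AEMeasurable (fun x => k x * ‖F (φ i) x‖ₑ) μ := fun i =>
    hk.aemeasurable.mul (Lp.aestronglyMeasurable _).enorm
  calc wnorm k h ≤ ∫⁻ x, liminf (fun i => k x * ‖F (φ i) x‖ₑ) atTop ∂μ := by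
        refine lintegral_mono_ae ?_
        filter_upwards [hφ] with x hx
        -- The weight may be infinite, and multiplication by `∞` is discontinuous at `0`; where `h x
        -- = 0` the left side vanishes anyway.
        by_cases h0 : h x = 0
        · simp [h0]
        refine le_of_eq (Tendsto.liminf_eq ?_).symm
        exact ENNReal.Tendsto.const_mul hx.enorm (Or.inl (by simpa using h0))
    _ ≤ liminf (fun i => ∫⁻ x, k x * ‖F (φ i) x‖ₑ ∂μ) atTop := lintegral_liminf_le' hm
    _ ≤ c := by
        refine liminf_le_of_le (by isBoundedDefault) fun b hb => ?_
        obtain ⟨i, hi⟩ := hb.exists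
        exact hi.trans (hFm (φ i))

theorem measurable_wnorm {k : α → ℝ≥0∞} (hk : Measurable k) [MeasurableSpace (α →₁[μ] ℂ)]
    [BorelSpace (α →₁[μ] ℂ)] : Measurable (wnorm k : (α →₁[μ] ℂ) → ℝ≥0∞) :=
  (lowerSemicontinuous_iff_isClosed_preimage.2 fun c => isClosed_wnorm_le hk c).measurable

theorem isClosed_ae_le (c : ℝ) : IsClosed {h : α →₁[μ] ℂ | ∀ᵐ x ∂μ, ‖h x‖ ≤ c} := by
  refine isClosed_of_closure_subset fun h hh => ?_
  obtain ⟨F, hFm, hF⟩ := mem_closure_iff_seq_limit.1 hh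
  obtain ⟨φ, hφ⟩ := exists_subseq_tendsto_ae hF
  have hm : ∀ᵐ x ∂μ, ∀ i, ‖F (φ i) x‖ ≤ c := ae_all_iff.2 fun i => hFm (φ i)
  filter_upwards [hφ, hm] with x hx hx'
  exact le_of_tendsto hx.norm (Eventually.of_forall hx')

theorem wnorm_one (h : α →₁[μ] ℂ) : wnorm 1 h = ENNReal.ofReal ‖h‖ := by
  simp [wnorm, L1.norm_eq_integral_norm, 
    ofReal_integral_norm_eq_lintegral_enorm (L1.integrable_coeFn h)]

theorem wnorm_add_le {k : α → ℝ≥0∞} (hk : Measurable k) (g h : α →₁[μ] ℂ) :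
    wnorm k (g + h) ≤ wnorm k g + wnorm k h := by
  unfold wnorm
  have hm : AEMeasurable (fun x => k x * ‖g x‖ₑ) μ :=
    hk.aemeasurable.mul (Lp.aestronglyMeasurable _).enorm
  rw [← lintegral_add_left' hm]
  refine lintegral_mono_ae ?_
  filter_upwards [Lp.coeFn_add g h] with x hx
  rw [hx, Pi.add_apply, ← mul_add]
  gcongr
  exact enorm_add_le _ _

theorem wnorm_smul (k : α → ℝ≥0∞) (c : ℂ) (h : α →₁[μ] ℂ) :
    wnorm k (c • h) = ‖c‖ₑ * wnorm k h := by
  unfold wnorm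
  rw [← lintegral_const_mul' _ _ enorm_ne_top]
  refine lintegral_congr_ae ?_
  filter_upwards [Lp.coeFn_smul c h] with x hx
  rw [hx, Pi.smul_apply, enorm_smul]
  ring

theorem wnorm_mono {k l : α → ℝ≥0∞} (hkl : k ≤ l) (h : α →₁[μ] ℂ) : wnorm k h ≤ wnorm l h :=
  lintegral_mono fun x => mul_le_mul_left (hkl x) _

/-- Integration against a bounded function, as a continuous linear functional on `L¹`. -/
def pairing (g : α → ℂ) (C : ℝ) (hg : AEStronglyMeasurable g μ) (hC : ∀ x, ‖g x‖ ≤ C) :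
    (α →₁[μ] ℂ) →L[ℂ] ℂ :=
  LinearMap.mkContinuous
    { toFun := fun h => ∫ x, g x * h x ∂μ
      map_add' := fun h₁ h₂ => by
        rw [← integral_add ((L1.integrable_coeFn h₁).bdd_mul hg (Eventually.of_forall hC))
          ((L1.integrable_coeFn h₂).bdd_mul hg (Eventually.of_forall hC))]
        refine integral_congr_ae ?_
        filter_upwards [Lp.coeFn_add h₁ h₂] with x hx
        rw [hx, Pi.add_apply, mul_add]
      map_smul' := fun c h => by
        rw [RingHom.id_apply, ← integral_smul]
        refine integral_congr_ae ?_
        filter_upwards [Lp.coeFn_smul c h] with x hx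
        rw [hx, Pi.smul_apply, smul_eq_mul, smul_eq_mul]
        ring } C fun h => by
    rw [L1.norm_eq_integral_norm, ← integral_const_mul]
    refine norm_integral_le_of_norm_le ((L1.integrable_coeFn h).norm.const_mul C)
      (Eventually.of_forall fun x => ?_)
    rw [norm_mul]
    exact mul_le_mul_of_nonneg_right (hC x) (norm_nonneg _)

/-! ### Minkowski and Fubini for `L¹`-valued integrals -/

variable {β : Type*} [MeasurableSpace β] {ρ : Measure β}

/-- Elements of `L¹` have no point values, so pointwise information on a Bochner integral is
extracted by testing with bounded functions: the pairing is a continuous functional and commutes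
with the integral. -/
theorem integral_bounded_mul_integral {g : α → ℂ} {C : ℝ} (hg : AEStronglyMeasurable g μ)
    (hC : ∀ x, ‖g x‖ ≤ C) {F : β → α →₁[μ] ℂ} (hF : Integrable F ρ) :
    Integrable (fun s => ∫ x, g x * F s x ∂μ) ρ ∧
    ∫ x, g x * (∫ s, F s ∂ρ : α →₁[μ] ℂ) x ∂μ = ∫ s, ∫ x, g x * F s x ∂μ ∂ρ :=
  ⟨(pairing g C hg hC).integrable_comp hF, ((pairing g C hg hC).integral_comp_comm hF).symm⟩

theorem conj_sign_mul (z : ℂ) : (starRingEnd ℂ z / (‖z‖ : ℂ)) * z = (‖z‖ : ℂ) := by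
  by_cases hz : z = 0
  · simp [hz]
  have : (‖z‖ : ℂ) ≠ 0 := by simpa using hz
  field_simp
  rw [mul_comm, Complex.mul_conj, Complex.normSq_eq_norm_sq]
  push_cast
  ring

theorem norm_conj_sign_le (z : ℂ) : ‖starRingEnd ℂ z / (‖z‖ : ℂ)‖ ≤ 1 := by
  rw [norm_div, RCLike.norm_conj, Complex.norm_real, norm_norm]
  exact div_self_le_one _

/-- Minkowski's inequality for a bounded real weight. -/
theorem lintegral_bounded_mul_integral_le {k : α → ℝ} {C : ℝ} (hk : Measurable k)
    (hk0 : ∀ x, 0 ≤ k x) (hC : ∀ x, k x ≤ C) {F : β → α →₁[μ] ℂ} (hF : Integrable F ρ) :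
    ∫⁻ x, ENNReal.ofReal (k x) * ‖(∫ s, F s ∂ρ : α →₁[μ] ℂ) x‖ₑ ∂μ ≤
      ∫⁻ s, ∫⁻ x, ENNReal.ofReal (k x) * ‖F s x‖ₑ ∂μ ∂ρ := by
  set H : α →₁[μ] ℂ := ∫ s, F s ∂ρ with hH
  -- The norming function: weight times conjugate phase of `H`, so that `g H = k |H|` everywhere,
  -- including the zeros of `H`.
  set g : α → ℂ := fun x => (k x : ℂ) * (starRingEnd ℂ (H x) / (‖H x‖ : ℂ)) with hg
  have hHm : Measurable H := (Lp.stronglyMeasurable H).measurable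
  have hgm : Measurable g := by
    have h1 : Measurable fun x => starRingEnd ℂ (H x) := Complex.continuous_conj.measurable.comp hHm
    have h2 : Measurable fun x => (‖H x‖ : ℂ) := Complex.measurable_ofReal.comp hHm.norm
    exact (Complex.measurable_ofReal.comp hk).mul (h1.div h2)
  have hgk : ∀ x, ‖g x‖ ≤ k x := fun x => by
    rw [hg, norm_mul, Complex.norm_real, Real.norm_of_nonneg (hk0 x)]
    exact mul_le_of_le_one_right (hk0 x) (norm_conj_sign_le _)
  have hgH : ∀ x, g x * H x = ((k x * ‖H x‖ : ℝ) : ℂ) := fun x => by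
    rw [hg, mul_assoc, conj_sign_mul]
    push_cast
    rfl
  obtain ⟨-, h2⟩ := integral_bounded_mul_integral hgm.aestronglyMeasurable
    (fun x => (hgk x).trans (hC x)) hF
  have hint : Integrable (fun x => k x * ‖H x‖) μ :=
    (L1.integrable_coeFn H).norm.bdd_mul hk.aestronglyMeasurable
      (Eventually.of_forall fun x => by rw [Real.norm_of_nonneg (hk0 x)]; exact hC x)
  calc ∫⁻ x, ENNReal.ofReal (k x) * ‖H x‖ₑ ∂μ
      = ∫⁻ x, ENNReal.ofReal (k x * ‖H x‖) ∂μ := by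
        refine lintegral_congr fun x => ?_
        rw [ENNReal.ofReal_mul (hk0 x), ofReal_norm]
    _ = ENNReal.ofReal (∫ x, k x * ‖H x‖ ∂μ) :=
        (ofReal_integral_eq_lintegral_ofReal hint
          (Eventually.of_forall fun x => mul_nonneg (hk0 x) (norm_nonneg _))).symm
    _ ≤ ‖∫ x, g x * H x ∂μ‖ₑ := by
        simp_rw [hgH]
        rw [integral_complex_ofReal, ← ofReal_norm, Complex.norm_real]
        exact ENNReal.ofReal_le_ofReal (le_abs_self _)
    _ ≤ ∫⁻ s, ‖∫ x, g x * F s x ∂μ‖ₑ ∂ρ := by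
        rw [h2]
        exact enorm_integral_le_lintegral_enorm _
    _ ≤ ∫⁻ s, ∫⁻ x, ENNReal.ofReal (k x) * ‖F s x‖ₑ ∂μ ∂ρ := by
        refine lintegral_mono fun s => (enorm_integral_le_lintegral_enorm _).trans ?_
        refine lintegral_mono fun x => ?_
        dsimp only
        rw [enorm_mul, ← ofReal_norm (g x)]
        gcongr
        exact hgk x

/-- Truncating the weight at `j` reduces to bounded real weights; monotone convergence in `j` gives
the rest. -/
theorem wnorm_integral_le {k : α → ℝ≥0∞} (hk : Measurable k) {F : β → α →₁[μ] ℂ}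
    (hF : Integrable F ρ) :
    wnorm k (∫ s, F s ∂ρ) ≤ ∫⁻ s, wnorm k (F s) ∂ρ := by
  have hsup : ∀ x, k x = ⨆ j : ℕ, min (k x) j := fun x => by
    rw [← inf_iSup_eq, ENNReal.iSup_natCast, inf_top_eq]
  have h1 : wnorm k (∫ s, F s ∂ρ) =
      ⨆ j : ℕ, ∫⁻ x, min (k x) j * ‖(∫ s, F s ∂ρ : α →₁[μ] ℂ) x‖ₑ ∂μ := by
    have hm : ∀ j : ℕ, AEMeasurable
        (fun x => min (k x) j * ‖(∫ s, F s ∂ρ : α →₁[μ] ℂ) x‖ₑ) μ := fun j =>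
      (hk.min measurable_const).aemeasurable.mul (Lp.aestronglyMeasurable _).enorm
    rw [← lintegral_iSup' hm]
    · refine lintegral_congr fun x => ?_
      rw [← ENNReal.iSup_mul, ← hsup]
    · refine Eventually.of_forall fun x i j hij => ?_
      dsimp only
      gcongr
  rw [h1]
  refine iSup_le fun j => ?_
  have hfin : ∀ x, min (k x) j ≠ ∞ := fun x =>
    ((min_le_right _ _).trans_lt (ENNReal.natCast_lt_top j)).ne
  have h := lintegral_bounded_mul_integral_le (k := fun x => (min (k x) j).toReal) (C := j)
    (hk.min measurable_const).ennreal_toReal (fun _ => ENNReal.toReal_nonneg)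
    (fun x => by simpa using ENNReal.toReal_mono (ENNReal.natCast_ne_top j) (min_le_right (k x) j)) hF
  simp_rw [ENNReal.ofReal_toReal (hfin _)] at h
  refine h.trans (lintegral_mono fun s => lintegral_mono fun x => ?_)
  dsimp only
  gcongr
  exact min_le_left _ _

/-- Minkowski's inequality with indicator weights bounds the integral of the modulus over every
measurable set of finite measure by a constant times its measure, and this localises to an almost
everywhere bound. -/
theorem ae_norm_integral_le [SigmaFinite μ] {F : β → α →₁[μ] ℂ} (hF : Integrable F ρ)
    {b : β → ℝ} (hb : Integrable b ρ) (hFb : ∀ᵐ s ∂ρ, ∀ᵐ x ∂μ, ‖F s x‖ ≤ b s) :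
    ∀ᵐ x ∂μ, ‖(∫ s, F s ∂ρ : α →₁[μ] ℂ) x‖ ≤ ∫ s, b s ∂ρ := by
  -- For `μ = 0` the hypothesis would not give `b ≥ 0`, which is needed below.
  by_cases hμ : μ = 0
  · simp [hμ]
  have : (ae μ).NeBot := ae_neBot.2 hμ
  have hb0 : 0 ≤ᵐ[ρ] b := by
    filter_upwards [hFb] with s hs
    obtain ⟨x, hx⟩ := hs.exists
    exact (norm_nonneg _).trans hx
  set H : α →₁[μ] ℂ := ∫ s, F s ∂ρ with hH
  have key : (fun x => ‖H x‖ₑ) ≤ᵐ[μ] fun _ => ENNReal.ofReal (∫ s, b s ∂ρ) := by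
    refine ae_le_of_forall_setLIntegral_le_of_sigmaFinite
      (Lp.stronglyMeasurable H).enorm fun A hA hfin => ?_
    have h := lintegral_bounded_mul_integral_le (k := A.indicator 1) (C := 1)
      (measurable_one.indicator hA) (fun x => indicator_nonneg (fun _ _ => zero_le_one) x)
      (fun x => indicator_le_self' (fun _ _ => zero_le_one) x) hF
    have hind : ∀ (h : α →₁[μ] ℂ), ∫⁻ x, ENNReal.ofReal (A.indicator 1 x) * ‖h x‖ₑ ∂μ =
        ∫⁻ x in A, ‖h x‖ₑ ∂μ := fun h => by
      rw [← lintegral_indicator hA]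
      refine lintegral_congr fun x => ?_
      by_cases hx : x ∈ A <;> simp [hx]
    simp_rw [hind] at h
    refine h.trans ?_
    rw [setLIntegral_const, ofReal_integral_eq_lintegral_ofReal hb hb0,
      ← lintegral_mul_const' _ _ hfin.ne]
    refine lintegral_mono_ae ?_
    filter_upwards [hFb] with s hs
    rw [← setLIntegral_const]
    refine lintegral_mono_ae (ae_restrict_of_ae ?_)
    filter_upwards [hs] with x hx
    rw [← ofReal_norm]
    exact ENNReal.ofReal_le_ofReal hx
  filter_upwards [key] with x hx
  rw [← ofReal_norm] at hx
  exact (ENNReal.ofReal_le_ofReal_iff (integral_nonneg_of_ae hb0)).1 hx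

/-- Fubini's theorem for an unbounded weight `g`, dominated in `s`. -/
theorem integral_mul_integral {g : α → ℂ} (hg : Measurable g) {F : β → α →₁[μ] ℂ}
    (hF : Integrable F ρ) {b : β → ℝ} (hb : Integrable b ρ)
    (hFb : ∀ᵐ s ∂ρ, wnorm (fun x => ‖g x‖ₑ) (F s) ≤ ENNReal.ofReal (b s)) :
    Integrable (fun x => g x * (∫ s, F s ∂ρ : α →₁[μ] ℂ) x) μ ∧
    Integrable (fun s => ∫ x, g x * F s x ∂μ) ρ ∧
    ∫ x, g x * (∫ s, F s ∂ρ : α →₁[μ] ℂ) x ∂μ = ∫ s, ∫ x, g x * F s x ∂μ ∂ρ := by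
  set H : α →₁[μ] ℂ := ∫ s, F s ∂ρ with hH
  have hint : ∀ h : α →₁[μ] ℂ, wnorm (fun x => ‖g x‖ₑ) h < ∞ → Integrable (fun x => g x * h x) μ :=
    fun h hh => ⟨hg.aestronglyMeasurable.mul (Lp.aestronglyMeasurable h), by
      simpa only [HasFiniteIntegral, enorm_mul, wnorm] using hh⟩
  have hHi : Integrable (fun x => g x * H x) μ := hint H <| by
    refine (wnorm_integral_le hg.enorm hF).trans_lt ((lintegral_mono_ae hFb).trans_lt ?_)
    exact hb.lintegral_lt_top
  -- Cutting `g` off where it is large makes it bounded, so the pairing applies; both sides then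
  -- pass to the limit by dominated convergence.
  set gj : ℕ → α → ℂ := fun j => {x | ‖g x‖ ≤ j}.indicator g with hgj
  have hgjm : ∀ j, AEStronglyMeasurable (gj j) μ := fun j =>
    (hg.indicator (measurableSet_le hg.norm measurable_const)).aestronglyMeasurable
  have hgjb : ∀ j x, ‖gj j x‖ ≤ j := fun j x => by
    by_cases hx : x ∈ {x | ‖g x‖ ≤ j}
    · simp only [hgj]
      rw [indicator_of_mem hx]
      exact hx
    · simp [hgj, indicator_of_notMem hx]
  have hgjg : ∀ j x, ‖gj j x‖ ≤ ‖g x‖ := fun j x => norm_indicator_le_norm_self _ _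
  have hlim : ∀ x, Tendsto (fun j => gj j x) atTop (𝓝 (g x)) := fun x => by
    obtain ⟨N, hN⟩ := exists_nat_ge ‖g x‖
    refine tendsto_const_nhds.congr' ?_
    filter_upwards [eventually_ge_atTop N] with j hj
    exact (indicator_of_mem (show x ∈ {x | ‖g x‖ ≤ j} from hN.trans (by exact_mod_cast hj)) _).symm
  have hdct : ∀ h : α →₁[μ] ℂ, Integrable (fun x => g x * h x) μ →
      Tendsto (fun j => ∫ x, gj j x * h x ∂μ) atTop (𝓝 (∫ x, g x * h x ∂μ)) := fun h hh => by
    refine tendsto_integral_of_dominated_convergence (fun x => ‖g x * h x‖)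
      (fun j => (hgjm j).mul (Lp.aestronglyMeasurable h)) hh.norm
      (fun j => Eventually.of_forall fun x => ?_)
      (Eventually.of_forall fun x => (hlim x).mul_const _)
    rw [norm_mul, norm_mul]
    exact mul_le_mul_of_nonneg_right (hgjg j x) (norm_nonneg _)
  have hlhs := hdct H hHi
  have hj := fun j => integral_bounded_mul_integral (hgjm j) (hgjb j) hF
  have hpt : ∀ᵐ s ∂ρ, Tendsto (fun j => ∫ x, gj j x * F s x ∂μ) atTop
      (𝓝 (∫ x, g x * F s x ∂μ)) := by
    filter_upwards [hFb] with s hs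
    exact hdct _ (hint _ (hs.trans_lt ENNReal.ofReal_lt_top))
  have hle : ∀ j, ∀ᵐ s ∂ρ, ‖∫ x, gj j x * F s x ∂μ‖ ≤ max (b s) 0 := fun j => by
    filter_upwards [hFb] with s hs
    have : ‖∫ x, gj j x * F s x ∂μ‖ₑ ≤ ENNReal.ofReal (b s) := by
      refine (enorm_integral_le_lintegral_enorm _).trans (le_trans ?_ hs)
      refine lintegral_mono fun x => ?_
      rw [enorm_mul]
      gcongr
      exact enorm_le_iff_norm_le.2 (hgjg j x)
    rw [← ofReal_norm] at this
    by_cases h0 : 0 ≤ b s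
    · exact ((ENNReal.ofReal_le_ofReal_iff h0).1 this).trans (le_max_left _ _)
    · rw [ENNReal.ofReal_of_nonpos (not_le.1 h0).le] at this
      exact (ENNReal.ofReal_eq_zero.1 (nonpos_iff_eq_zero.1 this)).trans (le_max_right _ _)
  have hbm : Integrable (fun s => max (b s) 0) ρ := hb.pos_part
  have hrhs := tendsto_integral_of_dominated_convergence (fun s => max (b s) 0)
    (fun j => (hj j).1.aestronglyMeasurable) hbm hle hpt
  refine ⟨hHi, ?_, tendsto_nhds_unique hlhs (hrhs.congr fun j => (hj j).2.symm)⟩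
  refine hbm.mono' (aestronglyMeasurable_of_tendsto_ae atTop
    (fun j => (hj j).1.aestronglyMeasurable) hpt) ?_
  filter_upwards [hpt, ae_all_iff.2 hle] with s h1 h2
  exact le_of_tendsto h1.norm (Eventually.of_forall h2)

end LOne

end CGL

end

noncomputable section

namespace CGL

/-! ### The Gaussian kernel -/

variable {n : ℕ}

/-- The space `ℝⁿ`. -/
abbrev Euc (n : ℕ) := EuclideanSpace ℝ (Fin n)

/-- The space `L¹(ℝⁿ; ℂ)`. -/
abbrev LOne (n : ℕ) := Euc n →₁[(volume : Measure (Euc n))] ℂ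

/-- The decay rate of `|G_ν|`. -/
def rate (ν : ℂ) : ℝ := ((4 * ν)⁻¹).re

theorem ne_zero_of_re_pos {ν : ℂ} (hν : 0 < ν.re) : ν ≠ 0 := by
  rintro rfl
  simp at hν

theorem rate_pos {ν : ℂ} (hν : 0 < ν.re) : 0 < rate ν := by
  have h4 : (0 : ℝ) < (4 * ν).re := by simpa using hν
  rw [rate, Complex.inv_re]
  exact div_pos h4 (Complex.normSq_pos.2 (ne_zero_of_re_pos h4))

theorem norm_gaussian (ν : ℂ) (x : Euc n) :
    ‖gaussian ν x‖ = ‖(4 * (Real.pi : ℂ) * ν) ^ (-(n : ℂ) / 2)‖ * Real.exp (-(rate ν * ‖x‖ ^ 2)) := by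
  rw [gaussian, norm_mul, Complex.norm_exp]
  congr 3
  rw [rate, neg_div, Complex.neg_re, div_eq_mul_inv, ← Complex.ofReal_pow, Complex.re_ofReal_mul]
  ring

theorem continuous_gaussian (ν : ℂ) : Continuous (gaussian ν : Euc n → ℂ) := by
  unfold gaussian
  fun_prop

/-- The supremum of `|G_ν|`. -/
def gaussSup (n : ℕ) (ν : ℂ) : ℝ := ‖(4 * (Real.pi : ℂ) * ν) ^ (-(n : ℂ) / 2)‖

theorem gaussSup_nonneg (n : ℕ) (ν : ℂ) : 0 ≤ gaussSup n ν := norm_nonneg _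

theorem norm_gaussian_le {ν : ℂ} (hν : 0 < ν.re) (x : Euc n) : ‖gaussian ν x‖ ≤ gaussSup n ν := by
  rw [norm_gaussian]
  refine mul_le_of_le_one_right (norm_nonneg _) (Real.exp_le_one_iff.2 ?_)
  have := mul_nonneg (rate_pos hν).le (sq_nonneg ‖x‖)
  linarith

/-- `r^k ≤ 1 + (r²)^k`, and `(b r²)^k / k!` is a single term of the exponential series. -/
theorem pow_le_const_mul_exp {b : ℝ} (hb : 0 < b) (k : ℕ) :
    ∃ C : ℝ, 0 ≤ C ∧ ∀ r : ℝ, 0 ≤ r → r ^ k ≤ C * Real.exp (b * r ^ 2) := by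
  refine ⟨1 + k.factorial * b⁻¹ ^ k, by positivity, fun r hr => ?_⟩
  have h1 : r ^ k ≤ 1 + (r ^ 2) ^ k := by
    rcases le_total r 1 with h | h
    · exact (pow_le_one₀ hr h).trans (le_add_of_nonneg_right (by positivity))
    · calc r ^ k ≤ (r ^ 2) ^ k := by gcongr; nlinarith
        _ ≤ _ := by linarith
  have h2 : (b * r ^ 2) ^ k / k.factorial ≤ Real.exp (b * r ^ 2) :=
    Real.pow_div_factorial_le_exp _ (by positivity) _
  have h3 : (1 : ℝ) ≤ Real.exp (b * r ^ 2) := Real.one_le_exp (by positivity)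
  have h4 : (r ^ 2) ^ k ≤ k.factorial * b⁻¹ ^ k * Real.exp (b * r ^ 2) := by
    calc (r ^ 2) ^ k = k.factorial * b⁻¹ ^ k * ((b * r ^ 2) ^ k / k.factorial) := by
          have hf : (k.factorial : ℝ) ≠ 0 := by positivity
          have hbk : b⁻¹ ^ k * b ^ k = 1 := by rw [← mul_pow, inv_mul_cancel₀ hb.ne', one_pow]
          rw [mul_pow, mul_div_assoc', mul_assoc (k.factorial : ℝ), mul_div_assoc,
            mul_div_cancel₀ _ hf, ← mul_assoc, hbk, one_mul]
      _ ≤ _ := by gcongr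
  nlinarith

theorem integrable_exp_neg_norm_sq {b : ℝ} (hb : 0 < b) :
    Integrable (fun x : Euc n => Real.exp (-(b * ‖x‖ ^ 2))) := by
  have h := GaussianFourier.integrable_cexp_neg_mul_sq_norm_add
    (V := Euc n) (b := b) (by simpa using hb) 0 0
  refine h.norm.congr (Eventually.of_forall fun x => ?_)
  simp only [zero_mul, add_zero, Complex.norm_exp]
  congr 1
  rw [← Complex.ofReal_pow, ← Complex.ofReal_neg, Complex.re_ofReal_mul, Complex.ofReal_re]
  ring

theorem integrable_pow_mul_exp_neg_norm_sq {b : ℝ} (hb : 0 < b) (k : ℕ) :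
    Integrable (fun x : Euc n => ‖x‖ ^ k * Real.exp (-(b * ‖x‖ ^ 2))) := by
  obtain ⟨C, hC0, hC⟩ := pow_le_const_mul_exp (half_pos hb) k
  refine ((integrable_exp_neg_norm_sq (n := n) (half_pos hb)).const_mul C).mono'
    (by fun_prop) (Eventually.of_forall fun x => ?_)
  rw [Real.norm_of_nonneg (by positivity)]
  calc ‖x‖ ^ k * Real.exp (-(b * ‖x‖ ^ 2))
      ≤ C * Real.exp (b / 2 * ‖x‖ ^ 2) * Real.exp (-(b * ‖x‖ ^ 2)) := by
        gcongr
        exact hC _ (norm_nonneg _)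
    _ = C * Real.exp (-(b / 2 * ‖x‖ ^ 2)) := by
        rw [mul_assoc, ← Real.exp_add]
        congr 2
        ring

/-- The moments `∫ |z|^k |G_ν|`. -/
def gaussMoment (n : ℕ) (ν : ℂ) (k : ℕ) : ℝ := ∫ z : Euc n, ‖z‖ ^ k * ‖gaussian ν z‖

theorem gaussMoment_nonneg (n : ℕ) (ν : ℂ) (k : ℕ) : 0 ≤ gaussMoment n ν k :=
  integral_nonneg fun _ => by positivity

theorem integrable_gaussMoment {ν : ℂ} (hν : 0 < ν.re) (k : ℕ) :
    Integrable (fun z : Euc n => ‖z‖ ^ k * ‖gaussian ν z‖) := by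
  refine ((integrable_pow_mul_exp_neg_norm_sq (n := n) (rate_pos hν) k).const_mul
    (gaussSup n ν)).congr (Eventually.of_forall fun x => ?_)
  dsimp only
  rw [norm_gaussian, gaussSup]
  ring

theorem gaussMoment_zero (n : ℕ) (ν : ℂ) : gaussMoment n ν 0 = ∫ z : Euc n, ‖gaussian ν z‖ := by
  simp [gaussMoment]

theorem integral_gaussian {ν : ℂ} (hν : 0 < ν.re) : ∫ z : Euc n, gaussian ν z = 1 := by
  have hν0 := ne_zero_of_re_pos hν
  have h := GaussianFourier.integral_cexp_neg_mul_sq_norm (V := Euc n) (b := (4 * ν)⁻¹) (rate_pos hν)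
  have h1 : ∀ z : Euc n, gaussian ν z =
      (4 * (Real.pi : ℂ) * ν) ^ (-(n : ℂ) / 2) * Complex.exp (-(4 * ν)⁻¹ * ‖z‖ ^ 2) := fun z => by
    rw [gaussian]
    congr 2
    rw [div_eq_mul_inv]
    ring
  simp_rw [h1]
  rw [integral_const_mul, h, finrank_euclideanSpace_fin]
  have h2 : (Real.pi : ℂ) / (4 * ν)⁻¹ = 4 * Real.pi * ν := by
    rw [div_inv_eq_mul]
    ring
  rw [h2, neg_div, Complex.cpow_neg]
  refine inv_mul_cancel₀ ?_
  rw [Complex.cpow_def_of_ne_zero]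
  · exact Complex.exp_ne_zero _
  · have : (Real.pi : ℂ) ≠ 0 := by exact_mod_cast Real.pi_ne_zero
    simp [hν0, this]

/-- A positive factor `t` does not change the argument, so on the principal branch the logarithm
splits off `log t` and the power factorises. -/
theorem gaussian_scale {ν : ℂ} (hν : 0 < ν.re) {t : ℝ} (ht : 0 < t) (x : Euc n) :
    gaussian ((t : ℂ) * ν) x =
      ((t ^ (-(n : ℝ) / 2) : ℝ) : ℂ) * gaussian ν (t ^ (-(1 : ℝ) / 2) • x) := by
  have hν0 := ne_zero_of_re_pos hν
  have hpi : (Real.pi : ℂ) ≠ 0 := by exact_mod_cast Real.pi_ne_zero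
  have h0 : 4 * (Real.pi : ℂ) * ν ≠ 0 := by simp [hν0, hpi]
  have ht0 : (t : ℂ) ≠ 0 := by exact_mod_cast ht.ne'
  unfold gaussian
  rw [show 4 * (Real.pi : ℂ) * (t * ν) = t * (4 * Real.pi * ν) by ring,
    Complex.cpow_def_of_ne_zero (mul_ne_zero ht0 h0), Complex.log_ofReal_mul ht h0, add_mul,
    Complex.exp_add, ← Complex.cpow_def_of_ne_zero h0, mul_assoc]
  congr 1
  · rw [Complex.ofReal_log ht.le, ← Complex.cpow_def_of_ne_zero ht0, Complex.ofReal_cpow ht.le]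
    push_cast
    rfl
  · congr 2
    have h2 : ((t ^ (-(1 : ℝ) / 2)) ^ 2 : ℝ) = t⁻¹ := by
      rw [← Real.rpow_natCast, ← Real.rpow_mul ht.le]
      norm_num
      exact Real.rpow_neg_one t
    rw [norm_smul, Real.norm_of_nonneg (by positivity), ← Complex.ofReal_pow,
      ← Complex.ofReal_pow, mul_pow, h2]
    push_cast
    field_simp

theorem norm_gaussian_scale_le {ν : ℂ} (hν : 0 < ν.re) {t : ℝ} (ht : 0 < t) (x : Euc n) :
    ‖gaussian ((t : ℂ) * ν) x‖ ≤ gaussSup n ν * t ^ (-(n : ℝ) / 2) := by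
  rw [gaussian_scale hν ht, norm_mul, Complex.norm_real, Real.norm_of_nonneg (by positivity), mul_comm]
  gcongr
  exact norm_gaussian_le hν _

/-! ### The semigroup on `L¹` -/

/-- Translation of an element of `L¹`. -/
def translate (a : Euc n) (g : LOne n) : LOne n :=
  Lp.compMeasurePreserving (fun x => x - a) (measurePreserving_sub_right volume a) g

theorem translate_ae (a : Euc n) (g : LOne n) : translate a g =ᵐ[volume] fun x => g (x - a) :=
  Lp.coeFn_compMeasurePreserving _ _

theorem norm_translate (a : Euc n) (g : LOne n) : ‖translate a g‖ = ‖g‖ :=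
  Lp.norm_compMeasurePreserving _ _

theorem translate_zero (g : LOne n) : translate 0 g = g := by
  refine Lp.ext ((translate_ae 0 g).trans ?_)
  simp

theorem translate_sub (a : Euc n) (g h : LOne n) :
    translate a (g - h) = translate a g - translate a h := map_sub _ _ _

theorem continuous_translate {Z : Type*} [TopologicalSpace Z] {a : Z → Euc n} {g : Z → LOne n}
    (ha : Continuous a) (hg : Continuous g) : Continuous fun z => translate (a z) (g z) := by
  have h : Continuous fun z => (⟨fun x => x - a z, by fun_prop⟩ : C(Euc n, Euc n)) :=
    ContinuousMap.continuous_of_continuous_uncurry _ (by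
      simp only [Function.uncurry_def, ContinuousMap.coe_mk]
      fun_prop)
  exact hg.compMeasurePreservingLp h (fun z => measurePreserving_sub_right volume (a z))
    ENNReal.one_ne_top

/-- The semigroup `e^{tνΔ}` on `L¹`, as an `L¹`-valued integral of translations. -/
def heat (ν : ℂ) (t : ℝ) (g : LOne n) : LOne n := ∫ z, gaussian ν z • translate (√t • z) g

theorem integrable_heat {ν : ℂ} (hν : 0 < ν.re) (t : ℝ) (g : LOne n) :
    Integrable fun z => gaussian ν z • translate (√t • z) g := by
  refine ((integrable_gaussian hν).norm.mul_const ‖g‖).mono'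
    (Continuous.aestronglyMeasurable ?_) (Eventually.of_forall fun z => ?_)
  · exact (continuous_gaussian ν).smul (continuous_translate (by fun_prop) continuous_const)
  · rw [norm_smul, norm_translate]

theorem heat_sub {ν : ℂ} (hν : 0 < ν.re) (t : ℝ) (g h : LOne n) :
    heat ν t (g - h) = heat ν t g - heat ν t h := by
  simp only [heat]
  rw [← integral_sub (integrable_heat hν t g) (integrable_heat hν t h)]
  simp only [translate_sub, smul_sub]

theorem norm_heat_le (ν : ℂ) (t : ℝ) (g : LOne n) :
    ‖heat ν t g‖ ≤ gaussMoment n ν 0 * ‖g‖ := by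
  rw [gaussMoment_zero, ← integral_mul_const]
  refine (norm_integral_le_integral_norm _).trans_eq ?_
  simp only [norm_smul, norm_translate]

/-- In the definition of `heat` the kernel is fixed and time enters only through the translation by
`√t z`. Dominated convergence and the continuity of translations in `L¹` thus give joint continuity
in time and data, up to and including `t = 0`. -/
theorem continuous_heat {ν : ℂ} (hν : 0 < ν.re) :
    Continuous fun p : ℝ × LOne n => heat ν p.1 p.2 := by
  refine continuous_iff_continuousAt.2 fun p₀ => ?_
  refine continuousAt_of_dominated (bound := fun z => ‖gaussian ν z‖ * (‖p₀.2‖ + 1))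
    (Eventually.of_forall fun p => (integrable_heat hν p.1 p.2).aestronglyMeasurable) ?_
    ((integrable_gaussian hν).norm.mul_const _) ?_
  · have : ∀ᶠ p : ℝ × LOne n in 𝓝 p₀, ‖p.2‖ < ‖p₀.2‖ + 1 :=
      (continuous_snd.norm.tendsto p₀).eventually_lt_const (by simp)
    filter_upwards [this] with p hp
    refine Eventually.of_forall fun z => ?_
    rw [norm_smul, norm_translate]
    gcongr
  · refine Eventually.of_forall fun z => Continuous.continuousAt ?_
    have hs : Continuous fun p : ℝ × LOne n => √p.1 • z :=
      (Real.continuous_sqrt.comp continuous_fst).smul continuous_const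
    exact (continuous_translate hs continuous_snd).const_smul (gaussian ν z)

/-- The square root of a nonpositive real is `0` by convention, so there is no translation and the
kernel has integral one. This matches the convention in `cglSemigroup`. -/
theorem heat_of_nonpos {ν : ℂ} (hν : 0 < ν.re) {t : ℝ} (ht : t ≤ 0) (g : LOne n) :
    heat ν t g = g := by
  simp only [heat, Real.sqrt_eq_zero_of_nonpos ht, zero_smul, translate_zero]
  rw [integral_smul_const, integral_gaussian hν, one_smul]

theorem heat_eq_integral {ν : ℂ} (hν : 0 < ν.re) {t : ℝ} (ht : 0 < t) (g : LOne n) :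
    heat ν t g = ∫ z, gaussian ((t : ℂ) * ν) z • translate z g := by
  have h := Measure.integral_comp_smul (volume : Measure (Euc n))
    (fun z => gaussian ((t : ℂ) * ν) z • translate z g) (√t)
  have hs : 0 < √t := Real.sqrt_pos.2 ht
  have h1 : ∀ z : Euc n, gaussian ((t : ℂ) * ν) (√t • z) =
      ((t ^ (-(n : ℝ) / 2) : ℝ) : ℂ) * gaussian ν z := fun z => by
    rw [gaussian_scale hν ht, smul_smul, Real.sqrt_eq_rpow, ← Real.rpow_add ht]
    norm_num
  have h2 : (√t ^ n)⁻¹ = t ^ (-(n : ℝ) / 2) := by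
    rw [Real.sqrt_eq_rpow, ← Real.rpow_natCast, ← Real.rpow_mul ht.le, ← Real.rpow_neg ht.le]
    congr 1
    ring
  have h3 : 0 < t ^ (-(n : ℝ) / 2) := by positivity
  simp only [h1, mul_smul] at h
  rw [integral_smul, finrank_euclideanSpace_fin, h2, abs_of_pos h3] at h
  rw [Complex.coe_smul] at h
  exact smul_right_injective (LOne n) h3.ne' h

theorem coeFn_toL1 {g : Euc n → ℂ} (hg : Integrable g) : toL1 g =ᵐ[volume] g := by
  rw [toL1, dif_pos hg]
  exact hg.coeFn_toL1

theorem toL1_coeFn (g : LOne n) : toL1 (g : Euc n → ℂ) = g :=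
  Lp.ext (coeFn_toL1 (L1.integrable_coeFn g))

theorem integrable_gaussian_scale {ν : ℂ} (hν : 0 < ν.re) {t : ℝ} (ht : 0 < t) :
    Integrable (gaussian ((t : ℂ) * ν) : Euc n → ℂ) :=
  integrable_gaussian (by simpa using mul_pos ht hν)

/-- The pointwise convolution and the `L¹`-valued integral of translates are compared through their
integrals over arbitrary measurable sets: Fubini on one side, pairing with an indicator on the
other. -/
theorem toL1_cglSemigroup {ν : ℂ} (hν : 0 < ν.re) (t : ℝ) {φ : Euc n → ℂ} (hφ : Integrable φ) :
    toL1 (cglSemigroup ν t φ) = heat ν t (toL1 φ) := by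
  by_cases ht : 0 < t
  swap
  · rw [heat_of_nonpos hν (not_lt.1 ht), cglSemigroup, if_neg ht]
  have hG := integrable_gaussian_scale (n := n) hν ht
  have hS := integrable_cglSemigroup hν t hφ
  refine Lp.ext ((coeFn_toL1 hS).trans ?_)
  refine Integrable.ae_eq_of_forall_setIntegral_eq _ _ hS (L1.integrable_coeFn _) fun A hA _ => ?_
  have hint : Integrable fun z => gaussian ((t : ℂ) * ν) z • translate z (toL1 φ) :=
    (hG.norm.mul_const ‖toL1 φ‖).mono' (Continuous.aestronglyMeasurable
      ((continuous_gaussian _).smul (continuous_translate continuous_id continuous_const)))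
      (Eventually.of_forall fun z => by rw [norm_smul, norm_translate])
  have h1 := (integral_bounded_mul_integral (g := A.indicator 1) (C := 1)
    (measurable_one.indicator hA).aestronglyMeasurable
    (fun x => (norm_indicator_le_norm_self _ _).trans (by simp)) hint).2
  have hconv := hG.convolution_integrand (ContinuousLinearMap.mul ℂ ℂ) hφ
  have hind : ∀ h : Euc n → ℂ, ∫ x in A, h x = ∫ x, A.indicator 1 x * h x := fun h => by
    rw [← integral_indicator hA]
    refine integral_congr_ae (Eventually.of_forall fun x => ?_)
    by_cases hx : x ∈ A <;> simp [hx]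
  have hsub : ∀ x, cglSemigroup ν t φ x = ∫ z, gaussian ((t : ℂ) * ν) z * φ (x - z) := fun x => by
    rw [cglSemigroup, if_pos ht, ← integral_sub_left_eq_self _ volume x]
    simp
  have hprod : Integrable (Function.uncurry fun x z : Euc n =>
      A.indicator 1 x * (gaussian ((t : ℂ) * ν) z * φ (x - z))) (volume.prod volume) := by
    refine Integrable.bdd_mul (c := 1) (f := fun q : Euc n × Euc n => A.indicator 1 q.1) hconv
      ((measurable_one.indicator hA).comp measurable_fst).aestronglyMeasurable
      (Eventually.of_forall fun q => (norm_indicator_le_norm_self _ _).trans (by simp))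
  rw [hind, hind, heat_eq_integral hν ht, h1]
  simp_rw [hsub, ← integral_const_mul]
  rw [integral_integral_swap hprod]
  refine integral_congr_ae (Eventually.of_forall fun z => ?_)
  dsimp only
  refine integral_congr_ae ?_
  have hq := (measurePreserving_sub_right (volume : Measure (Euc n)) z).quasiMeasurePreserving.ae_eq_comp
    (coeFn_toL1 hφ)
  filter_upwards [Lp.coeFn_smul (gaussian ((t : ℂ) * ν) z) (translate z (toL1 φ)),
    translate_ae z (toL1 φ), hq] with x hx hx' hx''
  rw [hx, Pi.smul_apply, hx', smul_eq_mul]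
  congr 2
  exact hx''.symm

theorem heat_coeFn {ν : ℂ} (hν : 0 < ν.re) {t : ℝ} (ht : 0 < t) (g : LOne n) :
    heat ν t g =ᵐ[volume] fun x => ∫ y, gaussian ((t : ℂ) * ν) (x - y) * g y := by
  have h := toL1_cglSemigroup hν t (L1.integrable_coeFn g)
  rw [toL1_coeFn] at h
  rw [← h]
  refine (coeFn_toL1 (integrable_cglSemigroup hν t (L1.integrable_coeFn g))).trans ?_
  rw [cglSemigroup, if_pos ht]

theorem heat_ae_le_of_ae_le {ν : ℂ} (hν : 0 < ν.re) (t : ℝ) {g : LOne n} {b : ℝ}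
    (hg : ∀ᵐ x, ‖g x‖ ≤ b) : ∀ᵐ x, ‖heat ν t g x‖ ≤ gaussMoment n ν 0 * b := by
  rw [gaussMoment_zero, ← integral_mul_const]
  refine ae_norm_integral_le (integrable_heat hν t g) ((integrable_gaussian hν).norm.mul_const b)
    (Eventually.of_forall fun z => ?_)
  have hq := (measurePreserving_sub_right (volume : Measure (Euc n)) (√t • z)).quasiMeasurePreserving.ae hg
  filter_upwards [Lp.coeFn_smul (gaussian ν z) (translate (√t • z) g), translate_ae (√t • z) g, hq]
    with x hx hx' hx''
  rw [hx, Pi.smul_apply, hx', norm_smul]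
  gcongr

theorem heat_ae_le {ν : ℂ} (hν : 0 < ν.re) {t : ℝ} (ht : 0 < t) (g : LOne n) :
    ∀ᵐ x, ‖heat ν t g x‖ ≤ gaussSup n ν * t ^ (-(n : ℝ) / 2) * ‖g‖ := by
  filter_upwards [heat_coeFn hν ht g] with x hx
  rw [hx, L1.norm_eq_integral_norm, ← integral_const_mul]
  refine norm_integral_le_of_norm_le ((L1.integrable_coeFn g).norm.const_mul _)
    (Eventually.of_forall fun y => ?_)
  rw [norm_mul]
  gcongr
  exact norm_gaussian_scale_le hν ht _

/-- The weight `|x|^k`. -/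
def powWeight (n k : ℕ) (x : Euc n) : ℝ≥0∞ := ‖x‖ₑ ^ k

theorem measurable_powWeight (n k : ℕ) : Measurable (powWeight n k) := by
  unfold powWeight
  fun_prop

theorem wnorm_translate_le (k : ℕ) (a : Euc n) (g : LOne n) :
    wnorm (powWeight n k) (translate a g) ≤
      2 ^ k * (‖a‖ₑ ^ k * ENNReal.ofReal ‖g‖ + wnorm (powWeight n k) g) := by
  have h1 : wnorm (powWeight n k) (translate a g) = ∫⁻ x, ‖x + a‖ₑ ^ k * ‖g x‖ₑ := by
    rw [← lintegral_sub_right_eq_self _ a]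
    refine lintegral_congr_ae ?_
    filter_upwards [translate_ae a g] with x hx
    rw [hx, powWeight, sub_add_cancel]
  have hm : AEMeasurable (fun x => ‖a‖ₑ ^ k * ((1 : Euc n → ℝ≥0∞) x * ‖g x‖ₑ)) :=
    (measurable_one.aemeasurable.mul (Lp.aestronglyMeasurable g).enorm).const_mul _
  rw [h1, ← wnorm_one, wnorm, wnorm, ← lintegral_const_mul' _ _ (by simp), ← lintegral_add_left' hm,
    ← lintegral_const_mul' _ _ (by simp)]
  refine lintegral_mono fun x => ?_
  dsimp only
  rw [Pi.one_apply, one_mul, ← add_mul, ← mul_assoc]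
  gcongr
  have : ‖x + a‖ₑ ≤ 2 * max ‖a‖ₑ ‖x‖ₑ := by
    rw [two_mul]
    exact (enorm_add_le x a).trans (add_le_add (le_max_right _ _) (le_max_left _ _))
  refine (pow_le_pow_left' this k).trans ?_
  rw [mul_pow]
  gcongr
  rcases le_total ‖a‖ₑ ‖x‖ₑ with h | h
  · rw [max_eq_right h]
    exact le_add_self
  · rw [max_eq_left h]
    exact le_self_add

/-- A translation by `√t z` costs `t^(k/2)|z|^k` times the `L¹` norm, which is then averaged against
`|G_ν|`. -/
theorem wnorm_heat_le {ν : ℂ} (hν : 0 < ν.re) (k : ℕ) {t : ℝ} (ht : 0 ≤ t) {g : LOne n} {a b : ℝ}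
    (ha : 0 ≤ a) (hb : 0 ≤ b) (hga : ‖g‖ ≤ a) (hgb : wnorm (powWeight n k) g ≤ ENNReal.ofReal b) :
    wnorm (powWeight n k) (heat ν t g) ≤
      ENNReal.ofReal (2 ^ k * (gaussMoment n ν k * t ^ ((k : ℝ) / 2) * a + gaussMoment n ν 0 * b)) := by
  refine (wnorm_integral_le (measurable_powWeight n k) (integrable_heat hν t g)).trans ?_
  have hst : √t ^ k = t ^ ((k : ℝ) / 2) := by
    rw [Real.sqrt_eq_rpow, ← Real.rpow_natCast, ← Real.rpow_mul ht]
    congr 1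
    ring
  have hpt : ∀ z : Euc n, wnorm (powWeight n k) (gaussian ν z • translate (√t • z) g) ≤
      ENNReal.ofReal (2 ^ k * (‖z‖ ^ k * ‖gaussian ν z‖ * t ^ ((k : ℝ) / 2) * a +
        ‖gaussian ν z‖ * b)) := fun z => by
    rw [wnorm_smul]
    calc ‖gaussian ν z‖ₑ * wnorm (powWeight n k) (translate (√t • z) g)
        ≤ ENNReal.ofReal ‖gaussian ν z‖ * (2 ^ k * (ENNReal.ofReal (t ^ ((k : ℝ) / 2) * ‖z‖ ^ k) *
            ENNReal.ofReal a + ENNReal.ofReal b)) := by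
          rw [ofReal_norm]
          gcongr
          refine (wnorm_translate_le k _ g).trans ?_
          gcongr
          rw [← hst, ← mul_pow, ← ofReal_norm, norm_smul, Real.norm_of_nonneg (Real.sqrt_nonneg t),
            ENNReal.ofReal_pow (by positivity)]
      _ = _ := by
          rw [← ENNReal.ofReal_mul (by positivity), ← ENNReal.ofReal_add (by positivity) hb,
            show (2 : ℝ≥0∞) ^ k = ENNReal.ofReal (2 ^ k) by
              rw [ENNReal.ofReal_pow (by norm_num)]; norm_num,
            ← ENNReal.ofReal_mul (by positivity), ← ENNReal.ofReal_mul (by positivity)]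
          congr 1
          ring
  refine (lintegral_mono hpt).trans_eq ?_
  have i1 := ((integrable_gaussMoment (n := n) hν k).mul_const (t ^ ((k : ℝ) / 2))).mul_const a
  have i2 := ((integrable_gaussian (n := n) hν).norm.mul_const b)
  have i3 : Integrable fun z : Euc n => 2 ^ k * (‖z‖ ^ k * ‖gaussian ν z‖ * t ^ ((k : ℝ) / 2) * a +
      ‖gaussian ν z‖ * b) := (i1.add i2).const_mul (2 ^ k)
  rw [← ofReal_integral_eq_lintegral_ofReal i3
    (Eventually.of_forall fun z => by dsimp only [Pi.zero_apply]; positivity), integral_const_mul]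
  rw [integral_add i1 i2, integral_mul_const, integral_mul_const, integral_mul_const, gaussMoment_zero]
  rfl

end CGL

end

noncomputable section

namespace CGL

variable {n : ℕ}

/-! ### The nonlinear term on `L¹` -/

/-- The power-type local Lipschitz estimate with a given constant. -/
structure NonlinBound (p K : ℝ) (f : ℂ → ℂ) : Prop where
  one_lt : 1 < p
  const_nonneg : 0 ≤ K
  zero : f 0 = 0
  lip : ∀ ξ η : ℂ, ‖f ξ - f η‖ ≤ K * (‖ξ‖ ^ (p - 1) + ‖η‖ ^ (p - 1)) * ‖ξ - η‖
  continuous : Continuous f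

theorem IsNonlinearity.exists_bound {p : ℝ} (hp : 1 < p) {f : ℂ → ℂ} (hf : IsNonlinearity p f) :
    ∃ K, NonlinBound p K f := by
  obtain ⟨h0, K, hK, h⟩ := id hf
  exact ⟨K, hp, hK.le, h0, h, continuous_nonlinearity hp hf⟩

/-- The nonlinear term `f(g)` as an element of `L¹`. -/
def nonlin (f : ℂ → ℂ) (g : LOne n) : LOne n := toL1 fun x => f (g x)

section nonlin

variable {p K : ℝ} {f : ℂ → ℂ} (hf : NonlinBound p K f)

include hf

theorem NonlinBound.norm_le {B : ℝ} {ξ : ℂ} (hξ : ‖ξ‖ ≤ B) :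
    ‖f ξ‖ ≤ K * B ^ (p - 1) * ‖ξ‖ := by
  have h := hf.lip ξ 0
  have hp := hf.one_lt
  have hK := hf.const_nonneg
  rw [hf.zero, sub_zero, sub_zero, norm_zero, Real.zero_rpow (by linarith), add_zero] at h
  refine h.trans ?_
  gcongr

theorem NonlinBound.integrable {B : ℝ} {g : LOne n} (hg : ∀ᵐ x, ‖g x‖ ≤ B) :
    Integrable fun x => f (g x) := by
  refine ((L1.integrable_coeFn g).norm.const_mul (K * B ^ (p - 1))).mono'
    (hf.continuous.comp_aestronglyMeasurable (Lp.aestronglyMeasurable g)) ?_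
  filter_upwards [hg] with x hx
  exact hf.norm_le hx

theorem NonlinBound.ae_le {B : ℝ} {g : LOne n} (hg : ∀ᵐ x, ‖g x‖ ≤ B) :
    ∀ᵐ x, ‖nonlin f g x‖ ≤ K * B ^ (p - 1) * ‖g x‖ := by
  filter_upwards [hg, coeFn_toL1 (hf.integrable hg)] with x hx hx'
  rw [nonlin, hx']
  exact hf.norm_le hx

theorem NonlinBound.norm_nonlin_sub_le {B : ℝ} {g h : LOne n} (hg : ∀ᵐ x, ‖g x‖ ≤ B)
    (hh : ∀ᵐ x, ‖h x‖ ≤ B) : ‖nonlin f g - nonlin f h‖ ≤ 2 * K * B ^ (p - 1) * ‖g - h‖ := by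
  rw [L1.norm_eq_integral_norm, L1.norm_eq_integral_norm, ← integral_const_mul]
  refine integral_mono_ae (L1.integrable_coeFn _).norm
    ((L1.integrable_coeFn _).norm.const_mul _) ?_
  filter_upwards [hg, hh, coeFn_toL1 (hf.integrable hg), coeFn_toL1 (hf.integrable hh),
    Lp.coeFn_sub g h, Lp.coeFn_sub (nonlin f g) (nonlin f h)] with x h1 h2 h3 h4 h5 h6
  rw [h5, h6, Pi.sub_apply, Pi.sub_apply, nonlin, nonlin, h3, h4]
  refine (hf.lip _ _).trans ?_
  have hp := hf.one_lt
  have hK := hf.const_nonneg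
  have e1 : ‖g x‖ ^ (p - 1) ≤ B ^ (p - 1) := by gcongr
  have e2 : ‖h x‖ ^ (p - 1) ≤ B ^ (p - 1) := by gcongr
  refine mul_le_mul_of_nonneg_right ?_ (norm_nonneg _)
  nlinarith

theorem NonlinBound.continuousOn_nonlin {B : ℝ} {u : ℝ → LOne n} {S : Set ℝ}
    (hu : ContinuousOn u S) (hB : ∀ t ∈ S, ∀ᵐ x, ‖u t x‖ ≤ B) :
    ContinuousOn (fun t => nonlin f (u t)) S := by
  intro t ht
  rw [ContinuousWithinAt, tendsto_iff_norm_sub_tendsto_zero]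
  have h := (tendsto_iff_norm_sub_tendsto_zero.1 (hu t ht)).const_mul (2 * K * B ^ (p - 1))
  rw [mul_zero] at h
  refine squeeze_zero' (Eventually.of_forall fun _ => norm_nonneg _) ?_ h
  filter_upwards [self_mem_nhdsWithin] with s hs
  exact hf.norm_nonlin_sub_le (hB s hs) (hB t ht)

end nonlin

/-! ### Decay estimates -/

/-- The size conditions satisfied at time `t` by a solution of size `R`. -/
structure Sized (M : ℕ) (t R : ℝ) (g : LOne n) : Prop where
  norm_le : ‖g‖ ≤ R
  ae_le : ∀ᵐ x, ‖g x‖ ≤ R * (1 + t) ^ (-(n : ℝ) / 2)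
  wnorm_le : wnorm (powWeight n M) g ≤ ENNReal.ofReal (R * (1 + t) ^ ((M : ℝ) / 2))

namespace Sized

variable {M : ℕ} {t R : ℝ} {g : LOne n}

theorem nonneg (h : Sized M t R g) : 0 ≤ R := (norm_nonneg _).trans h.norm_le

theorem mono (ht : 0 ≤ t) {R' : ℝ} (hR : R ≤ R') (h : Sized M t R g) : Sized M t R' g where
  norm_le := h.norm_le.trans hR
  ae_le := by
    filter_upwards [h.ae_le] with x hx
    refine hx.trans ?_
    gcongr
  wnorm_le := h.wnorm_le.trans (by gcongr)

theorem zero (ht : 0 ≤ t) (hR : 0 ≤ R) : Sized M t R (0 : LOne n) where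
  norm_le := by simpa using hR
  ae_le := by
    filter_upwards [Lp.coeFn_zero ℂ 1 (volume : Measure (Euc n))] with x hx
    rw [hx, Pi.zero_apply, norm_zero]
    positivity
  wnorm_le := by
    have : wnorm (powWeight n M) (0 : LOne n) = 0 := by
      have := wnorm_smul (powWeight n M) 0 (0 : LOne n)
      simpa using this
    rw [this]
    exact zero_le

/-- Closedness in `L¹` alone makes the set in the fixed-point argument complete for the `L¹`
distance, so no contraction in the stronger norms is needed. -/
theorem isClosed (M : ℕ) (t R : ℝ) : IsClosed {g : LOne n | Sized M t R g} := by
  have h : {g : LOne n | Sized M t R g} = {g | ‖g‖ ≤ R} ∩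
      {g | ∀ᵐ x, ‖g x‖ ≤ R * (1 + t) ^ (-(n : ℝ) / 2)} ∩
      {g | wnorm (powWeight n M) g ≤ ENNReal.ofReal (R * (1 + t) ^ ((M : ℝ) / 2))} :=
    Set.ext fun g => ⟨fun h => ⟨⟨h.1, h.2⟩, h.3⟩, fun h => ⟨h.1.1, h.1.2, h.2⟩⟩
  rw [h]
  exact ((isClosed_le continuous_norm continuous_const).inter (isClosed_ae_le _)).inter
    (isClosed_wnorm_le (measurable_powWeight n M) _)

theorem add (ht : 0 ≤ t) {R' : ℝ} {g' : LOne n} (h : Sized M t R g) (h' : Sized M t R' g') :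
    Sized M t (R + R') (g + g') where
  norm_le := (norm_add_le _ _).trans (add_le_add h.norm_le h'.norm_le)
  ae_le := by
    filter_upwards [h.ae_le, h'.ae_le, Lp.coeFn_add g g'] with x h1 h2 h3
    rw [h3, Pi.add_apply, add_mul]
    exact (norm_add_le _ _).trans (add_le_add h1 h2)
  wnorm_le := by
    have h1 := h.nonneg
    have h2 := h'.nonneg
    rw [add_mul, ENNReal.ofReal_add (by positivity) (by positivity)]
    exact (wnorm_add_le (measurable_powWeight n M) _ _).trans (add_le_add h.wnorm_le h'.wnorm_le)

theorem integral (ht : 0 ≤ t) {β : Type*} [MeasurableSpace β] {ρ : Measure β} {F : β → LOne n}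
    (hF : Integrable F ρ) {b : β → ℝ} (hb : Integrable b ρ) (h : ∀ᵐ s ∂ρ, Sized M t (b s) (F s)) :
    Sized M t (∫ s, b s ∂ρ) (∫ s, F s ∂ρ) where
  norm_le := norm_integral_le_of_norm_le hb (h.mono fun s hs => hs.norm_le)
  ae_le := by
    rw [← integral_mul_const]
    exact ae_norm_integral_le hF (hb.mul_const _) (h.mono fun s hs => hs.ae_le)
  wnorm_le := by
    refine (wnorm_integral_le (measurable_powWeight n M) hF).trans ?_
    refine (lintegral_mono_ae (h.mono fun s hs => hs.wnorm_le)).trans_eq ?_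
    rw [← integral_mul_const, ofReal_integral_eq_lintegral_ofReal (hb.mul_const _)]
    filter_upwards [h] with s hs
    have := hs.nonneg
    dsimp only [Pi.zero_apply]
    positivity

/-- Pointwise `|f(g)| ≤ A|g|` with `A = K (R(1+t)^(-n/2))^(p-1)`, so each of the three bounds is
simply multiplied by `A`. -/
theorem nonlin {p K : ℝ} {f : ℂ → ℂ} (hf : NonlinBound p K f) (ht : 0 ≤ t) (h : Sized M t R g) :
    Sized M t (K * R ^ p * (1 + t) ^ (-((n : ℝ) * (p - 1) / 2))) (nonlin f g) := by
  have hR := h.nonneg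
  have hK := hf.const_nonneg
  have hp := hf.one_lt
  set A := K * R ^ (p - 1) * (1 + t) ^ (-((n : ℝ) * (p - 1) / 2)) with hA
  have hA0 : 0 ≤ A := by positivity
  have hAe : K * (R * (1 + t) ^ (-(n : ℝ) / 2)) ^ (p - 1) = A := by
    rw [Real.mul_rpow hR (by positivity), ← Real.rpow_mul (by positivity), hA, ← mul_assoc]
    congr 2
    ring
  have hAR : K * R ^ p * (1 + t) ^ (-((n : ℝ) * (p - 1) / 2)) = A * R := by
    have : R ^ p = R ^ (p - 1) * R := by
      rw [← Real.rpow_add_one' hR (by linarith), sub_add_cancel]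
    rw [this, hA]
    ring
  have hae := hf.ae_le h.ae_le
  rw [hAe] at hae
  rw [hAR]
  refine ⟨?_, ?_, ?_⟩
  · rw [L1.norm_eq_integral_norm]
    calc ∫ x, ‖CGL.nonlin f g x‖ ≤ ∫ x, A * ‖g x‖ :=
          integral_mono_ae (L1.integrable_coeFn _).norm ((L1.integrable_coeFn g).norm.const_mul _) hae
      _ = A * ‖g‖ := by rw [integral_const_mul, L1.norm_eq_integral_norm]
      _ ≤ A * R := by gcongr; exact h.norm_le
  · filter_upwards [hae, h.ae_le] with x h1 h2
    rw [mul_assoc]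
    exact h1.trans (by gcongr)
  · calc wnorm (powWeight n M) (CGL.nonlin f g)
        ≤ ∫⁻ x, ENNReal.ofReal A * (powWeight n M x * ‖g x‖ₑ) := by
          refine lintegral_mono_ae ?_
          filter_upwards [hae] with x hx
          rw [← mul_assoc, mul_comm (ENNReal.ofReal A), mul_assoc]
          gcongr
          rw [← ofReal_norm, ← ofReal_norm, ← ENNReal.ofReal_mul hA0]
          exact ENNReal.ofReal_le_ofReal hx
      _ = ENNReal.ofReal A * wnorm (powWeight n M) g :=
          lintegral_const_mul' _ _ ENNReal.ofReal_ne_top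
      _ ≤ ENNReal.ofReal A * ENNReal.ofReal (R * (1 + t) ^ ((M : ℝ) / 2)) := by
          gcongr
          exact h.wnorm_le
      _ = _ := by rw [← ENNReal.ofReal_mul hA0, ← mul_assoc]

end Sized

/-- The constant in the decay estimates for the semigroup. -/
def heatConst (n : ℕ) (ν : ℂ) (M : ℕ) : ℝ :=
  (1 + 2 ^ ((n : ℝ) / 2)) * (gaussMoment n ν 0 + gaussSup n ν) +
    2 ^ M * (gaussMoment n ν M + gaussMoment n ν 0)

theorem heatConst_nonneg (n : ℕ) (ν : ℂ) (M : ℕ) : 0 ≤ heatConst n ν M := by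
  have := gaussMoment_nonneg n ν 0
  have := gaussMoment_nonneg n ν M
  have := gaussSup_nonneg n ν
  unfold heatConst
  positivity

theorem gaussMoment_le_heatConst (n : ℕ) (ν : ℂ) (M : ℕ) : gaussMoment n ν 0 ≤ heatConst n ν M := by
  have h0 := gaussMoment_nonneg n ν 0
  have hM := gaussMoment_nonneg n ν M
  have hS := gaussSup_nonneg n ν
  have h2 : (0 : ℝ) < 2 ^ ((n : ℝ) / 2) := by positivity
  have h3 : 0 ≤ 2 ^ M * (gaussMoment n ν M + gaussMoment n ν 0) := by positivity
  unfold heatConst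
  nlinarith [mul_nonneg h2.le (add_nonneg h0 hS)]

/-- For the sup norm there are two cases. If `t - s ≥ (1+t)/2`, smoothing from `L¹` gives the rate
`(1+t)^(-n/2)`. Otherwise `1 + s > (1+t)/2`, and the bound already known at time `s` has that rate.
The constant is thus uniform as `s → t`, and no singular factor enters the Duhamel integral. -/
theorem Sized.heat {ν : ℂ} (hν : 0 < ν.re) {M : ℕ} {s t R : ℝ} (hs : 0 ≤ s) (hst : s ≤ t)
    {g : LOne n} (h : Sized M s R g) : Sized M t (heatConst n ν M * R) (heat ν (t - s) g) := by
  have hR := h.nonneg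
  have h0 := gaussMoment_nonneg n ν 0
  have hM := gaussMoment_nonneg n ν M
  have hS := gaussSup_nonneg n ν
  have h2 : (0 : ℝ) < 2 ^ ((n : ℝ) / 2) := by positivity
  have hC := gaussMoment_le_heatConst n ν M
  have h3 : 0 ≤ 2 ^ M * (gaussMoment n ν M + gaussMoment n ν 0) := by positivity
  refine ⟨?_, ?_, ?_⟩
  · exact (norm_heat_le ν _ g).trans (mul_le_mul hC h.norm_le (norm_nonneg _) (heatConst_nonneg n ν M))
  · have key : ∀ r : ℝ, (1 + t) / 2 ≤ r →
        r ^ (-(n : ℝ) / 2) ≤ 2 ^ ((n : ℝ) / 2) * (1 + t) ^ (-(n : ℝ) / 2) := fun r hr => by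
      have ht : 0 < (1 + t) / 2 := by linarith
      have h4 : (0 : ℝ) ≤ n := Nat.cast_nonneg n
      calc r ^ (-(n : ℝ) / 2) ≤ ((1 + t) / 2) ^ (-(n : ℝ) / 2) :=
            Real.rpow_le_rpow_of_nonpos ht hr (by linarith)
        _ = _ := by
            rw [Real.div_rpow (by linarith) (by norm_num), neg_div, Real.rpow_neg (by norm_num : (0 : ℝ) ≤ 2),
              div_inv_eq_mul, mul_comm]
    have h1t : 0 < (1 + t) ^ (-(n : ℝ) / 2) := Real.rpow_pos_of_pos (by linarith) _
    rcases le_or_gt ((1 + t) / 2) (t - s) with hts | hts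
    · filter_upwards [heat_ae_le hν (show 0 < t - s by linarith) g] with x hx
      refine hx.trans ?_
      calc gaussSup n ν * (t - s) ^ (-(n : ℝ) / 2) * ‖g‖
          ≤ gaussSup n ν * (2 ^ ((n : ℝ) / 2) * (1 + t) ^ (-(n : ℝ) / 2)) * R := by
            gcongr
            · exact key _ hts
            · exact h.norm_le
        _ = (2 ^ ((n : ℝ) / 2) * gaussSup n ν) * (R * (1 + t) ^ (-(n : ℝ) / 2)) := by ring
        _ ≤ heatConst n ν M * (R * (1 + t) ^ (-(n : ℝ) / 2)) := by
            gcongr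
            unfold heatConst
            nlinarith [mul_nonneg h2.le h0]
        _ = _ := by ring
    · filter_upwards [heat_ae_le_of_ae_le hν (t - s) h.ae_le] with x hx
      refine hx.trans ?_
      calc gaussMoment n ν 0 * (R * (1 + s) ^ (-(n : ℝ) / 2))
          ≤ gaussMoment n ν 0 * (R * (2 ^ ((n : ℝ) / 2) * (1 + t) ^ (-(n : ℝ) / 2))) := by
            gcongr
            exact key _ (by linarith)
        _ = (2 ^ ((n : ℝ) / 2) * gaussMoment n ν 0) * (R * (1 + t) ^ (-(n : ℝ) / 2)) := by ring
        _ ≤ heatConst n ν M * (R * (1 + t) ^ (-(n : ℝ) / 2)) := by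
            gcongr
            unfold heatConst
            nlinarith [mul_nonneg h2.le hS]
        _ = _ := by ring
  · refine (wnorm_heat_le hν M (sub_nonneg.2 hst) hR (by positivity) h.norm_le h.wnorm_le).trans ?_
    refine ENNReal.ofReal_le_ofReal ?_
    have hts : 0 ≤ t - s := sub_nonneg.2 hst
    have e1 : (t - s) ^ ((M : ℝ) / 2) ≤ (1 + t) ^ ((M : ℝ) / 2) := by gcongr; linarith
    have e2 : (1 + s) ^ ((M : ℝ) / 2) ≤ (1 + t) ^ ((M : ℝ) / 2) := by gcongr
    have e3 : 0 ≤ (1 + t) ^ ((M : ℝ) / 2) := Real.rpow_nonneg (by linarith) _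
    calc 2 ^ M * (gaussMoment n ν M * (t - s) ^ ((M : ℝ) / 2) * R +
          gaussMoment n ν 0 * (R * (1 + s) ^ ((M : ℝ) / 2)))
        ≤ 2 ^ M * (gaussMoment n ν M * (1 + t) ^ ((M : ℝ) / 2) * R +
          gaussMoment n ν 0 * (R * (1 + t) ^ ((M : ℝ) / 2))) := by gcongr
      _ = 2 ^ M * (gaussMoment n ν M + gaussMoment n ν 0) * (R * (1 + t) ^ ((M : ℝ) / 2)) := by ring
      _ ≤ heatConst n ν M * (R * (1 + t) ^ ((M : ℝ) / 2)) := by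
          gcongr
          unfold heatConst
          nlinarith [mul_nonneg h2.le h0, mul_nonneg h2.le hS]
      _ = _ := by ring

/-! ### Existence of small solutions -/

theorem integrableOn_one_add_rpow {σ : ℝ} (hσ : 1 < σ) :
    IntegrableOn (fun s : ℝ => (1 + s) ^ (-σ)) (Ioi 0) := by
  have h := integrable_one_add_norm (E := ℝ) (μ := volume) (r := σ) (by simpa using hσ)
  refine h.integrableOn.congr_fun (fun s hs => ?_) measurableSet_Ioi
  dsimp only
  rw [Real.norm_of_nonneg (le_of_lt hs)]

/-- The integral `∫₀^∞ (1+s)^(-σ) ds`. -/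
def decayMass (σ : ℝ) : ℝ := ∫ s in Ioi (0 : ℝ), (1 + s) ^ (-σ)

theorem decayMass_nonneg (σ : ℝ) : 0 ≤ decayMass σ :=
  setIntegral_nonneg measurableSet_Ioi fun s hs => by
    have : (0 : ℝ) < s := hs
    positivity

theorem setIntegral_one_add_rpow_le {σ : ℝ} (hσ : 1 < σ) (t : ℝ) :
    ∫ s in Ioc 0 t, (1 + s) ^ (-σ) ≤ decayMass σ :=
  setIntegral_mono_set (integrableOn_one_add_rpow hσ)
    ((ae_restrict_iff' measurableSet_Ioi).2 (Eventually.of_forall fun s hs => by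
      have : (0 : ℝ) < s := hs
      dsimp only [Pi.zero_apply]
      positivity))
    Ioc_subset_Ioi_self.eventuallyLE

/-- The Duhamel term. -/
def duhamel (ν : ℂ) (w : ℝ → LOne n) (t : ℝ) : LOne n := ∫ s in (0 : ℝ)..t, heat ν (t - s) (w s)

theorem continuous_heat_comp {ν : ℂ} (hν : 0 < ν.re) {Z : Type*} [TopologicalSpace Z] {a : Z → ℝ}
    {g : Z → LOne n} (ha : Continuous a) (hg : Continuous g) :
    Continuous fun z => heat ν (a z) (g z) :=
  Continuous.comp (g := fun q : ℝ × LOne n => heat ν q.1 q.2) (f := fun z => (a z, g z))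
    (continuous_heat hν) (ha.prodMk hg)

theorem continuous_duhamel {ν : ℂ} (hν : 0 < ν.re) {w : ℝ → LOne n} (hw : Continuous w) :
    Continuous (duhamel ν w) :=
  intervalIntegral.continuous_parametric_intervalIntegral_of_continuous
    (f := fun t s => heat ν (t - s) (w s))
    (continuous_heat_comp hν (continuous_fst.sub continuous_snd) (hw.comp continuous_snd))
    continuous_id

theorem intervalIntegrable_heat {ν : ℂ} (hν : 0 < ν.re) {w : ℝ → LOne n} {t : ℝ} (ht : 0 ≤ t)
    (hw : ContinuousOn w (Icc 0 t)) :
    IntervalIntegrable (fun s => heat ν (t - s) (w s)) volume 0 t := by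
  refine ContinuousOn.intervalIntegrable ?_
  rw [uIcc_of_le ht]
  exact Continuous.comp_continuousOn (g := fun q : ℝ × LOne n => heat ν q.1 q.2)
    (f := fun s => (t - s, w s)) (continuous_heat hν) ((continuous_const.sub continuous_id).continuousOn.prodMk hw)

theorem Sized.duhamel {ν : ℂ} (hν : 0 < ν.re) {M : ℕ} {σ A : ℝ} (hσ : 1 < σ) {w : ℝ → LOne n}
    {t : ℝ} (ht : 0 ≤ t) (hw : ContinuousOn w (Icc 0 t))
    (h : ∀ s, 0 ≤ s → Sized M s (A * (1 + s) ^ (-σ)) (w s)) :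
    Sized M t (heatConst n ν M * A * decayMass σ) (duhamel ν w t) := by
  have hi := intervalIntegrable_heat hν ht hw
  rw [intervalIntegrable_iff_integrableOn_Ioc_of_le ht] at hi
  have hb : Integrable (fun s => heatConst n ν M * A * (1 + s) ^ (-σ)) (volume.restrict (Ioc 0 t)) :=
    ((integrableOn_one_add_rpow hσ).mono_set Ioc_subset_Ioi_self).const_mul _
  have hA : 0 ≤ A := by simpa using (h 0 le_rfl).nonneg
  have hs : Sized M t (∫ s in Ioc 0 t, heatConst n ν M * A * (1 + s) ^ (-σ))
      (∫ s in Ioc 0 t, CGL.heat ν (t - s) (w s)) :=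
    Sized.integral ht hi hb ((ae_restrict_iff' measurableSet_Ioc).2 (Eventually.of_forall fun s hs => by
      have := (h s hs.1.le).heat hν hs.1.le hs.2
      rwa [← mul_assoc] at this))
  rw [CGL.duhamel, intervalIntegral.integral_of_le ht]
  refine hs.mono ht ?_
  rw [integral_const_mul]
  have := heatConst_nonneg n ν M
  gcongr
  exact setIntegral_one_add_rpow_le hσ t

theorem norm_duhamel_sub_le {ν : ℂ} (hν : 0 < ν.re) {σ A : ℝ} (hσ : 1 < σ) (hA : 0 ≤ A)
    {w w' : ℝ → LOne n} {t : ℝ} (ht : 0 ≤ t) (hw : ContinuousOn w (Icc 0 t))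
    (hw' : ContinuousOn w' (Icc 0 t)) (h : ∀ s, 0 ≤ s → ‖w s - w' s‖ ≤ A * (1 + s) ^ (-σ)) :
    ‖duhamel ν w t - duhamel ν w' t‖ ≤ gaussMoment n ν 0 * A * decayMass σ := by
  rw [duhamel, duhamel, ← intervalIntegral.integral_sub (intervalIntegrable_heat hν ht hw)
    (intervalIntegrable_heat hν ht hw')]
  have hb := ((integrableOn_one_add_rpow hσ).mono_set (Ioc_subset_Ioi_self : Ioc 0 t ⊆ _)).const_mul
    (gaussMoment n ν 0 * A)
  have h0 := gaussMoment_nonneg n ν 0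
  rw [intervalIntegral.integral_of_le ht]
  refine (norm_integral_le_of_norm_le hb ((ae_restrict_iff' measurableSet_Ioc).2
    (Eventually.of_forall fun s hs => ?_))).trans ?_
  · rw [← heat_sub hν, mul_assoc]
    refine (norm_heat_le ν _ _).trans ?_
    gcongr
    exact h s hs.1.le
  · rw [integral_const_mul]
    gcongr
    exact setIntegral_one_add_rpow_le hσ t

-- Banach's theorem for bounded continuous curves in `L¹`, defined on the whole line with time
-- frozen at `max t 0`. The first smallness condition keeps the linear part within `R/2`. The second
-- makes the Duhamel part at most `R/4`, and the Lipschitz constant `2 · 1/4 = 1/2`.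
open BoundedContinuousFunction in
theorem exists_fixedPoint {ν : ℂ} (hν : 0 < ν.re) {p K : ℝ} {f : ℂ → ℂ} (hf : NonlinBound p K f)
    (hσ : 1 < (n : ℝ) * (p - 1) / 2) {M : ℕ} {a R : ℝ} {g : LOne n} (hg : Sized M 0 a g)
    (ha : heatConst n ν M * a ≤ R / 2)
    (hR : heatConst n ν M * K * decayMass ((n : ℝ) * (p - 1) / 2) * R ^ (p - 1) ≤ 1 / 4) :
    ∃ u : ℝ → LOne n, Continuous u ∧ (∀ t, Sized M (max t 0) R (u t)) ∧
      ∀ t, 0 ≤ t → u t = heat ν t g + duhamel ν (fun s => nonlin f (u s)) t := by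
  set σ := (n : ℝ) * (p - 1) / 2 with hσd
  have hp := hf.one_lt
  have hK := hf.const_nonneg
  have hC := heatConst_nonneg n ν M
  have hI := decayMass_nonneg σ
  have hR0 : 0 ≤ R := by
    have := mul_nonneg hC hg.nonneg
    linarith
  have hRp : R ^ p = R ^ (p - 1) * R := by
    rw [← Real.rpow_add_one' hR0 (by linarith), sub_add_cancel]
  let Z : Set (ℝ →ᵇ LOne n) := {u | ∀ t, Sized M (max t 0) R (u t)}
  have hZc : IsClosed Z := by
    have : Z = ⋂ t, {u : ℝ →ᵇ LOne n | Sized M (max t 0) R (u t)} := by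
      ext u
      simp [Z]
    rw [this]
    exact isClosed_iInter fun t => (Sized.isClosed M (max t 0) R).preimage
      (continuous_eval_const t)
  have h1 : ∀ s : ℝ, 0 ≤ s → ∀ r, 0 ≤ r → r * (1 + s) ^ (-(n : ℝ) / 2) ≤ r := fun s hs r hr => by
    refine mul_le_of_le_one_right hr (Real.rpow_le_one_of_one_le_of_nonpos (by linarith) ?_)
    have : (0 : ℝ) ≤ n := Nat.cast_nonneg n
    linarith
  have hw : ∀ u ∈ Z, Continuous fun s => nonlin f (u s) := fun u hu =>
    continuousOn_univ.1 (hf.continuousOn_nonlin (B := R) u.continuous.continuousOn fun t _ => by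
      filter_upwards [(hu t).ae_le] with x hx
      exact hx.trans (h1 _ (le_max_right _ _) _ hR0))
  have hZs : ∀ u ∈ Z, ∀ s, 0 ≤ s → Sized M s R (u s) := fun u hu s hs => by
    simpa [max_eq_left hs] using hu s
  have hws : ∀ u ∈ Z, ∀ s, 0 ≤ s → Sized M s (K * R ^ p * (1 + s) ^ (-σ)) (nonlin f (u s)) :=
    fun u hu s hs => (hZs u hu s hs).nonlin hf hs
  let Ψ : (ℝ →ᵇ LOne n) → ℝ → LOne n := fun u t =>
    heat ν (max t 0) g + duhamel ν (fun s => nonlin f (u s)) (max t 0)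
  have hΨc : ∀ u ∈ Z, Continuous (Ψ u) := fun u hu =>
    (continuous_heat_comp hν (continuous_id.max continuous_const) continuous_const).add
      ((continuous_duhamel hν (hw u hu)).comp (continuous_id.max continuous_const))
  have hΨs : ∀ u ∈ Z, ∀ t, Sized M (max t 0) R (Ψ u t) := fun u hu t => by
    have ht : 0 ≤ max t 0 := le_max_right _ _
    have e1 := hg.heat hν le_rfl ht
    rw [sub_zero] at e1
    refine (e1.add ht (Sized.duhamel hν hσ ht (hw u hu).continuousOn (hws u hu))).mono ht ?_
    have e2 : heatConst n ν M * (K * R ^ p) * decayMass σ =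
        heatConst n ν M * K * decayMass σ * R ^ (p - 1) * R := by
      rw [hRp]
      ring
    rw [e2]
    nlinarith
  let Φ : Z → Z := fun u =>
    ⟨BoundedContinuousFunction.ofNormedAddCommGroup (Ψ u) (hΨc u u.2) R
      fun t => (hΨs u u.2 t).norm_le, fun t => hΨs u u.2 t⟩
  have : CompleteSpace Z := hZc.completeSpace_coe
  have : Nonempty Z := ⟨0, fun t => Sized.zero (le_max_right _ _) hR0⟩
  have hcontr : ContractingWith (1 / 2) Φ := by
    refine ⟨by norm_num, LipschitzWith.of_dist_le_mul fun u v => ?_⟩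
    rw [Subtype.dist_eq, BoundedContinuousFunction.dist_le (by positivity)]
    intro t
    have ht : 0 ≤ max t 0 := le_max_right _ _
    have hd : ∀ s, 0 ≤ s → ‖nonlin f (u.1 s) - nonlin f (v.1 s)‖ ≤
        2 * K * R ^ (p - 1) * dist u v * (1 + s) ^ (-σ) := fun s hs => by
      refine (hf.norm_nonlin_sub_le (hZs u u.2 s hs).ae_le (hZs v v.2 s hs).ae_le).trans ?_
      have e1 : (R * (1 + s) ^ (-(n : ℝ) / 2)) ^ (p - 1) = R ^ (p - 1) * (1 + s) ^ (-σ) := by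
        rw [Real.mul_rpow hR0 (by positivity), ← Real.rpow_mul (by positivity), hσd]
        congr 2
        ring
      have e2 : ‖u.1 s - v.1 s‖ ≤ dist u v := by
        rw [← dist_eq_norm]
        exact BoundedContinuousFunction.dist_coe_le_dist s
      rw [e1]
      calc 2 * K * (R ^ (p - 1) * (1 + s) ^ (-σ)) * ‖u.1 s - v.1 s‖
          ≤ 2 * K * (R ^ (p - 1) * (1 + s) ^ (-σ)) * dist u v := by gcongr
        _ = _ := by ring
    have e3 := norm_duhamel_sub_le hν hσ (by positivity) ht (hw u u.2).continuousOn
      (hw v v.2).continuousOn hd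
    have e4 : dist ((Φ u).1 t) ((Φ v).1 t) = ‖duhamel ν (fun s => nonlin f (u.1 s)) (max t 0) -
        duhamel ν (fun s => nonlin f (v.1 s)) (max t 0)‖ := by
      rw [dist_eq_norm]
      change ‖(heat ν (max t 0) g + _) - (heat ν (max t 0) g + _)‖ = _
      rw [add_sub_add_left_eq_sub]
    rw [e4]
    refine e3.trans ?_
    have e5 := gaussMoment_le_heatConst n ν M
    calc gaussMoment n ν 0 * (2 * K * R ^ (p - 1) * dist u v) * decayMass σ
        ≤ heatConst n ν M * (2 * K * R ^ (p - 1) * dist u v) * decayMass σ := by gcongr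
      _ = 2 * (heatConst n ν M * K * decayMass σ * R ^ (p - 1)) * dist u v := by ring
      _ ≤ 2 * (1 / 4) * dist u v := by gcongr
      _ = _ := by norm_num
  set u := hcontr.fixedPoint Φ with hu
  have hfix : Φ u = u := hcontr.fixedPoint_isFixedPt
  refine ⟨u.1, u.1.continuous, u.2, fun t ht => ?_⟩
  have e : (Φ u).1 t = u.1 t := by rw [hfix]
  rw [← e]
  change heat ν (max t 0) g + duhamel ν (fun s => nonlin f (u.1 s)) (max t 0) = _
  rw [max_eq_left ht]

end CGL

end

noncomputable section

namespace CGL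

variable {n : ℕ}

/-! ### Continuity in `L^∞` for positive times -/

theorem norm_gaussian_scale {ν : ℂ} (hν : 0 < ν.re) {t : ℝ} (ht : 0 < t) (x : Euc n) :
    ‖gaussian ((t : ℂ) * ν) x‖ =
      gaussSup n ν * t ^ (-(n : ℝ) / 2) * Real.exp (-(rate ν / t * ‖x‖ ^ 2)) := by
  have h2 : ((t ^ (-(1 : ℝ) / 2)) ^ 2 : ℝ) = t⁻¹ := by
    rw [← Real.rpow_natCast, ← Real.rpow_mul ht.le]
    norm_num
    exact Real.rpow_neg_one t
  rw [gaussian_scale hν ht, norm_mul, Complex.norm_real, Real.norm_of_nonneg (by positivity),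
    norm_gaussian, norm_smul, Real.norm_of_nonneg (by positivity), mul_pow, h2, gaussSup]
  have : rate ν * (t⁻¹ * ‖x‖ ^ 2) = rate ν / t * ‖x‖ ^ 2 := by ring
  rw [this]
  ring

theorem tendsto_integral_gaussian_sub {ν : ℂ} (hν : 0 < ν.re) {t₀ : ℝ} (ht₀ : 0 < t₀) :
    Tendsto (fun t : ℝ => ∫ z : Euc n, ‖gaussian ((t : ℂ) * ν) z - gaussian ((t₀ : ℂ) * ν) z‖)
      (𝓝 t₀) (𝓝 0) := by
  have h0 : ∫ z : Euc n, ‖gaussian ((t₀ : ℂ) * ν) z - gaussian ((t₀ : ℂ) * ν) z‖ = 0 := by simp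
  rw [← h0]
  have hr := rate_pos hν
  have hS := gaussSup_nonneg n ν
  have hev : ∀ᶠ t in 𝓝 t₀, t₀ / 2 < t ∧ t < 2 * t₀ :=
    (eventually_gt_nhds (by linarith)).and (eventually_lt_nhds (by linarith))
  refine tendsto_integral_filter_of_dominated_convergence
    (fun z => 2 * (gaussSup n ν * (t₀ / 2) ^ (-(n : ℝ) / 2) *
      Real.exp (-(rate ν / (2 * t₀) * ‖z‖ ^ 2)))) ?_ ?_ ?_ ?_
  · refine Eventually.of_forall fun t => Continuous.aestronglyMeasurable ?_
    exact ((continuous_gaussian _).sub (continuous_gaussian _)).norm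
  · have key : ∀ t, t₀ / 2 < t → t < 2 * t₀ → ∀ z : Euc n, ‖gaussian ((t : ℂ) * ν) z‖ ≤
        gaussSup n ν * (t₀ / 2) ^ (-(n : ℝ) / 2) * Real.exp (-(rate ν / (2 * t₀) * ‖z‖ ^ 2)) := by
      intro t h1 h2 z
      have ht : 0 < t := by linarith
      rw [norm_gaussian_scale hν ht]
      have e1 : t ^ (-(n : ℝ) / 2) ≤ (t₀ / 2) ^ (-(n : ℝ) / 2) := by
        refine Real.rpow_le_rpow_of_nonpos (by linarith) h1.le ?_
        have : (0 : ℝ) ≤ n := Nat.cast_nonneg n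
        linarith
      have e2 : rate ν / (2 * t₀) ≤ rate ν / t := by gcongr
      gcongr
    filter_upwards [hev] with t ht
    refine Eventually.of_forall fun z => ?_
    rw [norm_norm, two_mul]
    exact (norm_sub_le _ _).trans (add_le_add (key t ht.1 ht.2 z)
      (key t₀ (by linarith) (by linarith) z))
  · exact ((integrable_exp_neg_norm_sq (by positivity)).const_mul _).const_mul 2
  · refine Eventually.of_forall fun z => ContinuousAt.tendsto ?_
    have hc : ContinuousAt (fun t : ℝ => gaussian ((t : ℂ) * ν) z) t₀ := by
      have : (fun t : ℝ => ((t ^ (-(n : ℝ) / 2) : ℝ) : ℂ) * gaussian ν (t ^ (-(1 : ℝ) / 2) • z)) =ᶠ[𝓝 t₀]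
          fun t : ℝ => gaussian ((t : ℂ) * ν) z := by
        filter_upwards [hev] with t ht
        rw [gaussian_scale hν (by linarith)]
      refine ContinuousAt.congr ?_ this
      refine ContinuousAt.mul ?_ ?_
      · exact Complex.continuous_ofReal.continuousAt.comp
          (Real.continuousAt_rpow_const _ _ (Or.inl ht₀.ne'))
      · exact (continuous_gaussian ν).continuousAt.comp
          ((Real.continuousAt_rpow_const _ _ (Or.inl ht₀.ne')).smul continuousAt_const)
    exact (hc.sub continuousAt_const).norm

theorem heat_sub_ae_le {ν : ℂ} (hν : 0 < ν.re) {t t₀ : ℝ} (ht : 0 < t) (ht₀ : 0 < t₀) {g : LOne n}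
    {B : ℝ} (hg : ∀ᵐ x, ‖g x‖ ≤ B) :
    ∀ᵐ x, ‖(heat ν t g - heat ν t₀ g) x‖ ≤
      (∫ z : Euc n, ‖gaussian ((t : ℂ) * ν) z - gaussian ((t₀ : ℂ) * ν) z‖) * B := by
  have hint : ∀ r : ℝ, 0 < r → Integrable fun z => gaussian ((r : ℂ) * ν) z • translate z g :=
    fun r hr => ((integrable_gaussian_scale hν hr).norm.mul_const ‖g‖).mono'
      (Continuous.aestronglyMeasurable
        ((continuous_gaussian _).smul (continuous_translate continuous_id continuous_const)))
      (Eventually.of_forall fun z => by rw [norm_smul, norm_translate])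
  rw [heat_eq_integral hν ht, heat_eq_integral hν ht₀, ← integral_sub (hint t ht) (hint t₀ ht₀),
    ← integral_mul_const]
  simp_rw [← sub_smul]
  refine ae_norm_integral_le ?_
    (((integrable_gaussian_scale hν ht).sub (integrable_gaussian_scale hν ht₀)).norm.mul_const B)
    (Eventually.of_forall fun z => ?_)
  · refine ((hint t ht).sub (hint t₀ ht₀)).congr (Eventually.of_forall fun z => ?_)
    exact (sub_smul _ _ _).symm
  have hq := (measurePreserving_sub_right (volume : Measure (Euc n)) z).quasiMeasurePreserving.ae hg
  filter_upwards [Lp.coeFn_smul (gaussian ((t : ℂ) * ν) z - gaussian ((t₀ : ℂ) * ν) z) (translate z g),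
    translate_ae z g, hq] with x hx hx' hx''
  rw [hx, Pi.smul_apply, hx', norm_smul]
  exact mul_le_mul_of_nonneg_left hx'' (norm_nonneg _)

theorem ae_le_add {g h : LOne n} {a b : ℝ} (hg : ∀ᵐ x, ‖g x‖ ≤ a) (hh : ∀ᵐ x, ‖h x‖ ≤ b) :
    ∀ᵐ x, ‖(g + h) x‖ ≤ a + b := by
  filter_upwards [hg, hh, Lp.coeFn_add g h] with x h1 h2 h3
  rw [h3, Pi.add_apply]
  exact (norm_add_le _ _).trans (add_le_add h1 h2)

theorem ae_le_sub {g h : LOne n} {a b : ℝ} (hg : ∀ᵐ x, ‖g x‖ ≤ a) (hh : ∀ᵐ x, ‖h x‖ ≤ b) :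
    ∀ᵐ x, ‖(g - h) x‖ ≤ a + b := by
  filter_upwards [hg, hh, Lp.coeFn_sub g h] with x h1 h2 h3
  rw [h3, Pi.sub_apply]
  exact (norm_sub_le _ _).trans (add_le_add h1 h2)

theorem duhamel_eq (ν : ℂ) (w : ℝ → LOne n) (t : ℝ) :
    duhamel ν w t = ∫ r in (0 : ℝ)..t, heat ν r (w (t - r)) := by
  rw [duhamel]
  have := intervalIntegral.integral_comp_sub_left (a := 0) (b := t)
    (fun s => heat ν s (w (t - s))) t
  simpa using this

/-- The modulus of continuity of the Duhamel term in `L^∞`. -/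
theorem exists_modulus_duhamel {ν : ℂ} (hν : 0 < ν.re) {w : ℝ → LOne n} (hw : Continuous w)
    {B : ℝ} (hB : ∀ t, ∀ᵐ x, ‖w t x‖ ≤ B) {t₀ : ℝ} (ht₀ : 0 < t₀) :
    ∃ η : ℝ → ℝ, Tendsto η (𝓝 t₀) (𝓝 0) ∧
      ∀ t, ∀ᵐ x, ‖(duhamel ν w t - duhamel ν w t₀) x‖ ≤ η t := by
  have hB0 : 0 ≤ B := by
    obtain ⟨x, hx⟩ := (hB 0).exists
    exact (norm_nonneg _).trans hx
  have hG := gaussMoment_nonneg n ν 0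
  have hS := gaussSup_nonneg n ν
  -- The second entry, from smoothing, tends to zero as `t → t₀` because `w` is continuous in `L¹`,
  -- but `r^(-n/2)` need not be integrable at `0`. The first entry, from the sup bound on `w`,
  -- supplies a constant majorant.
  set b : ℝ → ℝ → ℝ := fun t r => min (gaussMoment n ν 0 * (B + B))
    (gaussSup n ν * r ^ (-(n : ℝ) / 2) * ‖w (t - r) - w (t₀ - r)‖) with hb
  have hbm : ∀ t, AEStronglyMeasurable (b t) (volume.restrict (Ioc 0 t₀)) := fun t => by
    refine Measurable.aestronglyMeasurable ?_
    refine measurable_const.min ((measurable_const.mul (measurable_id.pow_const _)).mul ?_)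
    exact Continuous.measurable (by fun_prop)
  have hb0 : ∀ t r, 0 < r → 0 ≤ b t r := fun t r hr => by
    refine le_min (by positivity) (by positivity)
  have hbb : ∀ t, ∀ᵐ r ∂(volume.restrict (Ioc 0 t₀)), ‖b t r‖ ≤ gaussMoment n ν 0 * (B + B) :=
    fun t => (ae_restrict_iff' measurableSet_Ioc).2 (Eventually.of_forall fun r hr => by
      rw [Real.norm_of_nonneg (hb0 t r hr.1)]
      exact min_le_left _ _)
  have hbi : ∀ t, Integrable (b t) (volume.restrict (Ioc 0 t₀)) := fun t =>
    (integrable_const _).mono' (hbm t) (hbb t)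
  refine ⟨fun t => (∫ r in Ioc 0 t₀, b t r) + gaussMoment n ν 0 * B * |t - t₀|, ?_, fun t => ?_⟩
  · have h1 : Tendsto (fun t => ∫ r in Ioc 0 t₀, b t r) (𝓝 t₀) (𝓝 (∫ r in Ioc 0 t₀, (0 : ℝ))) := by
      refine tendsto_integral_filter_of_dominated_convergence (fun _ => gaussMoment n ν 0 * (B + B))
        (Eventually.of_forall hbm) (Eventually.of_forall hbb) (integrable_const _)
        (Eventually.of_forall fun r => ?_)
      have hc : Continuous fun t => b t r := by
        simp only [hb]
        fun_prop
      have := hc.tendsto t₀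
      simpa [hb, min_eq_right (mul_nonneg hG (add_nonneg hB0 hB0))] using this
    have h2 : Tendsto (fun t => gaussMoment n ν 0 * B * |t - t₀|) (𝓝 t₀) (𝓝 0) := by
      have hc : Continuous fun t => gaussMoment n ν 0 * B * |t - t₀| := by fun_prop
      simpa using hc.tendsto t₀
    simpa using h1.add h2
  · have hc : ∀ t, Continuous fun r => heat ν r (w (t - r)) := fun t =>
      continuous_heat_comp hν continuous_id (hw.comp (continuous_const.sub continuous_id))
    -- With the semigroup time `r = t - s` as variable, the two Duhamel terms share the kernel on
    -- `(0, t₀]`, and what remains is an integral over an interval of length `|t - t₀|`.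
    have e1 : duhamel ν w t - duhamel ν w t₀ =
        (∫ r in Ioc 0 t₀, (heat ν r (w (t - r)) - heat ν r (w (t₀ - r)))) +
          ∫ r in t₀..t, heat ν r (w (t - r)) := by
      rw [← intervalIntegral.integral_of_le ht₀.le, duhamel_eq, duhamel_eq,
        intervalIntegral.integral_sub ((hc t).intervalIntegrable _ _) ((hc t₀).intervalIntegrable _ _),
        ← intervalIntegral.integral_add_adjacent_intervals ((hc t).intervalIntegrable 0 t₀)
          ((hc t).intervalIntegrable t₀ t)]
      abel
    rw [e1]
    refine ae_le_add ?_ ?_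
    · refine ae_norm_integral_le (((hc t).sub (hc t₀)).integrableOn_Ioc) (hbi t)
        ((ae_restrict_iff' measurableSet_Ioc).2 (Eventually.of_forall fun r hr => ?_))
      rw [Pi.sub_apply, ← heat_sub hν]
      filter_upwards [heat_ae_le_of_ae_le hν r (ae_le_sub (hB (t - r)) (hB (t₀ - r))),
        heat_ae_le hν hr.1 (w (t - r) - w (t₀ - r))] with x h1 h2
      exact le_min h1 h2
    · have key : ∀ a c : ℝ, ∀ᵐ x, ‖(∫ r in Ioc a c, heat ν r (w (t - r))) x‖ ≤
          gaussMoment n ν 0 * B * |c - a| := fun a c => by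
        have h := ae_norm_integral_le (hc t).integrableOn_Ioc
          (integrable_const (μ := volume.restrict (Ioc a c)) (gaussMoment n ν 0 * B))
          (Eventually.of_forall fun r => heat_ae_le_of_ae_le hν r (hB (t - r)))
        filter_upwards [h] with x hx
        refine hx.trans ?_
        rw [setIntegral_const, smul_eq_mul, mul_comm, Real.volume_real_Ioc]
        gcongr
        exact max_le (le_abs_self _) (abs_nonneg _)
      rcases le_total t₀ t with h | h
      · rw [intervalIntegral.integral_of_le h]
        exact key t₀ t
      · rw [intervalIntegral.integral_of_ge h, abs_sub_comm]
        filter_upwards [key t t₀, Lp.coeFn_neg (∫ r in Ioc t t₀, heat ν r (w (t - r)))] with x h1 h2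
        rw [h2, Pi.neg_apply, norm_neg]
        exact h1

/-! ### Representatives in `L^∞` and the mild formulation -/

open Classical in
/-- An essentially bounded element of `L¹`, as an element of `L^∞`. -/
def toLinfty (g : LOne n) : Lp ℂ ∞ (volume : Measure (Euc n)) :=
  if h : MemLp g ∞ volume then h.toLp g else 0

theorem coeFn_toLinfty {g : LOne n} {B : ℝ} (hg : ∀ᵐ x, ‖g x‖ ≤ B) :
    toLinfty g =ᵐ[volume] g := by
  have h : MemLp g ∞ volume := memLp_top_of_bound (Lp.aestronglyMeasurable g) B hg
  rw [toLinfty, dif_pos h]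
  exact h.coeFn_toLp

theorem norm_Linfty_le {v : Lp ℂ ∞ (volume : Measure (Euc n))} {B : ℝ} (hB : 0 ≤ B)
    (hv : ∀ᵐ x, ‖v x‖ ≤ B) : ‖v‖ ≤ B := by
  rw [Lp.norm_def, eLpNorm_exponent_top]
  exact ENNReal.toReal_le_of_le_ofReal hB (eLpNormEssSup_le_of_ae_bound hv)

theorem ae_le_norm_Linfty (v : Lp ℂ ∞ (volume : Measure (Euc n))) : ∀ᵐ x, ‖v x‖ ≤ ‖v‖ := by
  have hfin : eLpNormEssSup v (volume : Measure (Euc n)) ≠ ∞ := by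
    rw [← eLpNorm_exponent_top]
    exact Lp.eLpNorm_ne_top v
  filter_upwards [enorm_ae_le_eLpNormEssSup v volume] with x hx
  rw [Lp.norm_def, eLpNorm_exponent_top]
  simpa using ENNReal.toReal_mono hfin hx

/-- The mild formulation of the equation, in terms of the semigroup on `L¹`. -/
def IsMild (ν : ℂ) (f : ℂ → ℂ) (g : LOne n) (u : ℝ → LOne n) : Prop :=
  ∀ t, 0 < t → u t = heat ν t g + duhamel ν (fun s => nonlin f (u s)) t

theorem toL1_cglSemigroup_nonlin {ν : ℂ} (hν : 0 < ν.re) {p K : ℝ} {f : ℂ → ℂ}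
    (hf : NonlinBound p K f) {B : ℝ} {g : LOne n} (hg : ∀ᵐ x, ‖g x‖ ≤ B) (t : ℝ) :
    toL1 (cglSemigroup ν t fun x => f (g x)) = heat ν t (nonlin f g) :=
  toL1_cglSemigroup hν t (hf.integrable hg)

/-- The substantial point is continuity in `L^∞` at positive times. The linear term has it because
`t ↦ G_{tν}` is continuous in `L¹` and the datum is bounded, the Duhamel term by
`exists_modulus_duhamel`. -/
theorem isGlobalSolution_of_isMild {ν : ℂ} (hν : 0 < ν.re) {p K : ℝ} {f : ℂ → ℂ}
    (hf : NonlinBound p K f) {u₀ : Euc n → ℂ} (hu₀ : Integrable u₀) {A B : ℝ}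
    (hu₀B : ∀ᵐ x, ‖u₀ x‖ ≤ A) {u : ℝ → LOne n} (hu : Continuous u) (huB : ∀ t, ‖u t‖ ≤ B)
    (hua : ∀ t, ∀ᵐ x, ‖u t x‖ ≤ B) (hmild : IsMild ν f (toL1 u₀) u) :
    IsGlobalSolution ν f u₀ u := by
  have hB0 : 0 ≤ B := (norm_nonneg _).trans (huB 0)
  have hK := hf.const_nonneg
  have hw : Continuous fun s => nonlin f (u s) :=
    continuousOn_univ.1 (hf.continuousOn_nonlin hu.continuousOn fun t _ => hua t)
  have hwB : ∀ t, ∀ᵐ x, ‖nonlin f (u t) x‖ ≤ K * B ^ (p - 1) * B := fun t => by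
    filter_upwards [hf.ae_le (hua t), hua t] with x h1 h2
    exact h1.trans (by gcongr)
  have hcongr : ∀ t s, toL1 (cglSemigroup ν (t - s) fun x => f (u s x)) =
      heat ν (t - s) (nonlin f (u s)) := fun t s => toL1_cglSemigroup_nonlin hν hf (hua s) _
  refine ⟨⟨hu.continuousOn, ⟨B, fun t _ => huB t⟩, fun t => toLinfty (u t), ?_, ⟨B, fun t _ => ?_⟩,
    fun t _ => coeFn_toLinfty (hua t)⟩, fun t ht => ?_, fun t ht => ?_⟩
  · intro t₀ ht₀
    refine ContinuousAt.continuousWithinAt ?_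
    have ht₀' : 0 < t₀ := ht₀
    obtain ⟨η, hη, hd⟩ := exists_modulus_duhamel hν hw hwB ht₀'
    have hu₀' : ∀ᵐ x, ‖toL1 u₀ x‖ ≤ A := by
      filter_upwards [hu₀B, coeFn_toL1 hu₀] with x h1 h2
      rwa [h2]
    have hη0 : ∀ t, 0 ≤ η t := fun t => by
      obtain ⟨x, hx⟩ := (hd t).exists
      exact (norm_nonneg _).trans hx
    have hA0 : 0 ≤ A := by
      obtain ⟨x, hx⟩ := hu₀B.exists
      exact (norm_nonneg _).trans hx
    rw [ContinuousAt, tendsto_iff_norm_sub_tendsto_zero]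
    have hlim := ((tendsto_integral_gaussian_sub (n := n) hν ht₀').mul_const A).add hη
    rw [zero_mul, add_zero] at hlim
    refine squeeze_zero' (Eventually.of_forall fun _ => norm_nonneg _) ?_ hlim
    filter_upwards [eventually_gt_nhds ht₀'] with t ht
    refine norm_Linfty_le (add_nonneg (mul_nonneg (integral_nonneg fun _ => norm_nonneg _) hA0) (hη0 t)) ?_
    have hsum := ae_le_add (heat_sub_ae_le hν ht ht₀' hu₀') (hd t)
    have e : heat ν t (toL1 u₀) - heat ν t₀ (toL1 u₀) +
        (duhamel ν (fun s => nonlin f (u s)) t - duhamel ν (fun s => nonlin f (u s)) t₀) =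
        u t - u t₀ := by
      rw [hmild t ht, hmild t₀ ht₀']
      abel
    rw [e] at hsum
    filter_upwards [hsum, Lp.coeFn_sub (toLinfty (u t)) (toLinfty (u t₀)), coeFn_toLinfty (hua t),
      coeFn_toLinfty (hua t₀), Lp.coeFn_sub (u t) (u t₀)] with x h1 h2 h3 h4 h5
    rw [h2, Pi.sub_apply, h3, h4]
    rwa [h5, Pi.sub_apply] at h1
  · refine norm_Linfty_le hB0 ?_
    filter_upwards [hua t, coeFn_toLinfty (hua t)] with x h1 h2
    rwa [h2]
  · simp_rw [hcongr]
    exact intervalIntegrable_heat hν ht.le hw.continuousOn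
  · simp_rw [hcongr]
    rw [toL1_cglSemigroup hν t hu₀]
    exact hmild t ht

/-! ### Uniqueness -/

theorem MemX.exists_ae_le {u : ℝ → LOne n} (hu : MemX u) :
    ∃ B : ℝ, ∀ t, 0 < t → ∀ᵐ x, ‖u t x‖ ≤ B := by
  obtain ⟨v, -, ⟨B, hB⟩, hv⟩ := hu.continuous_bounded_Linfty
  refine ⟨B, fun t ht => ?_⟩
  filter_upwards [ae_le_norm_Linfty (v t), hv t ht] with x h1 h2
  rw [← h2]
  exact h1.trans (hB t ht)

/-- Two global solutions share a sup bound `B`, on which `f` is Lipschitz; their `L¹` distance then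
satisfies a linear integral inequality, and Gronwall applies. No smallness is used. -/
theorem IsGlobalSolution.unique {ν : ℂ} (hν : 0 < ν.re) {p K : ℝ} {f : ℂ → ℂ}
    (hf : NonlinBound p K f) {u₀ : Euc n → ℂ} {u v : ℝ → LOne n}
    (hu : IsGlobalSolution ν f u₀ u) (hv : IsGlobalSolution ν f u₀ v) :
    ∀ t, 0 ≤ t → u t = v t := by
  obtain ⟨B₁, hB₁⟩ := hu.memX.exists_ae_le
  obtain ⟨B₂, hB₂⟩ := hv.memX.exists_ae_le
  set B := max B₁ B₂
  have huB : ∀ t, 0 < t → ∀ᵐ x, ‖u t x‖ ≤ B := fun t ht => (hB₁ t ht).mono fun x hx =>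
    hx.trans (le_max_left _ _)
  have hvB : ∀ t, 0 < t → ∀ᵐ x, ‖v t x‖ ≤ B := fun t ht => (hB₂ t ht).mono fun x hx =>
    hx.trans (le_max_right _ _)
  have hB0 : 0 ≤ B := by
    obtain ⟨x, hx⟩ := (huB 1 one_pos).exists
    exact (norm_nonneg _).trans hx
  have hK := hf.const_nonneg
  have hG := gaussMoment_nonneg n ν 0
  set L := gaussMoment n ν 0 * (2 * K * B ^ (p - 1)) with hL
  have hL0 : 0 ≤ L := by positivity
  set d : ℝ → ℝ := fun s => ‖u (max s 0) - v (max s 0)‖ with hd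
  have hdc : Continuous d := by
    have hmax : Continuous fun s : ℝ => max s 0 := continuous_id.max continuous_const
    exact ((hu.memX.continuous_L1.comp_continuous hmax fun s => mem_Ici.2 (le_max_right _ _)).sub
      (hv.memX.continuous_L1.comp_continuous hmax fun s => mem_Ici.2 (le_max_right _ _))).norm
  have hle : ∀ t, 0 < t → d t ≤ L * ∫ s in (0 : ℝ)..t, d s := fun t ht => by
    have e1 : u t - v t = ∫ s in (0 : ℝ)..t, (toL1 (cglSemigroup ν (t - s) fun x => f (u s x)) -
        toL1 (cglSemigroup ν (t - s) fun x => f (v s x))) := by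
      rw [intervalIntegral.integral_sub (hu.integrable_duhamel t ht) (hv.integrable_duhamel t ht),
        hu.integral_eq t ht, hv.integral_eq t ht]
      abel
    have e2 : d t = ‖u t - v t‖ := by simp only [hd, max_eq_left ht.le]
    rw [e2, e1, ← intervalIntegral.integral_const_mul, intervalIntegral.integral_of_le ht.le,
      intervalIntegral.integral_of_le ht.le]
    refine norm_integral_le_of_norm_le (hdc.const_mul L).integrableOn_Ioc
      ((ae_restrict_iff' measurableSet_Ioc).2 (Eventually.of_forall fun s hs => ?_))
    rw [toL1_cglSemigroup_nonlin hν hf (huB s hs.1), toL1_cglSemigroup_nonlin hν hf (hvB s hs.1),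
      ← heat_sub hν]
    refine (norm_heat_le ν _ _).trans ?_
    rw [hL, mul_assoc]
    refine mul_le_mul_of_nonneg_left ?_ hG
    have := hf.norm_nonlin_sub_le (huB s hs.1) (hvB s hs.1)
    simpa only [hd, max_eq_left hs.1.le] using this
  have hIc : Continuous fun t => ∫ s in (0 : ℝ)..t, d s :=
    intervalIntegral.continuous_primitive (fun a b => hdc.intervalIntegrable a b) 0
  have hd0 : ∀ t, 0 ≤ t → d t ≤ L * ∫ s in (0 : ℝ)..t, d s := fun t ht => by
    -- The equation is imposed only for `t > 0`; at `t = 0` the inequality, and with it the equality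
    -- of the initial values, follows by letting `t → 0+`.
    rcases ht.eq_or_lt with rfl | ht
    · refine le_of_tendsto_of_tendsto (b := 𝓝[>] (0 : ℝ)) (hdc.continuousAt.mono_left inf_le_left)
        ((hIc.const_mul L).continuousAt.mono_left inf_le_left) ?_
      filter_upwards [self_mem_nhdsWithin] with t ht
      exact hle t ht
    · exact hle t ht
  have hI0 : ∀ t, 0 ≤ t → 0 ≤ ∫ s in (0 : ℝ)..t, d s := fun t ht =>
    intervalIntegral.integral_nonneg ht fun s _ => norm_nonneg _
  have hI : ∀ t, 0 ≤ t → ∫ s in (0 : ℝ)..t, d s = 0 := fun t ht => by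
    -- Gronwall is applied to the primitive of `d`, which vanishes at `0` and whose derivative `d`
    -- is at most `L` times the primitive itself.
    have h := norm_le_gronwallBound_of_norm_deriv_right_le (a := 0) (b := t) (δ := 0) (K := L) (ε := 0)
      (f' := d) hIc.continuousOn
      (fun s _ => (intervalIntegral.integral_hasDerivAt_right (hdc.intervalIntegrable 0 s)
        (hdc.stronglyMeasurableAtFilter _ _) hdc.continuousAt).hasDerivWithinAt) (by simp)
      (fun s hs => by
        rw [Real.norm_of_nonneg (norm_nonneg _), Real.norm_of_nonneg (hI0 s hs.1), add_zero]
        exact hd0 s hs.1) t ⟨ht, le_rfl⟩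
    rw [gronwallBound_ε0_δ0] at h
    exact norm_le_zero_iff.1 h
  intro t ht
  have h := hd0 t ht
  rw [hI t ht, mul_zero] at h
  have h2 : ‖u t - v t‖ ≤ 0 := by simpa only [hd, max_eq_left ht] using h
  exact sub_eq_zero.1 (norm_le_zero_iff.1 h2)

end CGL

end

noncomputable section

namespace CGL

variable {n : ℕ}

/-! ### Coefficients of `exp (A X² + B X)` -/

section expCoeff

variable {R : Type*} [CommRing R] [Algebra ℂ R]

/-- The coefficient of `X^l` in `exp (A X² + B X)`. -/
def expCoeff (A B : R) (l : ℕ) : R :=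
  ∑ k ∈ Finset.range (l / 2 + 1),
    ((k.factorial : ℂ)⁻¹ * ((l - 2 * k).factorial : ℂ)⁻¹) • (A ^ k * B ^ (l - 2 * k))

theorem expCoeff_zero (A B : R) : expCoeff A B 0 = 1 := by simp [expCoeff]

theorem expCoeff_one (A B : R) : expCoeff A B 1 = B := by simp [expCoeff]

/-- The terms of `expCoeff`, extended by zero. -/
def expTerm (A B : R) (l k : ℕ) : R :=
  if 2 * k ≤ l then
    ((k.factorial : ℂ)⁻¹ * ((l - 2 * k).factorial : ℂ)⁻¹) • (A ^ k * B ^ (l - 2 * k)) else 0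

theorem expCoeff_eq_sum (A B : R) {l N : ℕ} (h : l / 2 + 1 ≤ N) :
    expCoeff A B l = ∑ k ∈ Finset.range N, expTerm A B l k := by
  rw [expCoeff, ← Finset.sum_subset (Finset.range_mono h)]
  · refine Finset.sum_congr rfl fun k hk => ?_
    rw [Finset.mem_range] at hk
    rw [expTerm, if_pos (by omega)]
  · intro k _ hk
    rw [Finset.mem_range] at hk
    rw [expTerm, if_neg (by omega)]

theorem succ_smul_expTerm (A B : R) (l k : ℕ) :
    ((k : ℂ) + 1) • expTerm A B (l + 2) (k + 1) = A * expTerm A B l k := by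
  unfold expTerm
  split_ifs with h1 h2 h2
  · rw [show l + 2 - 2 * (k + 1) = l - 2 * k by omega, smul_smul, Nat.factorial_succ, pow_succ,
      mul_smul_comm]
    have h3 : ((k : ℂ) + 1) * ((((k + 1) * k.factorial : ℕ) : ℂ)⁻¹ * ((l - 2 * k).factorial : ℂ)⁻¹) =
        (k.factorial : ℂ)⁻¹ * ((l - 2 * k).factorial : ℂ)⁻¹ := by
      have h4 : (k : ℂ) + 1 ≠ 0 := by exact_mod_cast k.succ_ne_zero
      push_cast
      rw [mul_inv, ← mul_assoc, ← mul_assoc, mul_inv_cancel₀ h4, one_mul]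
    rw [h3]
    congr 1
    ring
  · omega
  · omega
  · simp

theorem sub_smul_expTerm (A B : R) (l k : ℕ) :
    ((l : ℂ) + 1 - 2 * k) • expTerm A B (l + 1) k = B * expTerm A B l k := by
  unfold expTerm
  split_ifs with h1 h2 h2
  · obtain ⟨r, rfl⟩ := Nat.exists_eq_add_of_le h2
    rw [show 2 * k + r + 1 - 2 * k = r + 1 by omega, show 2 * k + r - 2 * k = r by omega, smul_smul,
      Nat.factorial_succ, pow_succ, mul_smul_comm]
    have h3 : ((2 * k + r : ℕ) : ℂ) + 1 - 2 * k = (r : ℂ) + 1 := by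
      push_cast
      ring
    have h4 : (r : ℂ) + 1 ≠ 0 := by exact_mod_cast r.succ_ne_zero
    have h5 : ((r : ℂ) + 1) * ((k.factorial : ℂ)⁻¹ * (((r + 1) * r.factorial : ℕ) : ℂ)⁻¹) =
        (k.factorial : ℂ)⁻¹ * (r.factorial : ℂ)⁻¹ := by
      push_cast
      rw [mul_inv, mul_left_comm, ← mul_assoc ((r : ℂ) + 1), mul_inv_cancel₀ h4, one_mul]
    rw [h3, h5]
    congr 1
    ring
  · have : (l : ℂ) + 1 - 2 * k = 0 := by
      have h3 : l + 1 = 2 * k := by omega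
      have : ((l + 1 : ℕ) : ℂ) = ((2 * k : ℕ) : ℂ) := by rw [h3]
      push_cast at this
      rw [this, sub_self]
    rw [this, zero_smul, mul_zero]
  · omega
  · simp

/-- The series `E = exp(AX² + BX)` satisfies `E' = (2AX + B)E`; this is the comparison of the
coefficients of `X^(l+1)`. -/
theorem expCoeff_add_two (A B : R) (l : ℕ) :
    ((l : ℂ) + 2) • expCoeff A B (l + 2) = 2 * A * expCoeff A B l + B * expCoeff A B (l + 1) := by
  have hN : ∀ j ≤ l + 2, j / 2 + 1 ≤ l + 3 := fun j hj => by omega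
  rw [expCoeff_eq_sum A B (hN (l + 2) (by omega)), expCoeff_eq_sum A B (N := l + 2) (by omega : l / 2 + 1 ≤ l + 2),
    expCoeff_eq_sum A B (hN (l + 1) (by omega)), Finset.mul_sum, Finset.mul_sum, Finset.smul_sum]
  -- Writing `l + 2 = 2k + (l + 2 - 2k)`, the first part lowers the exponent of `A` and the second
  -- that of `B`.
  have h1 : ∀ k, ((l : ℂ) + 2) • expTerm A B (l + 2) k =
      (2 * (k : ℂ)) • expTerm A B (l + 2) k + B * expTerm A B (l + 1) k := fun k => by
    rw [← sub_smul_expTerm, ← add_smul]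
    congr 1
    push_cast
    ring
  simp_rw [h1]
  rw [Finset.sum_add_distrib]
  congr 1
  rw [Finset.sum_range_succ']
  simp only [Nat.cast_zero, mul_zero, zero_smul, add_zero]
  refine Finset.sum_congr rfl fun k _ => ?_
  rw [mul_assoc, ← succ_smul_expTerm, mul_smul]
  push_cast
  rw [two_mul, two_smul]

end expCoeff

/-! ### Derivatives of the Gaussian kernel -/

/-- The one-dimensional Hermite polynomial. -/
def herm (a : ℕ) (μ x : ℂ) : ℂ := (a.factorial : ℂ) * expCoeff (-μ⁻¹) (x / μ) a

theorem herm_zero (μ x : ℂ) : herm 0 μ x = 1 := by simp [herm, expCoeff_zero]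

theorem herm_one (μ x : ℂ) : herm 1 μ x = x / μ := by simp [herm, expCoeff_one]

/-- The recurrence of `expCoeff` with `A = -1/μ`, `B = x/μ`. For `a = 0` the truncated index `a - 1`
is harmless, since its factor vanishes. -/
theorem herm_succ (a : ℕ) (μ x : ℂ) :
    herm (a + 1) μ x = x / μ * herm a μ x - 2 * a / μ * herm (a - 1) μ x := by
  rcases a with _ | a
  · simp [herm_zero, herm_one]
  · have h := expCoeff_add_two (-μ⁻¹) (x / μ) a
    rw [smul_eq_mul] at h
    rw [herm, herm, herm, Nat.add_sub_cancel, Nat.factorial_succ (a + 1), Nat.factorial_succ a]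
    push_cast
    calc ((a : ℂ) + 1 + 1) * (((a : ℂ) + 1) * a.factorial) * expCoeff (-μ⁻¹) (x / μ) (a + 1 + 1)
        = (((a : ℂ) + 1) * a.factorial) * (((a : ℂ) + 2) * expCoeff (-μ⁻¹) (x / μ) (a + 2)) := by ring
      _ = _ := by
        rw [h]
        ring

/-- The `x`-derivative of `herm`. -/
def hermDeriv (a : ℕ) (μ x : ℂ) : ℂ := a / μ * herm (a - 1) μ x

theorem herm_succ' (a : ℕ) (μ x : ℂ) :
    herm (a + 1) μ x = x / μ * herm a μ x - 2 * hermDeriv a μ x := by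
  rw [herm_succ, hermDeriv]
  ring

/-- The `μ`-derivative is what Euler's identity predicts from the homogeneity `h_a(λ²μ, λx) = λ^(-a)
h_a(μ, x)`. The formula is verified by induction through the three-term recurrence. -/
theorem hasDerivAt_herm {μ x : ℂ → ℂ} {μ' x' θ : ℂ} (hμ : HasDerivAt μ μ' θ) (hx : HasDerivAt x x' θ)
    (h0 : μ θ ≠ 0) (a : ℕ) :
    HasDerivAt (fun s => herm a (μ s) (x s))
      (x' * hermDeriv a (μ θ) (x θ) -
        μ' / (2 * μ θ) * (a * herm a (μ θ) (x θ) + x θ * hermDeriv a (μ θ) (x θ))) θ := by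
  induction a using Nat.twoStepInduction with
  | zero => simpa [herm_zero, hermDeriv] using hasDerivAt_const θ (1 : ℂ)
  | one =>
    simp only [herm_one, hermDeriv, Nat.sub_self, herm_zero]
    convert! hx.div hμ h0 using 1
    field_simp
    push_cast
    ring
  | more a h1 h2 =>
    have e : (fun s => herm (a + 2) (μ s) (x s)) = fun s =>
        x s / μ s * herm (a + 1) (μ s) (x s) - 2 * ((a : ℂ) + 1) / μ s * herm a (μ s) (x s) := by
      funext s
      rw [herm_succ (a + 1)]
      push_cast
      rfl
    rw [e]
    have h3 := ((hx.div hμ h0).mul h2).sub (((hasDerivAt_const θ (2 * ((a : ℂ) + 1))).div hμ h0).mul h1)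
    convert! h3 using 1
    rw [herm_succ (a + 1)]
    simp only [hermDeriv, Nat.add_sub_cancel, show a + 2 - 1 = a + 1 by omega]
    rw [herm_succ a]
    push_cast
    simp only [Pi.div_apply]
    field_simp
    ring

/-- The derivative `∂_x^a` of the one-dimensional Gaussian kernel. -/
def gaussDeriv₁ (a : ℕ) (μ x : ℂ) : ℂ :=
  ((-2) ^ a)⁻¹ * herm a μ x * ((4 * (Real.pi : ℂ) * μ) ^ (-(1 : ℂ) / 2) * Complex.exp (-x ^ 2 / (4 * μ)))

/-- The heat equation `∂_μ G = ∂_x² G` in complex time, differentiated `a` times and read along a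
curve: a time derivative raises the order by two, a space derivative by one. -/
theorem hasDerivAt_gaussDeriv₁ {μ x : ℂ → ℂ} {μ' x' θ : ℂ} (hμ : HasDerivAt μ μ' θ)
    (hx : HasDerivAt x x' θ) (h0 : 0 < (μ θ).re) (a : ℕ) :
    HasDerivAt (fun s => gaussDeriv₁ a (μ s) (x s))
      (μ' * gaussDeriv₁ (a + 2) (μ θ) (x θ) + x' * gaussDeriv₁ (a + 1) (μ θ) (x θ)) θ := by
  have hμ0 := ne_zero_of_re_pos h0
  have hpi : (Real.pi : ℂ) ≠ 0 := by exact_mod_cast Real.pi_ne_zero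
  have hre : 0 < (4 * (Real.pi : ℂ) * μ θ).re := by
    rw [show 4 * (Real.pi : ℂ) * μ θ = ((4 * Real.pi : ℝ) : ℂ) * μ θ by push_cast; ring,
      Complex.re_ofReal_mul]
    have := Real.pi_pos
    positivity
  have h1 := (hμ.const_mul (4 * (Real.pi : ℂ))).cpow_const (c := -(1 : ℂ) / 2) (Or.inl hre)
  have h2 := (((hx.pow 2).neg).div (hμ.const_mul 4) (by simpa using hμ0)).cexp
  have h3 := ((hasDerivAt_herm hμ hx hμ0 a).const_mul ((-2 : ℂ) ^ a)⁻¹).mul (h1.mul h2)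
  convert! h3 using 1
  have hne := ne_zero_of_re_pos hre
  have e1 : (4 * (Real.pi : ℂ) * μ θ) ^ (-(1 : ℂ) / 2 - 1) =
      (4 * (Real.pi : ℂ) * μ θ) ^ (-(1 : ℂ) / 2) / (4 * (Real.pi : ℂ) * μ θ) := by
    rw [Complex.cpow_sub _ _ hne, Complex.cpow_one]
  simp only [gaussDeriv₁, Pi.mul_apply, Pi.div_apply, Pi.neg_apply, Pi.pow_apply, e1]
  rw [herm_succ' a, show herm (a + 2) (μ θ) (x θ) = x θ / μ θ * herm (a + 1) (μ θ) (x θ) -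
    2 * ((a : ℂ) + 1) / μ θ * herm a (μ θ) (x θ) by rw [herm_succ (a + 1)]; push_cast; rfl,
    herm_succ' a]
  generalize (4 * (Real.pi : ℂ) * μ θ) ^ (-(1 : ℂ) / 2) = P
  generalize Complex.exp (-x θ ^ 2 / (4 * μ θ)) = Q
  generalize hermDeriv a (μ θ) (x θ) = H'
  generalize herm a (μ θ) (x θ) = H
  have hp2 : (-2 : ℂ) ^ a ≠ 0 := pow_ne_zero _ (by norm_num)
  rw [pow_succ (-2 : ℂ) (a + 1), pow_succ (-2 : ℂ) a]
  field_simp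
  push_cast
  ring

/-- The derivative `∂^α` of the Gaussian kernel. -/
def gaussDeriv (α : Fin n → ℕ) (μ : ℂ) (x : Fin n → ℂ) : ℂ := ∏ j, gaussDeriv₁ (α j) μ (x j)

theorem hasDerivAt_gaussDeriv {μ : ℂ → ℂ} {x : ℂ → Fin n → ℂ} {μ' θ : ℂ} {x' : Fin n → ℂ}
    (hμ : HasDerivAt μ μ' θ) (hx : ∀ j, HasDerivAt (fun s => x s j) (x' j) θ) (h0 : 0 < (μ θ).re)
    (α : Fin n → ℕ) :
    HasDerivAt (fun s => gaussDeriv α (μ s) (x s))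
      (∑ j, (μ' * gaussDeriv (α + Pi.single j 2) (μ θ) (x θ) +
        x' j * gaussDeriv (α + Pi.single j 1) (μ θ) (x θ))) θ := by
  unfold gaussDeriv
  have h := HasDerivAt.fun_finsetProd (u := Finset.univ) fun j _ =>
    hasDerivAt_gaussDeriv₁ hμ (hx j) h0 (α j)
  convert! h using 1
  refine Finset.sum_congr rfl fun j _ => ?_
  have hk : ∀ k, ∏ i, gaussDeriv₁ ((α + Pi.single j k : Fin n → ℕ) i) (μ θ) (x θ i) =
      (∏ i ∈ Finset.univ.erase j, gaussDeriv₁ (α i) (μ θ) (x θ i)) *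
        gaussDeriv₁ (α j + k) (μ θ) (x θ j) := fun k => by
    rw [← Finset.prod_erase_mul _ _ (Finset.mem_univ j)]
    congr 1
    · refine Finset.prod_congr rfl fun i hi => ?_
      rw [Pi.add_apply, Pi.single_eq_of_ne (Finset.ne_of_mem_erase hi), add_zero]
    · rw [Pi.add_apply, Pi.single_eq_same]
  rw [hk, hk, smul_eq_mul]
  ring

theorem hermite_eq_prod (ν : ℂ) (α : Fin n → ℕ) (x : Euc n) :
    hermite ν α x = ∏ j, herm (α j) ν (x j) := by
  have h1 : ∀ j, herm (α j) ν (x j) = ∑ b ∈ Finset.Iic (α j / 2),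
      (-1) ^ b * ((α j).factorial : ℂ) / ((b.factorial : ℂ) * ((α j - 2 * b).factorial : ℂ)) *
        (ν ^ (α j - b))⁻¹ * (x j : ℂ) ^ (α j - 2 * b) := fun j => by
    rw [herm, expCoeff, Finset.mul_sum, Nat.range_succ_eq_Iic]
    refine Finset.sum_congr rfl fun b hb => ?_
    rw [Finset.mem_Iic] at hb
    rw [show α j - b = b + (α j - 2 * b) by omega, pow_add, mul_inv, smul_eq_mul, div_pow,
      neg_pow, inv_pow]
    simp only [div_eq_mul_inv, mul_inv]
    ring
  have hI : Finset.Iic (fun j => α j / 2) = Fintype.piFinset fun j => Finset.Iic (α j / 2) := by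
    ext β
    simp [Pi.le_def]
  simp_rw [h1]
  rw [Finset.prod_univ_sum, hermite, hI]
  refine Finset.sum_congr rfl fun β _ => ?_
  simp only [Finset.prod_mul_distrib, Finset.prod_div_distrib, Finset.prod_pow_eq_pow_sum,
    Finset.prod_inv_distrib, len, mfact, monom, Pi.sub_apply, Pi.smul_apply, smul_eq_mul]
  push_cast
  rfl

/-- Identifies the functions in the profiles as derivatives of the kernel and accounts for the
powers of `-2` in `Lam`. -/
theorem gaussDeriv_eq (ν : ℂ) (α : Fin n → ℕ) (x : Euc n) :
    gaussDeriv α ν (fun j => x j) = ((-2) ^ len α)⁻¹ * (hermite ν α x * gaussian ν x) := by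
  have hpi : (Real.pi : ℂ) ≠ 0 := by exact_mod_cast Real.pi_ne_zero
  simp only [gaussDeriv, gaussDeriv₁, Finset.prod_mul_distrib, hermite_eq_prod, mul_assoc,
    Finset.prod_inv_distrib, Finset.prod_pow_eq_pow_sum, len, gaussian, Finset.prod_const,
    Finset.card_univ, Fintype.card_fin]
  congr 3
  · rw [← Complex.cpow_nat_mul]
    congr 1
    ring
  · rw [← Complex.exp_sum]
    congr 1
    rw [← Complex.ofReal_pow, EuclideanSpace.norm_sq_eq]
    simp only [Real.norm_eq_abs, sq_abs, neg_div]
    rw [Finset.sum_neg_distrib, ← Finset.sum_div]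
    push_cast
    rfl

theorem gaussDeriv_zero (ν : ℂ) (x : Euc n) :
    gaussDeriv 0 ν (fun j => x j) = gaussian ν x := by
  rw [gaussDeriv_eq, hermite_eq_prod]
  simp [len, herm_zero]

end CGL

end

noncomputable section

namespace CGL

variable {n : ℕ}

/-! ### Parabolic Taylor expansion of the Gaussian kernel -/

/-- The linear functional `X^α ↦ ∂^α G_μ(x)` on polynomials. -/
def evalGauss (μ : ℂ) (x : Fin n → ℂ) : MvPolynomial (Fin n) ℂ →ₗ[ℂ] ℂ :=
  (MvPolynomial.basisMonomials (Fin n) ℂ).constr ℂ fun α => gaussDeriv α μ x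

theorem evalGauss_monomial (μ : ℂ) (x : Fin n → ℂ) (α : Fin n →₀ ℕ) (c : ℂ) :
    evalGauss μ x (MvPolynomial.monomial α c) = c * gaussDeriv α μ x := by
  have h := (MvPolynomial.basisMonomials (Fin n) ℂ).constr_basis ℂ (fun α => gaussDeriv α μ x) α
  rw [MvPolynomial.coe_basisMonomials] at h
  rw [← mul_one c, ← smul_eq_mul, ← MvPolynomial.smul_monomial, map_smul, evalGauss, h, smul_eq_mul,
    smul_eq_mul, mul_one]

/-- The symbol of the time part of the expansion. -/
def timeSymbol (n : ℕ) (ν : ℂ) (σ : ℝ) : MvPolynomial (Fin n) ℂ :=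
  ∑ j, MvPolynomial.monomial (Finsupp.single j 2) (-(σ * ν))

/-- The symbol of the space part of the expansion. -/
def spaceSymbol (y : Euc n) : MvPolynomial (Fin n) ℂ :=
  ∑ j, MvPolynomial.monomial (Finsupp.single j 1) (-(y j : ℂ))

/-- The functional `evalGauss` along a parabolic curve starting at `(ν, z)`. -/
def evalCurve (ν : ℂ) (σ : ℝ) (z y : Euc n) (θ : ℝ) : MvPolynomial (Fin n) ℂ →ₗ[ℂ] ℂ :=
  evalGauss (((1 - θ ^ 2 * σ : ℝ) : ℂ) * ν) fun j => ((z - θ • y) j : ℂ)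

/-- Under `X^α ↔ ∂^α`, moving along `θ ↦ ((1 - θ²σ)ν, z - θy)` acts as multiplication by `2θA + B`,
where `A` and `B` are the time and space symbols. Time moves quadratically in `θ` and space
linearly, so the degree in `θ` is the parabolic degree, and the expansion reduces to the algebra of
`exp(Aθ² + Bθ)`. -/
theorem hasDerivAt_evalCurve {ν : ℂ} (hν : 0 < ν.re) {σ : ℝ} (z y : Euc n) {θ : ℝ}
    (hθ : 0 < 1 - θ ^ 2 * σ) (P : MvPolynomial (Fin n) ℂ) :
    HasDerivAt (fun s => evalCurve ν σ z y s P)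
      (2 * θ * evalCurve ν σ z y θ (P * timeSymbol n ν σ) +
        evalCurve ν σ z y θ (P * spaceSymbol y)) θ := by
  induction P using MvPolynomial.induction_on' with
  | monomial α c =>
    have hμ : HasDerivAt (fun s : ℂ => (1 - s ^ 2 * σ) * ν) (-(2 * θ * σ) * ν) (θ : ℂ) := by
      have h := ((((hasDerivAt_id (θ : ℂ)).pow 2).mul_const (σ : ℂ)).const_sub 1).mul_const ν
      convert! h using 1
      simp
    have hx : ∀ j, HasDerivAt (fun s : ℂ => (z j : ℂ) - s * y j) (-(y j : ℂ)) (θ : ℂ) := fun j => by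
      have h := ((hasDerivAt_id (θ : ℂ)).mul_const (y j : ℂ)).const_sub (z j : ℂ)
      convert! h using 1
      simp
    have h0 : 0 < ((1 - (θ : ℂ) ^ 2 * σ) * ν).re := by
      rw [show (1 - (θ : ℂ) ^ 2 * σ) * ν = ((1 - θ ^ 2 * σ : ℝ) : ℂ) * ν by push_cast; rfl,
        Complex.re_ofReal_mul]
      positivity
    have h := ((hasDerivAt_gaussDeriv (x := fun s j => (z j : ℂ) - s * y j) hμ hx h0 α).const_mul
      c).comp_ofReal
    convert! h using 1
    · funext s
      rw [evalCurve, evalGauss_monomial]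
      congr 2
      · push_cast
        rfl
      · funext j
        simp
    · simp only [timeSymbol, spaceSymbol, Finset.mul_sum, map_sum, MvPolynomial.monomial_mul,
        evalCurve, evalGauss_monomial]
      rw [← Finset.sum_add_distrib]
      refine Finset.sum_congr rfl fun j _ => ?_
      have e1 : (((1 - θ ^ 2 * σ : ℝ) : ℂ) * ν) = (1 - (θ : ℂ) ^ 2 * σ) * ν := by push_cast; rfl
      have e2 : (fun j => (((z - θ • y) j : ℝ) : ℂ)) = fun j => (z j : ℂ) - θ * y j := by
        funext j
        simp
      simp only [e1, e2, Finsupp.coe_add, Finsupp.single_eq_pi_single]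
      ring
  | add P Q hP hQ =>
    simp only [map_add, add_mul, mul_add]
    convert! hP.add hQ using 1
    ring

/-- The remainder of the expansion. -/
def taylorRem (ν : ℂ) (σ : ℝ) (z y : Euc n) (N : ℕ) (P : MvPolynomial (Fin n) ℂ) (θ : ℝ) : ℂ :=
  evalCurve ν σ z y θ P - ∑ l ∈ Finset.range N, (θ : ℂ) ^ l *
    evalCurve ν σ z y 0 (P * expCoeff (timeSymbol n ν σ) (spaceSymbol y) l)

theorem taylorRem_zero (ν : ℂ) (σ : ℝ) (z y : Euc n) (P : MvPolynomial (Fin n) ℂ) (θ : ℝ) :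
    taylorRem ν σ z y 0 P θ = evalCurve ν σ z y θ P := by simp [taylorRem]

theorem taylorRem_succ_at_zero (ν : ℂ) (σ : ℝ) (z y : Euc n) (N : ℕ) (P : MvPolynomial (Fin n) ℂ) :
    taylorRem ν σ z y (N + 1) P 0 = 0 := by
  rw [taylorRem, Finset.sum_range_succ']
  simp [expCoeff_zero]

/-- Differentiation reproduces remainders: one order lower with a factor `B`, two orders lower with
a factor `2θA`, by `expCoeff_add_two`. For `N = 0` the truncated `N - 1` is right, since both
remainders are then the full function. -/
theorem hasDerivAt_taylorRem {ν : ℂ} (hν : 0 < ν.re) {σ : ℝ} (z y : Euc n) {θ : ℝ}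
    (hθ : 0 < 1 - θ ^ 2 * σ) (N : ℕ) (P : MvPolynomial (Fin n) ℂ) :
    HasDerivAt (taylorRem ν σ z y (N + 1) P)
      (2 * θ * taylorRem ν σ z y (N - 1) (P * timeSymbol n ν σ) θ +
        taylorRem ν σ z y N (P * spaceSymbol y) θ) θ := by
  have hs : HasDerivAt (fun s : ℝ => ∑ l ∈ Finset.range (N + 1), (s : ℂ) ^ l *
      evalCurve ν σ z y 0 (P * expCoeff (timeSymbol n ν σ) (spaceSymbol y) l))
      (∑ l ∈ Finset.range (N + 1), (l * (θ : ℂ) ^ (l - 1)) *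
        evalCurve ν σ z y 0 (P * expCoeff (timeSymbol n ν σ) (spaceSymbol y) l)) θ := by
    refine HasDerivAt.fun_sum fun l _ => ?_
    have h := (hasDerivAt_pow l (θ : ℂ)).comp_ofReal
    simpa using h.mul_const _
  convert! (hasDerivAt_evalCurve hν z y hθ P).sub hs using 1
  set A := timeSymbol n ν σ with hA
  set B := spaceSymbol y with hB
  have hrec : ∀ l : ℕ, ((l : ℂ) + 2) * evalCurve ν σ z y 0 (P * expCoeff A B (l + 2)) =
      2 * evalCurve ν σ z y 0 (P * A * expCoeff A B l) +
        evalCurve ν σ z y 0 (P * B * expCoeff A B (l + 1)) := fun l => by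
    have e : (2 : MvPolynomial (Fin n) ℂ) * (P * A * expCoeff A B l) =
        (2 : ℂ) • (P * A * expCoeff A B l) := by rw [two_mul, two_smul]
    have e2 : P * (((l : ℂ) + 2) • expCoeff A B (l + 2)) =
        (2 : ℂ) • (P * A * expCoeff A B l) + P * B * expCoeff A B (l + 1) := by
      rw [expCoeff_add_two, ← e]
      ring
    have e3 := congrArg (evalCurve ν σ z y 0) e2
    rwa [mul_smul_comm, map_smul, map_add, map_smul, smul_eq_mul, smul_eq_mul] at e3
  simp only [taylorRem]
  rcases N with _ | N
  · simp
  · rw [Nat.add_sub_cancel, Finset.sum_range_succ' _ (N + 1), Finset.sum_range_succ' _ N,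
      Finset.sum_range_succ' _ N]
    have h1 : ∀ l ∈ Finset.range N, ((l + 1 + 1 : ℕ) : ℂ) * (θ : ℂ) ^ (l + 1 + 1 - 1) *
        evalCurve ν σ z y 0 (P * expCoeff A B (l + 1 + 1)) =
        2 * θ * ((θ : ℂ) ^ l * evalCurve ν σ z y 0 (P * A * expCoeff A B l)) +
          (θ : ℂ) ^ (l + 1) * evalCurve ν σ z y 0 (P * B * expCoeff A B (l + 1)) := fun l _ => by
      have h2 := hrec l
      rw [Nat.add_sub_cancel]
      push_cast
      calc ((l : ℂ) + 1 + 1) * (θ : ℂ) ^ (l + 1) * evalCurve ν σ z y 0 (P * expCoeff A B (l + 1 + 1))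
          = (θ : ℂ) ^ (l + 1) *
            (((l : ℂ) + 2) * evalCurve ν σ z y 0 (P * expCoeff A B (l + 2))) := by ring
        _ = _ := by
          rw [h2]
          ring
    rw [Finset.sum_congr rfl h1, Finset.sum_add_distrib, ← Finset.mul_sum]
    simp [expCoeff_zero, expCoeff_one]
    ring

/-! ### Gaussian bounds for the derivatives and for the Taylor remainder -/

theorem one_add_pow_le_exp {b : ℝ} (hb : 0 < b) (k : ℕ) :
    ∃ C : ℝ, 0 ≤ C ∧ ∀ r : ℝ, 0 ≤ r → (1 + r) ^ k ≤ C * Real.exp (b * r ^ 2) := by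
  obtain ⟨C, hC0, hC⟩ := pow_le_const_mul_exp (half_pos hb) k
  refine ⟨C * Real.exp b, by positivity, fun r hr => (hC (1 + r) (by linarith)).trans ?_⟩
  rw [mul_assoc, ← Real.exp_add]
  gcongr
  nlinarith [sq_nonneg (1 - r)]

theorem exists_norm_herm_le {ν : ℂ} (hν : 0 < ν.re) (a : ℕ) :
    ∃ C : ℝ, 0 ≤ C ∧ ∀ τ : ℝ, 1 / 2 ≤ τ → ∀ x : ℝ, ‖herm a (τ * ν) x‖ ≤ C * (1 + |x|) ^ a := by
  have hν0 : 0 < ‖ν‖ := norm_pos_iff.2 (ne_zero_of_re_pos hν)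
  have hinv : ∀ τ : ℝ, 1 / 2 ≤ τ → ‖((τ : ℂ) * ν)‖⁻¹ ≤ 2 / ‖ν‖ := fun τ hτ => by
    rw [norm_mul, Complex.norm_real, Real.norm_of_nonneg (by linarith), mul_inv, div_eq_mul_inv]
    gcongr
    rw [inv_le_comm₀ (by linarith) (by norm_num)]
    linarith
  induction a using Nat.twoStepInduction with
  | zero => exact ⟨1, zero_le_one, fun τ _ x => by simp [herm_zero]⟩
  | one =>
    refine ⟨2 / ‖ν‖, by positivity, fun τ hτ x => ?_⟩
    rw [herm_one, norm_div, div_eq_mul_inv, Complex.norm_real, Real.norm_eq_abs, pow_one, mul_comm]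
    gcongr
    · exact hinv τ hτ
    · linarith
  | more a h1 h2 =>
    obtain ⟨C₁, hC₁, h1⟩ := h1
    obtain ⟨C₂, hC₂, h2⟩ := h2
    refine ⟨2 / ‖ν‖ * C₂ + 2 * (a + 1) * (2 / ‖ν‖) * C₁, by positivity, fun τ hτ x => ?_⟩
    have e : herm (a + 2) (τ * ν) x = x / (τ * ν) * herm (a + 1) (τ * ν) x -
        2 * (((a + 1 : ℕ)) : ℂ) / (τ * ν) * herm a (τ * ν) x := herm_succ (a + 1) _ _
    have hx : |x| ≤ 1 + |x| := by linarith
    have hx1 : 1 ≤ 1 + |x| := by linarith [abs_nonneg x]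
    have h4 : (1 + |x|) ^ a ≤ (1 + |x|) ^ (a + 2) := pow_le_pow_right₀ hx1 (by omega)
    rw [e]
    calc ‖(x : ℂ) / (τ * ν) * herm (a + 1) (τ * ν) x - 2 * ((a + 1 : ℕ) : ℂ) / (τ * ν) * herm a (τ * ν) x‖
        ≤ ‖(x : ℂ) / (τ * ν) * herm (a + 1) (τ * ν) x‖ +
          ‖2 * ((a + 1 : ℕ) : ℂ) / (τ * ν) * herm a (τ * ν) x‖ := norm_sub_le _ _
      _ = ‖(τ * ν : ℂ)‖⁻¹ * |x| * ‖herm (a + 1) (τ * ν) x‖ +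
          2 * (a + 1) * ‖(τ * ν : ℂ)‖⁻¹ * ‖herm a (τ * ν) x‖ := by
          simp only [norm_mul, norm_div, Complex.norm_real, Real.norm_eq_abs, Complex.norm_natCast,
            Complex.norm_ofNat]
          push_cast
          ring
      _ ≤ 2 / ‖ν‖ * (1 + |x|) * (C₂ * (1 + |x|) ^ (a + 1)) +
          2 * (a + 1) * (2 / ‖ν‖) * (C₁ * (1 + |x|) ^ (a + 2)) := by
          have := hinv τ hτ
          have := h2 τ hτ x
          have := (h1 τ hτ x).trans (mul_le_mul_of_nonneg_left h4 hC₁)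
          gcongr
      _ = _ := by ring

/-- Half of the decay rate is spent on absorbing the Hermite polynomial. For `τ ≤ 1` the kernel
decays at least as fast as at `τ = 1`; `τ ≥ 1/2` keeps the prefactors bounded. -/
theorem exists_norm_gaussDeriv₁_le {ν : ℂ} (hν : 0 < ν.re) (a : ℕ) :
    ∃ C : ℝ, 0 ≤ C ∧ ∀ τ : ℝ, 1 / 2 ≤ τ → τ ≤ 1 → ∀ x : ℝ,
      ‖gaussDeriv₁ a (τ * ν) x‖ ≤ C * Real.exp (-(rate ν / 2 * x ^ 2)) := by
  obtain ⟨C₁, hC₁, h1⟩ := exists_norm_herm_le hν a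
  have hr := rate_pos hν
  obtain ⟨C₂, hC₂, h2⟩ := one_add_pow_le_exp (half_pos hr) a
  have hν0 : 0 < ‖ν‖ := norm_pos_iff.2 (ne_zero_of_re_pos hν)
  have hpi := Real.pi_pos
  refine ⟨C₁ * C₂ * (2 * Real.pi * ‖ν‖) ^ (-(1 : ℝ) / 2), by positivity, fun τ hτ hτ1 x => ?_⟩
  have hτ0 : 0 < τ := by linarith
  have e1 : ‖((-2 : ℂ) ^ a)⁻¹‖ ≤ 1 := by
    rw [norm_inv, norm_pow, norm_neg, Complex.norm_ofNat]
    exact inv_le_one_of_one_le₀ (one_le_pow₀ (by norm_num))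
  have e2 : ‖(4 * (Real.pi : ℂ) * (τ * ν)) ^ (-(1 : ℂ) / 2)‖ ≤ (2 * Real.pi * ‖ν‖) ^ (-(1 : ℝ) / 2) := by
    rw [show -(1 : ℂ) / 2 = ((-(1 : ℝ) / 2 : ℝ) : ℂ) by push_cast; rfl, Complex.norm_cpow_real]
    refine Real.rpow_le_rpow_of_nonpos (by positivity) ?_ (by norm_num)
    simp only [norm_mul, Complex.norm_real, Real.norm_of_nonneg hτ0.le, Real.norm_of_nonneg hpi.le,
      Complex.norm_ofNat]
    nlinarith [mul_pos hpi hν0]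
  have e3 : ‖Complex.exp (-(x : ℂ) ^ 2 / (4 * (τ * ν)))‖ ≤ Real.exp (-(rate ν * x ^ 2)) := by
    rw [Complex.norm_exp, Real.exp_le_exp]
    have : -(x : ℂ) ^ 2 / (4 * (τ * ν)) = ((-(x ^ 2 / τ) : ℝ) : ℂ) * (4 * ν)⁻¹ := by
      push_cast
      rw [show 4 * ((τ : ℂ) * ν) = τ * (4 * ν) by ring]
      simp only [div_eq_mul_inv, mul_inv]
      ring
    rw [this, Complex.re_ofReal_mul, ← rate, neg_mul, neg_le_neg_iff, mul_comm]
    gcongr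
    rw [le_div_iff₀ hτ0]
    exact mul_le_of_le_one_right (sq_nonneg x) hτ1
  have e4 := (h1 τ hτ x).trans (mul_le_mul_of_nonneg_left (h2 |x| (abs_nonneg x)) hC₁)
  rw [sq_abs] at e4
  rw [gaussDeriv₁, norm_mul, norm_mul, norm_mul]
  calc ‖((-2 : ℂ) ^ a)⁻¹‖ * ‖herm a (τ * ν) x‖ *
        (‖(4 * (Real.pi : ℂ) * (τ * ν)) ^ (-(1 : ℂ) / 2)‖ * ‖Complex.exp (-(x : ℂ) ^ 2 / (4 * (τ * ν)))‖)
      ≤ 1 * (C₁ * (C₂ * Real.exp (rate ν / 2 * x ^ 2))) *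
        ((2 * Real.pi * ‖ν‖) ^ (-(1 : ℝ) / 2) * Real.exp (-(rate ν * x ^ 2))) := by gcongr
    _ = C₁ * C₂ * (2 * Real.pi * ‖ν‖) ^ (-(1 : ℝ) / 2) *
        (Real.exp (rate ν / 2 * x ^ 2) * Real.exp (-(rate ν * x ^ 2))) := by ring
    _ = _ := by
        rw [← Real.exp_add]
        congr 2
        ring

theorem exists_norm_gaussDeriv_le {ν : ℂ} (hν : 0 < ν.re) (α : Fin n → ℕ) :
    ∃ C : ℝ, 0 ≤ C ∧ ∀ τ : ℝ, 1 / 2 ≤ τ → τ ≤ 1 → ∀ x : Euc n,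
      ‖gaussDeriv α (τ * ν) (fun j => x j)‖ ≤ C * Real.exp (-(rate ν / 2 * ‖x‖ ^ 2)) := by
  choose C hC0 hC using fun j => exists_norm_gaussDeriv₁_le hν (α j)
  refine ⟨∏ j, C j, Finset.prod_nonneg fun j _ => hC0 j, fun τ h1 h2 x => ?_⟩
  rw [gaussDeriv, norm_prod]
  refine (Finset.prod_le_prod (fun j _ => norm_nonneg _) fun j _ => hC j τ h1 h2 (x j)).trans_eq ?_
  rw [Finset.prod_mul_distrib, ← Real.exp_sum, Finset.sum_neg_distrib, ← Finset.mul_sum,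
    EuclideanSpace.norm_sq_eq]
  simp only [Real.norm_eq_abs, sq_abs]

/-- Moving the centre by at most one costs half of the rate and a constant; together with the half
lost to the polynomial factor this yields the rate `rate ν / 4` used from here on. -/
theorem exp_neg_sub_le {b : ℝ} (hb : 0 ≤ b) {z y : Euc n} {θ : ℝ} (hy : ‖y‖ ≤ 1) (hθ0 : 0 ≤ θ)
    (hθ1 : θ ≤ 1) :
    Real.exp (-(b * ‖z - θ • y‖ ^ 2)) ≤ Real.exp b * Real.exp (-(b / 2 * ‖z‖ ^ 2)) := by
  rw [← Real.exp_add, Real.exp_le_exp]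
  have h1 : ‖z‖ ≤ ‖z - θ • y‖ + 1 := by
    calc ‖z‖ = ‖(z - θ • y) + θ • y‖ := by rw [sub_add_cancel]
      _ ≤ ‖z - θ • y‖ + ‖θ • y‖ := norm_add_le _ _
      _ ≤ _ := by
        gcongr
        rw [norm_smul, Real.norm_of_nonneg hθ0]
        exact mul_le_one₀ hθ1 (norm_nonneg _) hy
  have h2 : ‖z‖ ^ 2 ≤ 2 * ‖z - θ • y‖ ^ 2 + 2 := by
    nlinarith [norm_nonneg z, norm_nonneg (z - θ • y), sq_nonneg (‖z - θ • y‖ - 1)]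
  nlinarith

/-- Induction on `N` by the mean value inequality from `θ = 0`, where remainders of positive order
vanish. The derivative consists of remainders of lower order for monomials of higher degree, so all
`α` are treated together. With `ρ = √σ + |y|`, the factor `σ` of the time symbol pays for two lost
powers of `ρ` and the factor `y` of the space symbol for one. -/
theorem exists_norm_taylorRem_le {ν : ℂ} (hν : 0 < ν.re) (N : ℕ) : ∀ α : Fin n →₀ ℕ,
    ∃ C : ℝ, 0 ≤ C ∧ ∀ (σ : ℝ) (z y : Euc n) (θ : ℝ), 0 ≤ σ → σ ≤ 1 / 2 → ‖y‖ ≤ 1 → 0 ≤ θ → θ ≤ 1 →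
      ‖taylorRem ν σ z y N (MvPolynomial.monomial α 1) θ‖ ≤
        C * (√σ + ‖y‖) ^ N * Real.exp (-(rate ν / 4 * ‖z‖ ^ 2)) := by
  have hr := rate_pos hν
  have hτ : ∀ σ θ : ℝ, 0 ≤ σ → σ ≤ 1 / 2 → 0 ≤ θ → θ ≤ 1 →
      1 / 2 ≤ 1 - θ ^ 2 * σ ∧ 1 - θ ^ 2 * σ ≤ 1 := fun σ θ h1 h2 h3 h4 => by
    have : θ ^ 2 ≤ 1 := pow_le_one₀ h3 h4
    constructor <;> nlinarith [sq_nonneg θ]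
  have hstep : ∀ M : ℕ, (∀ α : Fin n →₀ ℕ, ∃ C : ℝ, 0 ≤ C ∧ ∀ (σ : ℝ) (z y : Euc n) (θ : ℝ),
      0 ≤ σ → σ ≤ 1 / 2 → ‖y‖ ≤ 1 → 0 ≤ θ → θ ≤ 1 →
      ‖taylorRem ν σ z y M (MvPolynomial.monomial α 1) θ‖ ≤
        C * (√σ + ‖y‖) ^ M * Real.exp (-(rate ν / 4 * ‖z‖ ^ 2))) →
      (∀ α : Fin n →₀ ℕ, ∃ C : ℝ, 0 ≤ C ∧ ∀ (σ : ℝ) (z y : Euc n) (θ : ℝ),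
      0 ≤ σ → σ ≤ 1 / 2 → ‖y‖ ≤ 1 → 0 ≤ θ → θ ≤ 1 →
      ‖taylorRem ν σ z y (M - 1) (MvPolynomial.monomial α 1) θ‖ ≤
        C * (√σ + ‖y‖) ^ (M - 1) * Real.exp (-(rate ν / 4 * ‖z‖ ^ 2))) →
      ∀ α : Fin n →₀ ℕ, ∃ C : ℝ, 0 ≤ C ∧ ∀ (σ : ℝ) (z y : Euc n) (θ : ℝ),
      0 ≤ σ → σ ≤ 1 / 2 → ‖y‖ ≤ 1 → 0 ≤ θ → θ ≤ 1 →
      ‖taylorRem ν σ z y (M + 1) (MvPolynomial.monomial α 1) θ‖ ≤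
        C * (√σ + ‖y‖) ^ (M + 1) * Real.exp (-(rate ν / 4 * ‖z‖ ^ 2)) := by
    intro M hM hM1 α
    choose C hC0 hC using fun j : Fin n => hM (α + Finsupp.single j 1)
    choose D hD0 hD using fun j : Fin n => hM1 (α + Finsupp.single j 2)
    refine ⟨2 * (‖ν‖ * ∑ j, D j) + ∑ j, C j, by
      have := Finset.sum_nonneg fun j (_ : j ∈ Finset.univ) => hC0 j
      have := Finset.sum_nonneg fun j (_ : j ∈ Finset.univ) => hD0 j
      positivity, fun σ z y θ hσ0 hσ hy hθ0 hθ1 => ?_⟩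
    set ρ := √σ + ‖y‖ with hρ
    set G := Real.exp (-(rate ν / 4 * ‖z‖ ^ 2)) with hG
    have hρ0 : 0 ≤ ρ := by positivity
    -- For `M = 0` the truncated subtraction loses only one power; then `σ ≤ √σ` suffices, since `σ
    -- ≤ 1`.
    have hσρ : σ * ρ ^ (M - 1) ≤ ρ ^ (M + 1) := by
      have h1 : √σ ≤ ρ := by linarith [norm_nonneg y]
      have h2 : √σ ≤ 1 := Real.sqrt_le_one.2 (by linarith)
      have h3 : √σ * √σ = σ := Real.mul_self_sqrt hσ0
      rcases M with _ | M
      · simp only [Nat.zero_sub, pow_zero, mul_one, zero_add, pow_one]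
        nlinarith [Real.sqrt_nonneg σ]
      · rw [Nat.add_sub_cancel, show M + 1 + 1 = 2 + M by omega, pow_add]
        gcongr
        nlinarith [Real.sqrt_nonneg σ]
    have hyρ : ‖y‖ * ρ ^ M ≤ ρ ^ (M + 1) := by
      rw [pow_succ']
      gcongr
      linarith [Real.sqrt_nonneg σ]
    have hlin : ∀ (L : ℕ) (k : ℕ) (c : Fin n → ℂ) (θ : ℝ),
        taylorRem ν σ z y L (MvPolynomial.monomial α 1 *
          ∑ j, MvPolynomial.monomial (Finsupp.single j k) (c j)) θ =
        ∑ j, c j * taylorRem ν σ z y L (MvPolynomial.monomial (α + Finsupp.single j k) 1) θ := by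
      intro L k c θ
      have e : ∀ j, MvPolynomial.monomial (α + Finsupp.single j k) (c j) =
          c j • MvPolynomial.monomial (α + Finsupp.single j k) (1 : ℂ) := fun j => by
        rw [MvPolynomial.smul_monomial, smul_eq_mul, mul_one]
      simp only [taylorRem, Finset.mul_sum, MvPolynomial.monomial_mul, one_mul, e, Finset.sum_mul,
        map_sum, smul_mul_assoc, map_smul, smul_eq_mul, mul_sub, Finset.sum_sub_distrib]
      rw [Finset.sum_comm]
      congr 1
      refine Finset.sum_congr rfl fun j _ => Finset.sum_congr rfl fun l _ => ?_
      ring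
    have hbound : ∀ s ∈ Ico (0 : ℝ) 1,
        ‖2 * (s : ℂ) * taylorRem ν σ z y (M - 1) (MvPolynomial.monomial α 1 * timeSymbol n ν σ) s +
          taylorRem ν σ z y M (MvPolynomial.monomial α 1 * spaceSymbol y) s‖ ≤
        (2 * (‖ν‖ * ∑ j, D j) + ∑ j, C j) * ρ ^ (M + 1) * G := by
      intro s hs
      have h1 : ‖taylorRem ν σ z y (M - 1) (MvPolynomial.monomial α 1 * timeSymbol n ν σ) s‖ ≤
          ‖ν‖ * (∑ j, D j) * ρ ^ (M + 1) * G := by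
        rw [timeSymbol, hlin]
        calc ‖∑ j, -((σ : ℂ) * ν) * taylorRem ν σ z y (M - 1)
              (MvPolynomial.monomial (α + Finsupp.single j 2) 1) s‖
            ≤ ∑ j, σ * ‖ν‖ * (D j * ρ ^ (M - 1) * G) := by
              refine norm_sum_le_of_le _ fun j _ => ?_
              rw [norm_mul, norm_neg, norm_mul, Complex.norm_real, Real.norm_of_nonneg hσ0]
              gcongr
              exact hD j σ z y s hσ0 hσ hy hs.1 hs.2.le
          _ = ‖ν‖ * (∑ j, D j) * (σ * ρ ^ (M - 1)) * G := by
              rw [Finset.mul_sum, Finset.sum_mul, Finset.sum_mul]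
              refine Finset.sum_congr rfl fun j _ => ?_
              ring
          _ ≤ _ := by
              have := Finset.sum_nonneg fun j (_ : j ∈ Finset.univ) => hD0 j
              gcongr
      have h2 : ‖taylorRem ν σ z y M (MvPolynomial.monomial α 1 * spaceSymbol y) s‖ ≤
          (∑ j, C j) * ρ ^ (M + 1) * G := by
        rw [spaceSymbol, hlin]
        calc ‖∑ j, -(y j : ℂ) * taylorRem ν σ z y M
              (MvPolynomial.monomial (α + Finsupp.single j 1) 1) s‖
            ≤ ∑ j, ‖y‖ * (C j * ρ ^ M * G) := by
              refine norm_sum_le_of_le _ fun j _ => ?_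
              rw [norm_mul, norm_neg, Complex.norm_real]
              gcongr
              · exact PiLp.norm_apply_le y j
              · exact hC j σ z y s hσ0 hσ hy hs.1 hs.2.le
          _ = (∑ j, C j) * (‖y‖ * ρ ^ M) * G := by
              rw [Finset.sum_mul, Finset.sum_mul]
              refine Finset.sum_congr rfl fun j _ => ?_
              ring
          _ ≤ _ := by
              have := Finset.sum_nonneg fun j (_ : j ∈ Finset.univ) => hC0 j
              gcongr
      refine (norm_add_le _ _).trans ?_
      rw [norm_mul, norm_mul, Complex.norm_ofNat, Complex.norm_real, Real.norm_of_nonneg hs.1]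
      have h3 : 2 * s * ‖taylorRem ν σ z y (M - 1) (MvPolynomial.monomial α 1 * timeSymbol n ν σ) s‖ ≤
          2 * 1 * (‖ν‖ * (∑ j, D j) * ρ ^ (M + 1) * G) := by
        gcongr
        exact hs.2.le
      calc _ ≤ 2 * 1 * (‖ν‖ * (∑ j, D j) * ρ ^ (M + 1) * G) + (∑ j, C j) * ρ ^ (M + 1) * G :=
            add_le_add h3 h2
        _ = _ := by ring
    have hmv := norm_image_sub_le_of_norm_deriv_le_segment' (a := (0 : ℝ)) (b := 1)
      (f := taylorRem ν σ z y (M + 1) (MvPolynomial.monomial α 1))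
      (fun s hs => (hasDerivAt_taylorRem hν z y
        (lt_of_lt_of_le (by norm_num) (hτ σ s hσ0 hσ hs.1 hs.2).1) M _).hasDerivWithinAt)
      hbound θ ⟨hθ0, hθ1⟩
    rw [taylorRem_succ_at_zero, sub_zero, sub_zero] at hmv
    refine hmv.trans (mul_le_of_le_one_right ((norm_nonneg _).trans (hbound 0 (by simp))) hθ1)
  have hbase : ∀ α : Fin n →₀ ℕ, ∃ C : ℝ, 0 ≤ C ∧ ∀ (σ : ℝ) (z y : Euc n) (θ : ℝ),
      0 ≤ σ → σ ≤ 1 / 2 → ‖y‖ ≤ 1 → 0 ≤ θ → θ ≤ 1 →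
      ‖taylorRem ν σ z y 0 (MvPolynomial.monomial α 1) θ‖ ≤
        C * (√σ + ‖y‖) ^ 0 * Real.exp (-(rate ν / 4 * ‖z‖ ^ 2)) := by
    intro α
    obtain ⟨C, hC0, hC⟩ := exists_norm_gaussDeriv_le hν (α : Fin n → ℕ)
    refine ⟨C * Real.exp (rate ν / 2), by positivity, fun σ z y θ hσ0 hσ hy hθ0 hθ1 => ?_⟩
    obtain ⟨h1, h2⟩ := hτ σ θ hσ0 hσ hθ0 hθ1
    rw [taylorRem_zero, evalCurve, evalGauss_monomial, one_mul, pow_zero, mul_one]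
    refine (hC _ h1 h2 (z - θ • y)).trans ?_
    rw [mul_assoc]
    gcongr
    have := exp_neg_sub_le (half_pos hr).le (z := z) hy hθ0 hθ1
    rwa [show rate ν / 2 / 2 = rate ν / 4 by ring] at this
  -- The step needs the two preceding orders, so the induction carries both.
  have hpair : ∀ N : ℕ, (∀ α : Fin n →₀ ℕ, ∃ C : ℝ, 0 ≤ C ∧ ∀ (σ : ℝ) (z y : Euc n) (θ : ℝ),
      0 ≤ σ → σ ≤ 1 / 2 → ‖y‖ ≤ 1 → 0 ≤ θ → θ ≤ 1 →
      ‖taylorRem ν σ z y N (MvPolynomial.monomial α 1) θ‖ ≤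
        C * (√σ + ‖y‖) ^ N * Real.exp (-(rate ν / 4 * ‖z‖ ^ 2))) ∧
      (∀ α : Fin n →₀ ℕ, ∃ C : ℝ, 0 ≤ C ∧ ∀ (σ : ℝ) (z y : Euc n) (θ : ℝ),
      0 ≤ σ → σ ≤ 1 / 2 → ‖y‖ ≤ 1 → 0 ≤ θ → θ ≤ 1 →
      ‖taylorRem ν σ z y (N - 1) (MvPolynomial.monomial α 1) θ‖ ≤
        C * (√σ + ‖y‖) ^ (N - 1) * Real.exp (-(rate ν / 4 * ‖z‖ ^ 2))) := by
    intro N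
    induction N with
    | zero => exact ⟨hbase, hbase⟩
    | succ M ih => exact ⟨hstep M ih.1 ih.2, ih.1⟩
  exact (hpair N).1

end CGL

end

noncomputable section

namespace CGL

variable {n : ℕ}

/-! ### The parabolic Taylor polynomial in terms of multi-indices -/

/-- Pairs of multi-indices `(γ, β)` of parabolic length `2|γ| + |β| ≤ M`. -/
def taylorIdx (n M : ℕ) : Finset ((Fin n → ℕ) × (Fin n → ℕ)) :=
  ((Finset.Iic fun _ => M) ×ˢ (Finset.Iic fun _ => M)).filter fun q => 2 * len q.1 + len q.2 ≤ M

theorem apply_le_len (α : Fin n → ℕ) (j : Fin n) : α j ≤ len α :=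
  Finset.single_le_sum (fun i _ => Nat.zero_le (α i)) (Finset.mem_univ j)

theorem mem_taylorIdx {M : ℕ} {q : (Fin n → ℕ) × (Fin n → ℕ)} :
    q ∈ taylorIdx n M ↔ 2 * len q.1 + len q.2 ≤ M := by
  simp only [taylorIdx, Finset.mem_filter, Finset.mem_product, Finset.mem_Iic, Pi.le_def,
    and_iff_right_iff_imp]
  intro h
  exact ⟨fun j => (apply_le_len q.1 j).trans (by omega), fun j => (apply_le_len q.2 j).trans (by omega)⟩

/-- The grouping used in `profile`: `|γ|` first, then `|β|`. The Taylor expansion groups the same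
pairs by `2|γ| + |β|`, as in `sum_taylorIdx'`; passing through the common index set identifies the
two. -/
theorem sum_taylorIdx {X : Type*} [AddCommMonoid X] (M : ℕ) (F : (Fin n → ℕ) → (Fin n → ℕ) → X) :
    ∑ k ∈ Finset.range (M / 2 + 1), ∑ γ ∈ multiIndices n k, ∑ i ∈ Finset.range (M - 2 * k + 1),
      ∑ β ∈ multiIndices n i, F γ β = ∑ q ∈ taylorIdx n M, F q.1 q.2 := by
  simp only [Finset.sum_sigma']
  refine Finset.sum_nbij' (fun a => (a.2.1, a.2.2.2)) (fun q => ⟨len q.1, q.1, len q.2, q.2⟩) ?_ ?_ ?_ ?_ ?_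
  · rintro ⟨k, γ, i, β⟩ h
    simp only [Finset.mem_sigma, Finset.mem_range, mem_multiIndices, mem_taylorIdx] at h ⊢
    omega
  · rintro ⟨γ, β⟩ h
    simp only [Finset.mem_sigma, Finset.mem_range, mem_multiIndices, mem_taylorIdx] at h ⊢
    exact ⟨by omega, trivial, by omega, trivial⟩
  · rintro ⟨k, γ, i, β⟩ h
    simp only [Finset.mem_sigma, Finset.mem_range, mem_multiIndices] at h
    obtain ⟨-, rfl, -, rfl⟩ := h
    rfl
  · rintro ⟨γ, β⟩ _
    rfl
  · rintro ⟨k, γ, i, β⟩ _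
    rfl

theorem sum_taylorIdx' {X : Type*} [AddCommMonoid X] (M : ℕ) (F : (Fin n → ℕ) → (Fin n → ℕ) → X) :
    ∑ l ∈ Finset.range (M + 1), ∑ k ∈ Finset.range (l / 2 + 1), ∑ γ ∈ multiIndices n k,
      ∑ β ∈ multiIndices n (l - 2 * k), F γ β = ∑ q ∈ taylorIdx n M, F q.1 q.2 := by
  simp only [Finset.sum_sigma']
  refine Finset.sum_nbij' (fun a => (a.2.2.1, a.2.2.2))
    (fun q => ⟨2 * len q.1 + len q.2, len q.1, q.1, q.2⟩) ?_ ?_ ?_ ?_ ?_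
  · rintro ⟨l, k, γ, β⟩ h
    simp only [Finset.mem_sigma, Finset.mem_range, mem_multiIndices, mem_taylorIdx] at h ⊢
    omega
  · rintro ⟨γ, β⟩ h
    simp only [Finset.mem_sigma, Finset.mem_range, mem_multiIndices, mem_taylorIdx] at h ⊢
    exact ⟨by omega, by omega, trivial, by omega⟩
  · rintro ⟨l, k, γ, β⟩ h
    simp only [Finset.mem_sigma, Finset.mem_range, mem_multiIndices] at h
    obtain ⟨-, h2, rfl, h3⟩ := h
    have : 2 * len γ + len β = l := by omega
    subst this
    rfl
  · rintro ⟨γ, β⟩ _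
    rfl
  · rintro ⟨l, k, γ, β⟩ _
    rfl

/-- The numerical coefficients of the expansion. -/
def taylorCoeff (ν : ℂ) (q : (Fin n → ℕ) × (Fin n → ℕ)) : ℂ :=
  (-ν) ^ len q.1 / (mfact q.1 : ℂ) * ((-1) ^ len q.2 / (mfact q.2 : ℂ))

/-- The derivative `∂^{2γ+β} G_ν`. -/
def taylorFun (ν : ℂ) (q : (Fin n → ℕ) × (Fin n → ℕ)) (z : Euc n) : ℂ :=
  gaussDeriv (2 • q.1 + q.2) ν fun j => z j

/-- The parabolic Taylor polynomial of degree `M` of the kernel. -/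
def taylorPoly (ν : ℂ) (M : ℕ) (z : Euc n) (σ : ℝ) (y : Euc n) : ℂ :=
  ∑ q ∈ taylorIdx n M, taylorCoeff ν q * (σ : ℂ) ^ len q.1 * monom q.2 y * taylorFun ν q z

theorem prod_monomial {ι : Type*} (s : Finset ι) (d : ι → Fin n →₀ ℕ) (c : ι → ℂ) :
    ∏ i ∈ s, MvPolynomial.monomial (d i) (c i) =
      MvPolynomial.monomial (∑ i ∈ s, d i) (∏ i ∈ s, c i) := by
  classical
  induction s using Finset.induction with
  | empty => simp
  | insert i s hi ih =>
    rw [Finset.prod_insert hi, Finset.prod_insert hi, Finset.sum_insert hi, ih,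
      MvPolynomial.monomial_mul]

/-- The multinomial theorem: `1/k!` times the multinomial coefficient is `1/γ!`, the factor
appearing in the profiles. -/
theorem sum_monomial_pow (c : Fin n → ℂ) (a k : ℕ) :
    (((k.factorial : ℂ)⁻¹) • (∑ j, MvPolynomial.monomial (Finsupp.single j a) (c j)) ^ k :
      MvPolynomial (Fin n) ℂ) =
    ∑ γ ∈ multiIndices n k, MvPolynomial.monomial (Finsupp.equivFunOnFinite.symm (a • γ))
      ((mfact γ : ℂ)⁻¹ * ∏ j, c j ^ γ j) := by
  rw [Finset.sum_pow_eq_sum_piAntidiag, Finset.smul_sum]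
  refine Finset.sum_congr rfl fun γ hγ => ?_
  have hk : len γ = k := mem_multiIndices.1 hγ
  have h1 : ∏ j, (MvPolynomial.monomial (Finsupp.single j a) (c j)) ^ γ j =
      (MvPolynomial.monomial (Finsupp.equivFunOnFinite.symm (a • γ)) (∏ j, c j ^ γ j) :
        MvPolynomial (Fin n) ℂ) := by
    simp only [MvPolynomial.monomial_pow]
    have hd : ∑ j, γ j • Finsupp.single j a = Finsupp.equivFunOnFinite.symm (a • γ) := by
      ext i
      rw [Finsupp.finsetSum_apply, Finset.sum_eq_single i]
      · simp [mul_comm]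
      · intro j _ hj
        simp [Finsupp.single_eq_of_ne hj.symm]
      · simp
    rw [prod_monomial, hd]
  have h2 : (mfact γ : ℂ) * (Nat.multinomial Finset.univ γ : ℂ) = (k.factorial : ℂ) := by
    rw [← hk]
    exact_mod_cast Nat.multinomial_spec Finset.univ γ
  have h3 : (mfact γ : ℂ) ≠ 0 := by
    exact_mod_cast (Finset.prod_pos fun j _ => Nat.factorial_pos (γ j)).ne'
  have h4 : (k.factorial : ℂ) ≠ 0 := by exact_mod_cast k.factorial_ne_zero
  rw [h1, ← nsmul_eq_mul, ← Nat.cast_smul_eq_nsmul ℂ, smul_smul, MvPolynomial.smul_monomial, smul_eq_mul]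
  congr 2
  rw [← h2] at h4 ⊢
  rw [mul_inv, mul_assoc, inv_mul_cancel₀ (right_ne_zero_of_mul h4), mul_one]

theorem evalGauss_expCoeff (ν : ℂ) (σ : ℝ) (z y : Euc n) (l : ℕ) :
    evalGauss ν (fun j => z j) (expCoeff (timeSymbol n ν σ) (spaceSymbol y) l) =
      ∑ k ∈ Finset.range (l / 2 + 1), ∑ γ ∈ multiIndices n k, ∑ β ∈ multiIndices n (l - 2 * k),
        taylorCoeff ν (γ, β) * (σ : ℂ) ^ len γ * monom β y * taylorFun ν (γ, β) z := by
  rw [expCoeff, map_sum]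
  refine Finset.sum_congr rfl fun k _ => ?_
  have h1 : ((k.factorial : ℂ)⁻¹ * ((l - 2 * k).factorial : ℂ)⁻¹) •
      (timeSymbol n ν σ ^ k * spaceSymbol y ^ (l - 2 * k)) =
      ((k.factorial : ℂ)⁻¹ • timeSymbol n ν σ ^ k) *
        (((l - 2 * k).factorial : ℂ)⁻¹ • spaceSymbol y ^ (l - 2 * k)) := by
    rw [smul_mul_smul_comm]
  rw [h1, timeSymbol, spaceSymbol, sum_monomial_pow, sum_monomial_pow, Finset.sum_mul_sum]
  simp only [map_sum, MvPolynomial.monomial_mul, evalGauss_monomial]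
  refine Finset.sum_congr rfl fun γ _ => Finset.sum_congr rfl fun β _ => ?_
  have e1 : ∏ j, (-((σ : ℂ) * ν)) ^ γ j = (-ν) ^ len γ * (σ : ℂ) ^ len γ := by
    rw [Finset.prod_pow_eq_pow_sum, ← mul_pow, len]
    congr 1
    ring
  have e2 : ∏ j, (-(y j : ℂ)) ^ β j = (-1) ^ len β * monom β y := by
    have h : ∀ j, (-(y j : ℂ)) ^ β j = (-1) ^ β j * (y j : ℂ) ^ β j := fun j => neg_pow _ _
    simp_rw [h]
    rw [Finset.prod_mul_distrib, Finset.prod_pow_eq_pow_sum, len, monom]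
  rw [e1, e2, taylorCoeff, taylorFun]
  have e3 : ((Finsupp.equivFunOnFinite.symm (2 • γ) + Finsupp.equivFunOnFinite.symm (1 • β) :
      Fin n →₀ ℕ) : Fin n → ℕ) = 2 • γ + β := by
    rw [one_smul]
    rfl
  rw [e3]
  simp only [div_eq_mul_inv]
  ring

theorem evalCurve_at_zero (ν : ℂ) (σ : ℝ) (z y : Euc n) :
    evalCurve ν σ z y 0 = evalGauss ν fun j => z j := by
  simp [evalCurve]

theorem taylorPoly_eq (ν : ℂ) (M : ℕ) (z : Euc n) (σ : ℝ) (y : Euc n) :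
    taylorPoly ν M z σ y = ∑ l ∈ Finset.range (M + 1),
      evalCurve ν σ z y 0 (expCoeff (timeSymbol n ν σ) (spaceSymbol y) l) := by
  simp only [evalCurve_at_zero, evalGauss_expCoeff]
  exact (sum_taylorIdx' M fun γ β =>
    taylorCoeff ν (γ, β) * (σ : ℂ) ^ len γ * monom β y * taylorFun ν (γ, β) z).symm

theorem norm_monom_le (β : Fin n → ℕ) (y : Euc n) : ‖monom β y‖ ≤ ‖y‖ ^ len β := by
  rw [monom, norm_prod, len, ← Finset.prod_pow_eq_pow_sum]
  refine Finset.prod_le_prod (fun j _ => norm_nonneg _) fun j _ => ?_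
  rw [norm_pow, Complex.norm_real]
  gcongr
  exact PiLp.norm_apply_le y j

theorem exists_norm_taylorFun_le {ν : ℂ} (hν : 0 < ν.re) (q : (Fin n → ℕ) × (Fin n → ℕ)) :
    ∃ C : ℝ, 0 ≤ C ∧ ∀ z : Euc n, ‖taylorFun ν q z‖ ≤ C * Real.exp (-(rate ν / 4 * ‖z‖ ^ 2)) := by
  obtain ⟨C, hC0, hC⟩ := exists_norm_gaussDeriv_le hν (2 • q.1 + q.2)
  refine ⟨C, hC0, fun z => ?_⟩
  have h := hC 1 (by norm_num) le_rfl z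
  rw [Complex.ofReal_one, one_mul] at h
  refine h.trans ?_
  have := rate_pos hν
  gcongr
  norm_num

theorem exists_norm_taylorPoly_le {ν : ℂ} (hν : 0 < ν.re) (n M : ℕ) :
    ∃ C : ℝ, 0 ≤ C ∧ ∀ (z : Euc n) (σ : ℝ) (y : Euc n), 0 ≤ σ →
      ‖taylorPoly ν M z σ y‖ ≤ C * (1 + (√σ + ‖y‖)) ^ M * Real.exp (-(rate ν / 4 * ‖z‖ ^ 2)) := by
  choose C hC0 hC using fun q : (Fin n → ℕ) × (Fin n → ℕ) => exists_norm_taylorFun_le hν q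
  refine ⟨∑ q ∈ taylorIdx n M, ‖taylorCoeff ν q‖ * C q,
    Finset.sum_nonneg fun q _ => mul_nonneg (norm_nonneg _) (hC0 q), fun z σ y hσ => ?_⟩
  rw [taylorPoly, Finset.sum_mul, Finset.sum_mul]
  refine norm_sum_le_of_le _ fun q hq => ?_
  rw [mem_taylorIdx] at hq
  set ρ := √σ + ‖y‖ with hρ
  have hρ0 : 0 ≤ ρ := by positivity
  have h1 : σ ^ len q.1 * ‖y‖ ^ len q.2 ≤ (1 + ρ) ^ M := by
    have e1 : σ = √σ ^ 2 := (Real.sq_sqrt hσ).symm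
    have e2 : √σ ≤ 1 + ρ := by linarith [norm_nonneg y]
    have e3 : ‖y‖ ≤ 1 + ρ := by linarith [Real.sqrt_nonneg σ]
    calc σ ^ len q.1 * ‖y‖ ^ len q.2 = √σ ^ (2 * len q.1) * ‖y‖ ^ len q.2 := by
          rw [pow_mul, Real.sq_sqrt hσ]
      _ ≤ (1 + ρ) ^ (2 * len q.1) * (1 + ρ) ^ len q.2 := by gcongr
      _ = (1 + ρ) ^ (2 * len q.1 + len q.2) := (pow_add _ _ _).symm
      _ ≤ (1 + ρ) ^ M := pow_le_pow_right₀ (by linarith) hq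
  rw [norm_mul, norm_mul, norm_mul, norm_pow, Complex.norm_real, Real.norm_of_nonneg hσ]
  calc ‖taylorCoeff ν q‖ * σ ^ len q.1 * ‖monom q.2 y‖ * ‖taylorFun ν q z‖
      ≤ ‖taylorCoeff ν q‖ * σ ^ len q.1 * ‖y‖ ^ len q.2 *
        (C q * Real.exp (-(rate ν / 4 * ‖z‖ ^ 2))) := by
        gcongr
        · exact norm_monom_le _ _
        · exact hC q z
    _ = ‖taylorCoeff ν q‖ * C q * (σ ^ len q.1 * ‖y‖ ^ len q.2) *
        Real.exp (-(rate ν / 4 * ‖z‖ ^ 2)) := by ring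
    _ ≤ _ := by
        have := mul_nonneg (norm_nonneg (taylorCoeff ν q)) (hC0 q)
        gcongr

/-- The modulus `r^M min(1, r)` of the remainder. -/
def modulus (M : ℕ) (r : ℝ) : ℝ := r ^ M * min 1 r

theorem modulus_nonneg (M : ℕ) {r : ℝ} (hr : 0 ≤ r) : 0 ≤ modulus M r := by
  unfold modulus
  positivity

theorem modulus_add_le (M : ℕ) {a b : ℝ} (ha : 0 ≤ a) (hb : 0 ≤ b) :
    modulus M (a + b) ≤ 2 ^ (M + 1) * (modulus M a + modulus M b) := by
  have key : ∀ a b : ℝ, 0 ≤ a → 0 ≤ b → a ≤ b → modulus M (a + b) ≤ 2 ^ (M + 1) * modulus M b := by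
    intro a b ha hb hab
    have h1 : min 1 (a + b) ≤ 2 * min 1 b := by
      rcases le_total 1 b with h | h
      · rw [min_eq_left h]
        linarith [min_le_left 1 (a + b)]
      · rw [min_eq_right h]
        linarith [min_le_right 1 (a + b)]
    calc modulus M (a + b) ≤ (2 * b) ^ M * (2 * min 1 b) := by
          unfold modulus
          gcongr
          linarith
      _ = 2 ^ (M + 1) * modulus M b := by
          unfold modulus
          rw [mul_pow]
          ring
  rcases le_total a b with h | h
  · refine (key a b ha hb h).trans ?_
    have := modulus_nonneg M ha
    gcongr
    linarith
  · rw [add_comm]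
    refine (key b a hb ha h).trans ?_
    have := modulus_nonneg M hb
    gcongr
    linarith

/-- For `|y| ≤ 1` the remainder of order `M + 1` applies, and `ρ ≤ 2` turns `ρ^(M+1)` into `ρ^M
min(1, ρ)`. For `|y| > 1` kernel and polynomial are bounded separately by `ρ^M`; they concentrate at
`y` and at `0`, which explains the two exponentials. Growth of order `M` only means that no moment
beyond the `M`-th is required. -/
theorem exists_norm_gaussian_sub_taylorPoly_le {ν : ℂ} (hν : 0 < ν.re) (n M : ℕ) :
    ∃ C : ℝ, 0 ≤ C ∧ ∀ (z : Euc n) (σ : ℝ) (y : Euc n), 0 ≤ σ → σ ≤ 1 / 2 →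
      ‖gaussian (((1 - σ : ℝ) : ℂ) * ν) (z - y) - taylorPoly ν M z σ y‖ ≤
        C * modulus M (√σ + ‖y‖) *
          (Real.exp (-(rate ν / 4 * ‖z‖ ^ 2)) + Real.exp (-(rate ν / 4 * ‖z - y‖ ^ 2))) := by
  obtain ⟨C₁, hC₁, h1⟩ := exists_norm_taylorRem_le (n := n) hν (M + 1) 0
  obtain ⟨C₂, hC₂, h2⟩ := exists_norm_taylorPoly_le hν n M
  obtain ⟨C₃, hC₃, h3⟩ := exists_norm_gaussDeriv_le (n := n) hν 0
  have hr := rate_pos hν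
  refine ⟨2 * C₁ + 2 ^ M * C₂ + C₃, by positivity, fun z σ y hσ0 hσ => ?_⟩
  set ρ := √σ + ‖y‖ with hρ
  have hρ0 : 0 ≤ ρ := by positivity
  set E₁ := Real.exp (-(rate ν / 4 * ‖z‖ ^ 2))
  set E₂ := Real.exp (-(rate ν / 4 * ‖z - y‖ ^ 2))
  have hE₁ : 0 < E₁ := Real.exp_pos _
  have hE₂ : 0 < E₂ := Real.exp_pos _
  have hmod := modulus_nonneg M hρ0
  rcases le_or_gt ‖y‖ 1 with hy | hy
  · have h := h1 σ z y 1 hσ0 hσ hy zero_le_one le_rfl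
    have e : taylorRem ν σ z y (M + 1) (MvPolynomial.monomial 0 1) 1 =
        gaussian (((1 - σ : ℝ) : ℂ) * ν) (z - y) - taylorPoly ν M z σ y := by
      rw [taylorRem, taylorPoly_eq, evalCurve, evalGauss_monomial, one_mul, Finsupp.coe_zero,
        gaussDeriv_zero]
      simp
    rw [e] at h
    refine h.trans ?_
    have h4 : ρ ^ (M + 1) ≤ 2 * modulus M ρ := by
      have h5 : √σ ≤ 1 := Real.sqrt_le_one.2 (by linarith)
      have h6 : ρ ≤ 2 * min 1 ρ := by
        rcases le_total 1 ρ with h | h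
        · rw [min_eq_left h]
          linarith
        · rw [min_eq_right h]
          linarith
      calc ρ ^ (M + 1) = ρ ^ M * ρ := pow_succ _ _
        _ ≤ ρ ^ M * (2 * min 1 ρ) := by gcongr
        _ = 2 * modulus M ρ := by
          unfold modulus
          ring
    calc C₁ * ρ ^ (M + 1) * E₁ ≤ C₁ * (2 * modulus M ρ) * (E₁ + E₂) := by
          gcongr
          linarith
      _ = (2 * C₁) * modulus M ρ * (E₁ + E₂) := by ring
      _ ≤ _ := by
          gcongr
          have : 0 ≤ 2 ^ M * C₂ := by positivity
          linarith
  · have hρ1 : 1 ≤ ρ := by linarith [Real.sqrt_nonneg σ]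
    have hm : modulus M ρ = ρ ^ M := by rw [modulus, min_eq_left hρ1, mul_one]
    have hm1 : 1 ≤ modulus M ρ := by
      rw [hm]
      exact one_le_pow₀ hρ1
    have a1 : ‖gaussian (((1 - σ : ℝ) : ℂ) * ν) (z - y)‖ ≤ C₃ * modulus M ρ * E₂ := by
      have h := h3 (1 - σ) (by linarith) (by linarith) (z - y)
      rw [gaussDeriv_zero] at h
      refine h.trans ?_
      refine mul_le_mul (le_mul_of_one_le_right hC₃ hm1) ?_ (Real.exp_pos _).le (by positivity)
      rw [Real.exp_le_exp]
      nlinarith [sq_nonneg ‖z - y‖]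
    have a2 : ‖taylorPoly ν M z σ y‖ ≤ 2 ^ M * C₂ * modulus M ρ * E₁ := by
      refine (h2 z σ y hσ0).trans ?_
      rw [hm]
      calc C₂ * (1 + ρ) ^ M * E₁ ≤ C₂ * (2 * ρ) ^ M * E₁ := by
            gcongr
            linarith
        _ = _ := by
            rw [mul_pow]
            ring
    refine (norm_sub_le _ _).trans ((add_le_add a1 a2).trans ?_)
    have b1 : 0 ≤ C₁ * modulus M ρ := by positivity
    have b2 : 0 ≤ 2 ^ M * C₂ * modulus M ρ := by positivity
    have b3 : 0 ≤ C₃ * modulus M ρ := by positivity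
    nlinarith [mul_nonneg b1 hE₁.le, mul_nonneg b1 hE₂.le, mul_nonneg b2 hE₂.le, mul_nonneg b3 hE₁.le]

end CGL

end

noncomputable section

namespace CGL

variable {n : ℕ}

/-! ### Rescaled size -/

/-- `h` has size `a` in `L¹` and size `a t^(-n/2)` in `L^∞`. -/
structure RescaledSize (t a : ℝ) (h : LOne n) : Prop where
  norm_le : ‖h‖ ≤ a
  ae_le : ∀ᵐ x, ‖h x‖ ≤ a * t ^ (-(n : ℝ) / 2)

namespace RescaledSize

variable {t a b : ℝ} {g h : LOne n}

theorem mono (ht : 0 < t) (hab : a ≤ b) (hh : RescaledSize t a h) : RescaledSize t b h where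
  norm_le := hh.norm_le.trans hab
  ae_le := by
    filter_upwards [hh.ae_le] with x hx
    refine hx.trans ?_
    gcongr

theorem zero : RescaledSize t 0 (0 : LOne n) where
  norm_le := by simp
  ae_le := by
    filter_upwards [Lp.coeFn_zero ℂ 1 (volume : Measure (Euc n))] with x hx
    simp

theorem add (hg : RescaledSize t a g) (hh : RescaledSize t b h) : RescaledSize t (a + b) (g + h) where
  norm_le := (norm_add_le _ _).trans (add_le_add hg.norm_le hh.norm_le)
  ae_le := by
    rw [add_mul]
    exact ae_le_add hg.ae_le hh.ae_le

theorem sub (hg : RescaledSize t a g) (hh : RescaledSize t b h) : RescaledSize t (a + b) (g - h) where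
  norm_le := (norm_sub_le _ _).trans (add_le_add hg.norm_le hh.norm_le)
  ae_le := by
    rw [add_mul]
    exact ae_le_sub hg.ae_le hh.ae_le

theorem integral {β : Type*} [MeasurableSpace β] {ρ : Measure β} {F : β → LOne n}
    (hF : Integrable F ρ) {b : β → ℝ} (hb : Integrable b ρ)
    (h : ∀ᵐ s ∂ρ, RescaledSize t (b s) (F s)) : RescaledSize t (∫ s, b s ∂ρ) (∫ s, F s ∂ρ) where
  norm_le := norm_integral_le_of_norm_le hb (h.mono fun s hs => hs.norm_le)
  ae_le := by
    rw [← integral_mul_const]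
    exact ae_norm_integral_le hF (hb.mul_const _) (h.mono fun s hs => hs.ae_le)

end RescaledSize

/-! ### Integral operators with rescaled Gaussian kernels -/

theorem rpow_scale_mul {t : ℝ} (ht : 0 < t) (n : ℕ) :
    t ^ (-(n : ℝ) / 2) * |((t ^ (-(1 : ℝ) / 2)) ^ n)⁻¹| = 1 := by
  rw [abs_of_nonneg (by positivity), ← Real.rpow_natCast, ← Real.rpow_mul ht.le, ← Real.rpow_neg ht.le,
    ← Real.rpow_add ht]
  convert! Real.rpow_zero t using 2
  ring

theorem integral_scaled_exp {κ t : ℝ} (hκ : 0 < κ) (ht : 0 < t) :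
    Integrable (fun x : Euc n => t ^ (-(n : ℝ) / 2) *
      Real.exp (-(κ * ‖t ^ (-(1 : ℝ) / 2) • x‖ ^ 2))) ∧
    ∫ x : Euc n, t ^ (-(n : ℝ) / 2) * Real.exp (-(κ * ‖t ^ (-(1 : ℝ) / 2) • x‖ ^ 2)) =
      ∫ x : Euc n, Real.exp (-(κ * ‖x‖ ^ 2)) := by
  have hr : t ^ (-(1 : ℝ) / 2) ≠ 0 := by positivity
  refine ⟨((integrable_exp_neg_norm_sq hκ).comp_smul hr).const_mul _, ?_⟩
  rw [integral_const_mul, Measure.integral_comp_smul volume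
    (fun x : Euc n => Real.exp (-(κ * ‖x‖ ^ 2))), finrank_euclideanSpace_fin, smul_eq_mul, ← mul_assoc,
    rpow_scale_mul ht, one_mul]

/-- Integral operators with a rescaled Gaussian kernel. -/
theorem exists_rescaledSize_of_kernel {κ : ℝ} (hκ : 0 < κ) (n : ℕ) :
    ∃ I : ℝ, 0 ≤ I ∧ ∀ (t : ℝ), 0 < t → ∀ (k : Euc n → Euc n → ℂ) (b : Euc n → ℝ), Measurable b →
      (∀ y, 0 ≤ b y) →
      (∀ x y, ‖k x y‖ ≤ b y * (t ^ (-(n : ℝ) / 2) *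
        (Real.exp (-(κ * ‖t ^ (-(1 : ℝ) / 2) • x‖ ^ 2)) +
          Real.exp (-(κ * ‖t ^ (-(1 : ℝ) / 2) • (x - y)‖ ^ 2))))) →
      ∀ (g h : LOne n), (h =ᵐ[volume] fun x => ∫ y, k x y * g y) →
      ∀ a : ℝ, 0 ≤ a → wnorm (fun y => ENNReal.ofReal (b y)) g ≤ ENNReal.ofReal a →
      RescaledSize t (I * a) h := by
  have hJ0 : 0 ≤ ∫ x : Euc n, Real.exp (-(κ * ‖x‖ ^ 2)) := integral_nonneg fun _ => (Real.exp_pos _).le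
  -- The first summand serves the `L¹` bound (the `x`-integral of the two exponentials, via
  -- Tonelli), the second the sup bound (each exponential is at most one).
  refine ⟨2 * (∫ x : Euc n, Real.exp (-(κ * ‖x‖ ^ 2))) + 2, by positivity,
    fun t ht k b hb hb0 hk g h hh a ha hga => ?_⟩
  set J := ∫ x : Euc n, Real.exp (-(κ * ‖x‖ ^ 2)) with hJ
  set r := t ^ (-(1 : ℝ) / 2) with hr
  set c := t ^ (-(n : ℝ) / 2) with hc
  have hc0 : 0 < c := by positivity
  set E : Euc n → Euc n → ℝ := fun x y =>
    c * (Real.exp (-(κ * ‖r • x‖ ^ 2)) + Real.exp (-(κ * ‖r • (x - y)‖ ^ 2))) with hE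
  have hE0 : ∀ x y, 0 ≤ E x y := fun x y => by
    simp only [hE]
    positivity
  have hEc : Continuous fun q : Euc n × Euc n => E q.1 q.2 := by
    simp only [hE]
    fun_prop
  have hEint : ∀ y, ∫⁻ x, ENNReal.ofReal (E x y) = ENNReal.ofReal (2 * J) := fun y => by
    have h1 := integral_scaled_exp (n := n) hκ ht
    have h2 : Integrable fun x : Euc n => c * Real.exp (-(κ * ‖r • (x - y)‖ ^ 2)) := h1.1.comp_sub_right y
    have h3 : ∫ x : Euc n, c * Real.exp (-(κ * ‖r • (x - y)‖ ^ 2)) = J := by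
      rw [integral_sub_right_eq_self (fun x : Euc n => c * Real.exp (-(κ * ‖r • x‖ ^ 2))) y]
      exact h1.2
    have h4 : ∀ x, E x y = c * Real.exp (-(κ * ‖r • x‖ ^ 2)) + c * Real.exp (-(κ * ‖r • (x - y)‖ ^ 2)) :=
      fun x => by simp only [hE, mul_add]
    have h5 : Integrable fun x => E x y := by
      simp_rw [h4]
      exact h1.1.add h2
    rw [← ofReal_integral_eq_lintegral_ofReal h5 (Eventually.of_forall fun x => hE0 x y)]
    simp_rw [h4]
    rw [integral_add h1.1 h2, h3, h1.2, two_mul]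
  have hpt : ∀ᵐ x, ‖h x‖ₑ ≤ ∫⁻ y, ENNReal.ofReal (E x y) * (ENNReal.ofReal (b y) * ‖g y‖ₑ) := by
    filter_upwards [hh] with x hx
    rw [hx]
    refine (enorm_integral_le_lintegral_enorm _).trans (lintegral_mono fun y => ?_)
    dsimp only
    rw [enorm_mul, ← mul_assoc, ← ENNReal.ofReal_mul (hE0 x y), ← ofReal_norm (k x y), mul_comm (E x y)]
    gcongr
    exact hk x y
  refine ⟨?_, ?_⟩
  · have hm : AEMeasurable (Function.uncurry fun x y : Euc n =>
        ENNReal.ofReal (E x y) * (ENNReal.ofReal (b y) * ‖g y‖ₑ)) (volume.prod volume) := by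
      have m1 : Measurable fun q : Euc n × Euc n => ENNReal.ofReal (E q.1 q.2) :=
        hEc.measurable.ennreal_ofReal
      have m2 : Measurable fun q : Euc n × Euc n => ENNReal.ofReal (b q.2) * ‖g q.2‖ₑ :=
        ((hb.comp measurable_snd).ennreal_ofReal).mul
          ((Lp.stronglyMeasurable g).measurable.comp measurable_snd).enorm
      exact (m1.mul m2).aemeasurable
    have h1 : ENNReal.ofReal ‖h‖ ≤ ENNReal.ofReal (2 * J * a) := by
      rw [← wnorm_one]
      calc wnorm 1 h = ∫⁻ x, ‖h x‖ₑ := by simp [wnorm]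
        _ ≤ ∫⁻ x, ∫⁻ y, ENNReal.ofReal (E x y) * (ENNReal.ofReal (b y) * ‖g y‖ₑ) :=
            lintegral_mono_ae hpt
        _ = ∫⁻ y, ∫⁻ x, ENNReal.ofReal (E x y) * (ENNReal.ofReal (b y) * ‖g y‖ₑ) :=
            lintegral_lintegral_swap hm
        _ = ∫⁻ y, ENNReal.ofReal (2 * J) * (ENNReal.ofReal (b y) * ‖g y‖ₑ) := by
            refine lintegral_congr fun y => ?_
            rw [lintegral_mul_const _ (by
              exact (hEc.comp (continuous_id.prodMk continuous_const)).measurable.ennreal_ofReal), hEint]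
        _ = ENNReal.ofReal (2 * J) * wnorm (fun y => ENNReal.ofReal (b y)) g :=
            lintegral_const_mul' _ _ ENNReal.ofReal_ne_top
        _ ≤ ENNReal.ofReal (2 * J) * ENNReal.ofReal a := by gcongr
        _ = _ := (ENNReal.ofReal_mul (by positivity)).symm
    refine ((ENNReal.ofReal_le_ofReal_iff (by positivity)).1 h1).trans ?_
    gcongr
    linarith
  · filter_upwards [hpt] with x hx
    have hE2 : ∀ y, E x y ≤ 2 * c := fun y => by
      have e : ∀ v : Euc n, Real.exp (-(κ * ‖v‖ ^ 2)) ≤ 1 := fun v =>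
        Real.exp_le_one_iff.2 (by
          have : 0 ≤ κ * ‖v‖ ^ 2 := by positivity
          linarith)
      simp only [hE]
      rw [mul_comm]
      gcongr
      linarith [e (r • x), e (r • (x - y))]
    have h1 : ENNReal.ofReal ‖h x‖ ≤ ENNReal.ofReal (2 * c * a) := by
      rw [ofReal_norm]
      calc ‖h x‖ₑ ≤ ∫⁻ y, ENNReal.ofReal (E x y) * (ENNReal.ofReal (b y) * ‖g y‖ₑ) := hx
        _ ≤ ∫⁻ y, ENNReal.ofReal (2 * c) * (ENNReal.ofReal (b y) * ‖g y‖ₑ) := by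
            refine lintegral_mono fun y => ?_
            dsimp only
            gcongr
            exact hE2 y
        _ = ENNReal.ofReal (2 * c) * wnorm (fun y => ENNReal.ofReal (b y)) g :=
            lintegral_const_mul' _ _ ENNReal.ofReal_ne_top
        _ ≤ ENNReal.ofReal (2 * c) * ENNReal.ofReal a := by gcongr
        _ = _ := (ENNReal.ofReal_mul (by positivity)).symm
    refine ((ENNReal.ofReal_le_ofReal_iff (by positivity)).1 h1).trans ?_
    have : 0 ≤ J * a * c := by positivity
    nlinarith

/-! ### Moments -/

theorem powWeight_le {j M : ℕ} (hj : j ≤ M) : powWeight n j ≤ 1 + powWeight n M := fun x => by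
  simp only [powWeight, Pi.add_apply, Pi.one_apply]
  rcases le_total ‖x‖ₑ 1 with h | h
  · exact (pow_le_one' h j).trans le_self_add
  · exact (pow_le_pow_right' h hj).trans le_add_self

theorem wnorm_add_weight {k : Euc n → ℝ≥0∞} (hk : Measurable k) (l : Euc n → ℝ≥0∞) (g : LOne n) :
    wnorm (k + l) g = wnorm k g + wnorm l g := by
  have hm : AEMeasurable (fun x => k x * ‖g x‖ₑ) :=
    hk.aemeasurable.mul (Lp.aestronglyMeasurable g).enorm
  rw [wnorm, wnorm, wnorm, ← lintegral_add_left' hm]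
  simp only [Pi.add_apply, add_mul]

theorem wnorm_powWeight_lt_top {j M : ℕ} (hj : j ≤ M) {g : LOne n}
    (hg : wnorm (powWeight n M) g < ∞) : wnorm (powWeight n j) g < ∞ := by
  refine (wnorm_mono (powWeight_le hj) g).trans_lt ?_
  rw [wnorm_add_weight measurable_one, wnorm_one]
  exact ENNReal.add_lt_top.2 ⟨ENNReal.ofReal_lt_top, hg⟩

theorem continuous_monom (β : Fin n → ℕ) : Continuous (monom β : Euc n → ℂ) := by
  unfold monom
  fun_prop

theorem enorm_monom_le (β : Fin n → ℕ) (y : Euc n) : ‖monom β y‖ₑ ≤ powWeight n (len β) y := by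
  rw [powWeight, ← ofReal_norm, ← ofReal_norm, ← ENNReal.ofReal_pow (norm_nonneg _)]
  exact ENNReal.ofReal_le_ofReal (norm_monom_le β y)

theorem wnorm_monom_le (β : Fin n → ℕ) (g : LOne n) :
    wnorm (fun x => ‖monom β x‖ₑ) g ≤ wnorm (powWeight n (len β)) g :=
  wnorm_mono (enorm_monom_le β) g

theorem integrable_monom_mul {M : ℕ} {β : Fin n → ℕ} (hβ : len β ≤ M) {g : LOne n}
    (hg : wnorm (powWeight n M) g < ∞) : Integrable fun y => monom β y * g y := by
  refine ⟨(continuous_monom β).aestronglyMeasurable.mul (Lp.aestronglyMeasurable g), ?_⟩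
  have := (wnorm_monom_le β g).trans_lt (wnorm_powWeight_lt_top hβ hg)
  simpa only [HasFiniteIntegral, enorm_mul, wnorm] using this

theorem memWeightedL1_of_wnorm {M : ℕ} {g : LOne n} (hg : wnorm (powWeight n M) g < ∞) :
    MemWeightedL1 M g :=
  ⟨L1.integrable_coeFn g, fun _ hα => integrable_monom_mul hα hg⟩

/-- Interpolation by splitting at `|x| = √(1+t)`: inside, `|x|^j ≤ (1+t)^(j/2)`; outside, `|x|^j ≤
(1+t)^((j-M)/2) |x|^M`. -/
theorem Sized.wnorm_powWeight_le {j M : ℕ} (hj : j ≤ M) {t R : ℝ} (ht : 0 ≤ t) {g : LOne n}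
    (h : Sized M t R g) :
    wnorm (powWeight n j) g ≤ ENNReal.ofReal (2 * R * (1 + t) ^ ((j : ℝ) / 2)) := by
  have hR := h.nonneg
  have h1t : 0 < 1 + t := by linarith
  set c := (1 + t) ^ ((j : ℝ) / 2) with hc
  set d := (1 + t) ^ (((j : ℝ) - M) / 2) with hd
  have hw : powWeight n j ≤ (fun _ => ENNReal.ofReal c) + fun x => ENNReal.ofReal d * powWeight n M x := by
    intro x
    simp only [powWeight, Pi.add_apply]
    rw [← ofReal_norm, ← ENNReal.ofReal_pow (norm_nonneg _), ← ENNReal.ofReal_pow (norm_nonneg _),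
      ← ENNReal.ofReal_mul (by positivity), ← ENNReal.ofReal_add (by positivity) (by positivity)]
    refine ENNReal.ofReal_le_ofReal ?_
    have hs : (1 + t) ^ ((1 : ℝ) / 2) = √(1 + t) := (Real.sqrt_eq_rpow _).symm
    have hs0 : 0 < √(1 + t) := Real.sqrt_pos.2 h1t
    have hcs : c = √(1 + t) ^ j := by
      rw [hc, Real.sqrt_eq_rpow, ← Real.rpow_natCast, ← Real.rpow_mul h1t.le]
      congr 1
      ring
    rcases le_total ‖x‖ √(1 + t) with h | h
    · have : ‖x‖ ^ j ≤ c := by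
        rw [hcs]
        gcongr
      have : 0 ≤ d * ‖x‖ ^ M := by positivity
      linarith
    · have hds : d * √(1 + t) ^ (M - j) = 1 := by
        rw [hd, Real.sqrt_eq_rpow, ← Real.rpow_natCast, ← Real.rpow_mul h1t.le, ← Real.rpow_add h1t,
          Nat.cast_sub hj]
        convert! Real.rpow_zero _ using 2
        ring
      calc ‖x‖ ^ j = d * √(1 + t) ^ (M - j) * ‖x‖ ^ j := by rw [hds, one_mul]
        _ ≤ d * ‖x‖ ^ (M - j) * ‖x‖ ^ j := by gcongr
        _ = d * ‖x‖ ^ M := by rw [mul_assoc, ← pow_add, Nat.sub_add_cancel hj]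
        _ ≤ _ := by linarith [show 0 ≤ c by positivity]
  refine (wnorm_mono hw g).trans ?_
  rw [wnorm_add_weight measurable_const]
  have e1 : wnorm (fun _ => ENNReal.ofReal c) g = ENNReal.ofReal c * ENNReal.ofReal ‖g‖ := by
    rw [← wnorm_one, wnorm, wnorm, ← lintegral_const_mul' _ _ ENNReal.ofReal_ne_top]
    simp
  have e2 : wnorm (fun x => ENNReal.ofReal d * powWeight n M x) g =
      ENNReal.ofReal d * wnorm (powWeight n M) g := by
    rw [wnorm, wnorm, ← lintegral_const_mul' _ _ ENNReal.ofReal_ne_top]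
    simp only [mul_assoc]
  rw [e1, e2]
  calc ENNReal.ofReal c * ENNReal.ofReal ‖g‖ + ENNReal.ofReal d * wnorm (powWeight n M) g
      ≤ ENNReal.ofReal c * ENNReal.ofReal R +
        ENNReal.ofReal d * ENNReal.ofReal (R * (1 + t) ^ ((M : ℝ) / 2)) := by
        gcongr
        · exact h.norm_le
        · exact h.wnorm_le
    _ = ENNReal.ofReal (2 * R * c) := by
        rw [← ENNReal.ofReal_mul (by positivity), ← ENNReal.ofReal_mul (by positivity),
          ← ENNReal.ofReal_add (by positivity) (by positivity)]
        congr 1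
        have : d * (1 + t) ^ ((M : ℝ) / 2) = c := by
          rw [hd, ← Real.rpow_add h1t]
          congr 1
          ring
        calc c * R + d * (R * (1 + t) ^ ((M : ℝ) / 2))
            = c * R + R * (d * (1 + t) ^ ((M : ℝ) / 2)) := by ring
          _ = _ := by
            rw [this]
            ring

/-- A source term with the decay of `f(u(s))`. -/
structure DecaySource (M : ℕ) (σ A : ℝ) (w : ℝ → LOne n) : Prop where
  continuousOn : ContinuousOn w (Ici 0)
  sized : ∀ s, 0 ≤ s → Sized M s (A * (1 + s) ^ (-σ)) (w s)
  lt : (M : ℝ) / 2 + 1 < σ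

namespace DecaySource

variable {M : ℕ} {σ A : ℝ} {w : ℝ → LOne n}

theorem nonneg (h : DecaySource M σ A w) : 0 ≤ A := by simpa using (h.sized 0 le_rfl).nonneg

theorem integrableOn_weight (h : DecaySource M σ A w) :
    IntegrableOn (fun s : ℝ => (1 + s) ^ (-(σ - (M : ℝ) / 2))) (Ioi 0) :=
  integrableOn_one_add_rpow (by linarith [h.lt])

theorem aestronglyMeasurable (h : DecaySource M σ A w) :
    AEStronglyMeasurable w (volume.restrict (Ioi 0)) :=
  (h.continuousOn.mono Ioi_subset_Ici_self).aestronglyMeasurable measurableSet_Ioi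

/-- A factor `s^k` costs as much as `2k` moments, so parabolic length at most `M` leaves the
exponent `σ - M/2`, which exceeds one for a `DecaySource`. All time integrals in the profiles
converge for this reason. -/
theorem pow_mul_le {s : ℝ} (hs : 0 ≤ s) {j k : ℕ} (hjk : j + 2 * k ≤ M) :
    s ^ k * ((1 + s) ^ (-σ) * (1 + s) ^ ((j : ℝ) / 2)) ≤ (1 + s) ^ (-(σ - (M : ℝ) / 2)) := by
  have h1 : 0 < 1 + s := by linarith
  calc s ^ k * ((1 + s) ^ (-σ) * (1 + s) ^ ((j : ℝ) / 2))
      ≤ (1 + s) ^ k * ((1 + s) ^ (-σ) * (1 + s) ^ ((j : ℝ) / 2)) := by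
        gcongr
        linarith
    _ = (1 + s) ^ ((k : ℝ) + (-σ + (j : ℝ) / 2)) := by
        rw [Real.rpow_add h1, Real.rpow_add h1, Real.rpow_natCast]
    _ ≤ _ := by
        refine Real.rpow_le_rpow_of_exponent_le (by linarith) ?_
        have : ((j + 2 * k : ℕ) : ℝ) ≤ M := by exact_mod_cast hjk
        push_cast at this
        linarith

theorem integrableOn_pow_smul (h : DecaySource M σ A w) {k : ℕ} (hk : 2 * k ≤ M) :
    IntegrableOn (fun s : ℝ => s ^ k • w s) (Ioi 0) := by
  have hA := h.nonneg
  refine (h.integrableOn_weight.const_mul A).mono'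
    ((continuous_pow k).aestronglyMeasurable.smul h.aestronglyMeasurable)
    ((ae_restrict_iff' measurableSet_Ioi).2 (Eventually.of_forall fun s hs => ?_))
  have hs : 0 < s := hs
  rw [norm_smul, Real.norm_of_nonneg (by positivity)]
  have h2 := pow_mul_le (M := M) (σ := σ) hs.le (j := 0) (k := k) (by omega)
  rw [Nat.cast_zero, zero_div, Real.rpow_zero, mul_one] at h2
  calc s ^ k * ‖w s‖ ≤ s ^ k * (A * (1 + s) ^ (-σ)) := by
        gcongr
        exact (h.sized s hs.le).norm_le
    _ = A * (s ^ k * (1 + s) ^ (-σ)) := by ring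
    _ ≤ _ := by gcongr

theorem wnorm_pow_smul_le (h : DecaySource M σ A w) {j k : ℕ} (hjk : j + 2 * k ≤ M) {s : ℝ}
    (hs : 0 ≤ s) : wnorm (powWeight n j) (s ^ k • w s) ≤
      ENNReal.ofReal (2 * A * (1 + s) ^ (-(σ - (M : ℝ) / 2))) := by
  have hA := h.nonneg
  have e : s ^ k • w s = ((s ^ k : ℝ) : ℂ) • w s := (Complex.coe_smul _ _).symm
  rw [e, wnorm_smul, ← ofReal_norm, Complex.norm_real, Real.norm_of_nonneg (by positivity)]
  calc ENNReal.ofReal (s ^ k) * wnorm (powWeight n j) (w s)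
      ≤ ENNReal.ofReal (s ^ k) * ENNReal.ofReal (2 * (A * (1 + s) ^ (-σ)) * (1 + s) ^ ((j : ℝ) / 2)) := by
        gcongr
        exact (h.sized s hs).wnorm_powWeight_le (by omega) hs
    _ = ENNReal.ofReal (2 * A * (s ^ k * ((1 + s) ^ (-σ) * (1 + s) ^ ((j : ℝ) / 2)))) := by
        rw [← ENNReal.ofReal_mul (by positivity)]
        congr 1
        ring
    _ ≤ _ := by
        gcongr
        exact pow_mul_le hs hjk

theorem ae_wnorm_pow_smul_le (h : DecaySource M σ A w) {j k : ℕ} (hjk : j + 2 * k ≤ M) :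
    ∀ᵐ s ∂(volume.restrict (Ioi (0 : ℝ))), wnorm (powWeight n j) (s ^ k • w s) ≤
      ENNReal.ofReal (2 * A * (1 + s) ^ (-(σ - (M : ℝ) / 2))) :=
  (ae_restrict_iff' measurableSet_Ioi).2 (Eventually.of_forall fun _ hs =>
    h.wnorm_pow_smul_le hjk (le_of_lt hs))

theorem wnorm_integral_le (h : DecaySource M σ A w) {j k : ℕ} (hjk : j + 2 * k ≤ M) :
    wnorm (powWeight n j) (∫ s in Ioi (0 : ℝ), s ^ k • w s) ≤
      ENNReal.ofReal (2 * A * decayMass (σ - (M : ℝ) / 2)) := by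
  have hA := h.nonneg
  refine (CGL.wnorm_integral_le (measurable_powWeight n j) (h.integrableOn_pow_smul (by omega))).trans ?_
  refine (lintegral_mono_ae (h.ae_wnorm_pow_smul_le hjk)).trans_eq ?_
  rw [decayMass, ← integral_const_mul,
    ofReal_integral_eq_lintegral_ofReal (h.integrableOn_weight.const_mul (2 * A))]
  refine (ae_restrict_iff' measurableSet_Ioi).2 (Eventually.of_forall fun s hs => ?_)
  have : (0 : ℝ) < s := hs
  dsimp only [Pi.zero_apply]
  positivity

/-- Moments of the time integrals of the source. -/
theorem moment_integral (h : DecaySource M σ A w) {k : ℕ} {β : Fin n → ℕ} (hk : 2 * k + len β ≤ M) :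
    IntegrableOn (fun s : ℝ => ((s : ℂ) ^ k) * ∫ y, monom β y * w s y) (Ioi 0) ∧
    ∫ y, monom β y * (∫ s in Ioi (0 : ℝ), s ^ k • w s : LOne n) y =
      ∫ s in Ioi (0 : ℝ), ((s : ℂ) ^ k) * ∫ y, monom β y * w s y := by
  have hm := integral_mul_integral (continuous_monom β).measurable
    (h.integrableOn_pow_smul (k := k) (by omega)) (h.integrableOn_weight.const_mul (2 * A))
    (by
      filter_upwards [h.ae_wnorm_pow_smul_le (j := len β) (k := k) (by omega)] with s hs
      exact (wnorm_monom_le β _).trans hs)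
  have e : ∀ s : ℝ, ∫ y, monom β y * (s ^ k • w s : LOne n) y =
      ((s : ℂ) ^ k) * ∫ y, monom β y * w s y := fun s => by
    rw [← integral_const_mul]
    refine integral_congr_ae ?_
    filter_upwards [Lp.coeFn_smul (s ^ k : ℝ) (w s)] with y hy
    rw [hy, Pi.smul_apply, Complex.real_smul]
    push_cast
    ring
  simp_rw [e] at hm
  exact hm.2

end DecaySource

end CGL

end

noncomputable section

namespace CGL

variable {n : ℕ}

/-! ### The profile as an element of `L¹` -/

/-- The rescaled modulus `r^M min(1, r t^(-1/2))`. -/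
def smod (M : ℕ) (t r : ℝ) : ℝ := r ^ M * min 1 (r * t ^ (-(1 : ℝ) / 2))

theorem smod_nonneg (M : ℕ) {t r : ℝ} (ht : 0 ≤ t) (hr : 0 ≤ r) : 0 ≤ smod M t r := by
  unfold smod
  positivity

theorem smod_le (M : ℕ) {r : ℝ} (hr : 0 ≤ r) (t : ℝ) : smod M t r ≤ r ^ M :=
  mul_le_of_le_one_right (by positivity) (min_le_left _ _)

theorem continuous_smod (M : ℕ) (t : ℝ) : Continuous (smod M t) := by
  unfold smod
  fun_prop

theorem tendsto_rpow_neg_half : Tendsto (fun t : ℝ => t ^ (-(1 : ℝ) / 2)) atTop (𝓝 0) := by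
  have h := tendsto_rpow_neg_atTop (y := (1 : ℝ) / 2) (by norm_num)
  simpa only [neg_div] using h

theorem tendsto_smod (M : ℕ) (r : ℝ) : Tendsto (fun t => smod M t r) atTop (𝓝 0) := by
  have h : Tendsto (fun t : ℝ => r ^ M * min 1 (r * t ^ (-(1 : ℝ) / 2))) atTop
      (𝓝 (r ^ M * min 1 (r * 0))) :=
    (tendsto_const_nhds.min (tendsto_rpow_neg_half.const_mul r)).const_mul _
  simpa [smod] using h

theorem rpow_neg_half_pow {t : ℝ} (ht : 0 ≤ t) (k : ℕ) :
    (t ^ (-(1 : ℝ) / 2)) ^ k = t ^ (-(k : ℝ) / 2) := by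
  rw [← Real.rpow_natCast, ← Real.rpow_mul ht]
  congr 1
  ring

theorem modulus_scale (M : ℕ) {t : ℝ} (ht : 0 ≤ t) (r : ℝ) :
    modulus M (r * t ^ (-(1 : ℝ) / 2)) = t ^ (-(M : ℝ) / 2) * smod M t r := by
  rw [modulus, smod, mul_pow, rpow_neg_half_pow ht]
  ring

theorem sqrt_div_eq {s t : ℝ} (hs : 0 ≤ s) (ht : 0 ≤ t) : √(s / t) = √s * t ^ (-(1 : ℝ) / 2) := by
  rw [Real.sqrt_div hs, div_eq_mul_inv, Real.sqrt_eq_rpow t, ← Real.rpow_neg ht, neg_div]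

theorem modulus_parabolic_le (M : ℕ) {s t : ℝ} (hs : 0 ≤ s) (ht : 0 ≤ t) (y : Euc n) :
    modulus M (√(s / t) + ‖t ^ (-(1 : ℝ) / 2) • y‖) ≤
      2 ^ (M + 1) * (t ^ (-(M : ℝ) / 2) * (smod M t √s + smod M t ‖y‖)) := by
  refine (modulus_add_le M (Real.sqrt_nonneg _) (norm_nonneg _)).trans_eq ?_
  rw [sqrt_div_eq hs ht, norm_smul, Real.norm_of_nonneg (by positivity), mul_comm _ ‖y‖,
    modulus_scale M ht, modulus_scale M ht]
  ring

/-- The error functional. -/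
def errB (M : ℕ) (t : ℝ) (g : LOne n) (s : ℝ) : ℝ :=
  smod M t √s * ‖g‖ + (wnorm (fun y => ENNReal.ofReal (smod M t ‖y‖)) g).toReal

theorem wnorm_smod_le (M : ℕ) (t : ℝ) (g : LOne n) :
    wnorm (fun y => ENNReal.ofReal (smod M t ‖y‖)) g ≤ wnorm (powWeight n M) g := by
  refine wnorm_mono (fun y => ?_) g
  rw [powWeight, ← ofReal_norm, ← ENNReal.ofReal_pow (norm_nonneg _)]
  exact ENNReal.ofReal_le_ofReal (smod_le M (norm_nonneg _) t)

theorem errB_nonneg (M : ℕ) {t : ℝ} (ht : 0 ≤ t) (g : LOne n) (s : ℝ) : 0 ≤ errB M t g s := by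
  have := smod_nonneg M ht (Real.sqrt_nonneg s)
  unfold errB
  positivity

theorem wnorm_le_errB {M : ℕ} {t s D : ℝ} (ht : 0 ≤ t) (hD : 0 ≤ D) {g : LOne n}
    (hg : wnorm (powWeight n M) g < ∞) :
    wnorm (fun y => ENNReal.ofReal (D * (smod M t √s + smod M t ‖y‖))) g ≤
      ENNReal.ofReal (D * errB M t g s) := by
  have h0 := smod_nonneg M ht (Real.sqrt_nonneg s)
  have hw : (fun y : Euc n => ENNReal.ofReal (D * (smod M t √s + smod M t ‖y‖))) =
      fun y => ENNReal.ofReal D *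
        ((fun _ : Euc n => ENNReal.ofReal (smod M t √s)) +
          fun y : Euc n => ENNReal.ofReal (smod M t ‖y‖) : Euc n → ℝ≥0∞) y := by
    funext y
    rw [Pi.add_apply, ← ENNReal.ofReal_add h0 (smod_nonneg M ht (norm_nonneg y)), ← ENNReal.ofReal_mul hD]
  have e1 : ∀ (c : ℝ) (k : Euc n → ℝ≥0∞),
      wnorm (fun y => ENNReal.ofReal c * k y) g = ENNReal.ofReal c * wnorm k g := fun c k => by
    rw [wnorm, wnorm, ← lintegral_const_mul' _ _ ENNReal.ofReal_ne_top]
    simp only [mul_assoc]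
  have e2 : wnorm (fun _ : Euc n => ENNReal.ofReal (smod M t √s)) g =
      ENNReal.ofReal (smod M t √s) * ENNReal.ofReal ‖g‖ := by
    have := e1 (smod M t √s) 1
    simpa [wnorm_one] using this
  rw [hw, e1, wnorm_add_weight measurable_const, e2, errB, ENNReal.ofReal_mul hD,
    ENNReal.ofReal_add (by positivity) ENNReal.toReal_nonneg, ENNReal.ofReal_mul h0,
    ENNReal.ofReal_toReal ((wnorm_smod_le M t g).trans_lt hg).ne]

theorem continuous_taylorFun (ν : ℂ) (q : (Fin n → ℕ) × (Fin n → ℕ)) : Continuous (taylorFun ν q) := by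
  unfold taylorFun
  simp_rw [gaussDeriv_eq]
  refine continuous_const.mul (Continuous.mul ?_ (continuous_gaussian ν))
  unfold hermite
  exact continuous_finsetSum _ fun β _ => continuous_const.mul (continuous_monom _)

theorem integrable_taylorFun {ν : ℂ} (hν : 0 < ν.re) (q : (Fin n → ℕ) × (Fin n → ℕ)) :
    Integrable (taylorFun ν q) := by
  obtain ⟨C, _, hC⟩ := exists_norm_taylorFun_le hν q
  have hr := rate_pos hν
  exact ((integrable_exp_neg_norm_sq (n := n) (b := rate ν / 4) (by positivity)).const_mul C).mono'
    (continuous_taylorFun ν q).aestronglyMeasurable (Eventually.of_forall hC)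

theorem integrable_dilation {t : ℝ} (ht : 0 < t) {φ : Euc n → ℂ} (hφ : Integrable φ) :
    Integrable (dilation t φ) := by
  have hr : t ^ (-(1 : ℝ) / 2) ≠ 0 := by positivity
  exact (hφ.comp_smul hr).const_mul _

theorem monom_smul (β : Fin n → ℕ) (r : ℝ) (y : Euc n) :
    monom β (r • y) = (r : ℂ) ^ len β * monom β y := by
  simp only [monom, PiLp.smul_apply, smul_eq_mul, Complex.ofReal_mul, mul_pow, Finset.prod_mul_distrib,
    Finset.prod_pow_eq_pow_sum, len]

/-- The coefficients of the profile. -/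
def profCoeff (ν : ℂ) (t s : ℝ) (g : LOne n) (q : (Fin n → ℕ) × (Fin n → ℕ)) : ℂ :=
  taylorCoeff ν q * ((s / t : ℝ) : ℂ) ^ len q.1 * ((t ^ (-(1 : ℝ) / 2) : ℝ) : ℂ) ^ len q.2 *
    ∫ y, monom q.2 y * g y

/-- The contribution to the profile at time `t` of a source `g` at time `s`. -/
def profVec (ν : ℂ) (M : ℕ) (t s : ℝ) (g : LOne n) : LOne n :=
  ∑ q ∈ taylorIdx n M, profCoeff ν t s g q • toL1 (dilation t (taylorFun ν q))

theorem coeFn_finset_sum_smul {ι : Type*} (S : Finset ι) (c : ι → ℂ) (F : ι → LOne n)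
    (G : ι → Euc n → ℂ) (h : ∀ i ∈ S, F i =ᵐ[volume] G i) :
    (∑ i ∈ S, c i • F i : LOne n) =ᵐ[volume] fun x => ∑ i ∈ S, c i * G i x := by
  classical
  induction S using Finset.induction with
  | empty =>
    simp only [Finset.sum_empty]
    exact Lp.coeFn_zero ℂ 1 (volume : Measure (Euc n))
  | insert i S hi ih =>
    rw [Finset.sum_insert hi]
    filter_upwards [Lp.coeFn_add (c i • F i) (∑ i ∈ S, c i • F i), Lp.coeFn_smul (c i) (F i),
      h i (Finset.mem_insert_self i S), ih fun j hj => h j (Finset.mem_insert_of_mem hj)]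
      with x h1 h2 h3 h4
    rw [h1, Pi.add_apply, h2, Pi.smul_apply, h3, h4, Finset.sum_insert hi, smul_eq_mul]

theorem profVec_coeFn {ν : ℂ} (hν : 0 < ν.re) (M : ℕ) {t : ℝ} (ht : 0 < t) (s : ℝ) (g : LOne n) :
    profVec ν M t s g =ᵐ[volume] fun x =>
      ∑ q ∈ taylorIdx n M, profCoeff ν t s g q * dilation t (taylorFun ν q) x :=
  coeFn_finset_sum_smul _ _ _ _ fun q _ =>
    coeFn_toL1 (integrable_dilation ht (integrable_taylorFun hν q))

/-- The kernel of `profVec`. -/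
def profKernel (ν : ℂ) (M : ℕ) (t s : ℝ) (x y : Euc n) : ℂ :=
  ((t ^ (-(n : ℝ) / 2) : ℝ) : ℂ) *
    taylorPoly ν M (t ^ (-(1 : ℝ) / 2) • x) (s / t) (t ^ (-(1 : ℝ) / 2) • y)

theorem integral_profKernel (ν : ℂ) {M : ℕ} (t s : ℝ) {g : LOne n}
    (hg : wnorm (powWeight n M) g < ∞) (x : Euc n) :
    Integrable (fun y => profKernel ν M t s x y * g y) ∧ ∫ y, profKernel ν M t s x y * g y =
      ∑ q ∈ taylorIdx n M, profCoeff ν t s g q * dilation t (taylorFun ν q) x := by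
  set r := t ^ (-(1 : ℝ) / 2) with hr
  set c := t ^ (-(n : ℝ) / 2) with hc
  have e : (fun y => profKernel ν M t s x y * g y) = fun y => ∑ q ∈ taylorIdx n M,
      (taylorCoeff ν q * ((s / t : ℝ) : ℂ) ^ len q.1 * (r : ℂ) ^ len q.2 *
        ((c : ℂ) * taylorFun ν q (r • x))) * (monom q.2 y * g y) := by
    funext y
    rw [profKernel, taylorPoly, Finset.mul_sum, Finset.sum_mul]
    refine Finset.sum_congr rfl fun q _ => ?_
    rw [monom_smul]
    ring
  have hi : ∀ q ∈ taylorIdx n M, Integrable fun y =>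
      (taylorCoeff ν q * ((s / t : ℝ) : ℂ) ^ len q.1 * (r : ℂ) ^ len q.2 *
        ((c : ℂ) * taylorFun ν q (r • x))) * (monom q.2 y * g y) := fun q hq => by
    rw [mem_taylorIdx] at hq
    exact (integrable_monom_mul (by omega) hg).const_mul _
  rw [e]
  refine ⟨integrable_finsetSum _ hi, ?_⟩
  rw [integral_finsetSum _ hi]
  refine Finset.sum_congr rfl fun q _ => ?_
  rw [integral_const_mul, profCoeff, dilation]
  ring

/-- After scaling by `t` the difference has as kernel the Taylor remainder at `(s/t, y/√t)`; the
condition `s ≤ t/2` puts `s/t` in the range of the Taylor estimate. -/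
theorem exists_rescaledSize_heat_sub_profVec {ν : ℂ} (hν : 0 < ν.re) (n M : ℕ) :
    ∃ C : ℝ, 0 ≤ C ∧ ∀ (t s : ℝ), 0 < t → 0 ≤ s → s ≤ t / 2 → ∀ g : LOne n,
      wnorm (powWeight n M) g < ∞ →
      RescaledSize t (t ^ (-(M : ℝ) / 2) * (C * errB M t g s)) (heat ν (t - s) g - profVec ν M t s g) := by
  obtain ⟨C, hC0, hC⟩ := exists_norm_gaussian_sub_taylorPoly_le hν n M
  have hrate := rate_pos hν
  obtain ⟨I, hI0, hI⟩ := exists_rescaledSize_of_kernel (κ := rate ν / 4) (by positivity) n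
  refine ⟨I * (C * 2 ^ (M + 1)), by positivity, fun t s ht hs hst g hg => ?_⟩
  have hts : 0 < t - s := by linarith
  set D := C * 2 ^ (M + 1) * t ^ (-(M : ℝ) / 2) with hD
  have hD0 : 0 ≤ D := by positivity
  have key := hI t ht (fun x y => gaussian (((t - s : ℝ) : ℂ) * ν) (x - y) - profKernel ν M t s x y)
    (fun y => D * (smod M t √s + smod M t ‖y‖))
    (by
      have := continuous_smod M t
      exact Continuous.measurable (by fun_prop))
    (fun y => by
      have := smod_nonneg M ht.le (Real.sqrt_nonneg s)
      have := smod_nonneg M ht.le (norm_nonneg y)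
      positivity)
    (fun x y => by
      have h1 : ((t - s : ℝ) : ℂ) * ν = (t : ℂ) * (((1 - s / t : ℝ) : ℂ) * ν) := by
        rw [← mul_assoc, ← Complex.ofReal_mul]
        congr 2
        field_simp
      have hst' : s / t ≤ 1 / 2 := by
        rw [div_le_div_iff₀ ht two_pos]
        linarith
      have h2 : 0 < (((1 - s / t : ℝ) : ℂ) * ν).re := by
        rw [Complex.re_ofReal_mul]
        exact mul_pos (by linarith) hν
      rw [h1, gaussian_scale h2 ht, smul_sub, profKernel, ← mul_sub, norm_mul, Complex.norm_real,
        Real.norm_of_nonneg (by positivity)]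
      have h3 := hC (t ^ (-(1 : ℝ) / 2) • x) (s / t) (t ^ (-(1 : ℝ) / 2) • y) (by positivity) hst'
      refine (mul_le_mul_of_nonneg_left h3 (by positivity)).trans ?_
      have h4 := modulus_parabolic_le M hs ht.le y
      calc _ ≤ t ^ (-(n : ℝ) / 2) * (C * (2 ^ (M + 1) * (t ^ (-(M : ℝ) / 2) *
            (smod M t √s + smod M t ‖y‖))) * (Real.exp (-(rate ν / 4 * ‖t ^ (-(1 : ℝ) / 2) • x‖ ^ 2)) +
              Real.exp (-(rate ν / 4 * ‖t ^ (-(1 : ℝ) / 2) • x - t ^ (-(1 : ℝ) / 2) • y‖ ^ 2)))) := by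
            gcongr
        _ = _ := by ring)
    g (heat ν (t - s) g - profVec ν M t s g)
    (by
      filter_upwards [Lp.coeFn_sub (heat ν (t - s) g) (profVec ν M t s g), heat_coeFn hν hts g,
        profVec_coeFn hν M ht s g] with x h1 h2 h3
      obtain ⟨h4, h5⟩ := integral_profKernel ν t s hg x
      have h6 : Integrable fun y => gaussian (((t - s : ℝ) : ℂ) * ν) (x - y) * g y :=
        (L1.integrable_coeFn g).bdd_mul
          ((continuous_gaussian _).comp (continuous_const.sub continuous_id)).aestronglyMeasurable
          (Eventually.of_forall fun y => norm_gaussian_scale_le hν hts (x - y))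
      rw [h1, Pi.sub_apply, h2, h3, ← h5, ← integral_sub h6 h4]
      simp only [sub_mul])
    (D * errB M t g s) (mul_nonneg hD0 (errB_nonneg M ht.le g s)) (wnorm_le_errB ht.le hD0 hg)
  convert! key using 1
  rw [hD]
  ring

/-- For `s ≥ t/2` nothing is approximated: the parabolic distance `ρ` is bounded below, so `min(1,
ρ)` is no gain and the profile by itself is already of the size of the error functional. -/
theorem exists_rescaledSize_profVec {ν : ℂ} (hν : 0 < ν.re) (n M : ℕ) :
    ∃ C : ℝ, 0 ≤ C ∧ ∀ (t s : ℝ), 0 < t → t / 2 ≤ s → ∀ g : LOne n,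
      wnorm (powWeight n M) g < ∞ →
      RescaledSize t (t ^ (-(M : ℝ) / 2) * (C * errB M t g s)) (profVec ν M t s g) := by
  obtain ⟨C, hC0, hC⟩ := exists_norm_taylorPoly_le hν n M
  have hrate := rate_pos hν
  obtain ⟨I, hI0, hI⟩ := exists_rescaledSize_of_kernel (κ := rate ν / 4) (by positivity) n
  refine ⟨I * (C * (3 ^ M * 2) * 2 ^ (M + 1)), by positivity, fun t s ht hst g hg => ?_⟩
  have hs : 0 ≤ s := by linarith
  set D := C * (3 ^ M * 2) * 2 ^ (M + 1) * t ^ (-(M : ℝ) / 2) with hD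
  have hD0 : 0 ≤ D := by positivity
  have key := hI t ht (fun x y => profKernel ν M t s x y)
    (fun y => D * (smod M t √s + smod M t ‖y‖))
    (by
      have := continuous_smod M t
      exact Continuous.measurable (by fun_prop))
    (fun y => by
      have := smod_nonneg M ht.le (Real.sqrt_nonneg s)
      have := smod_nonneg M ht.le (norm_nonneg y)
      positivity)
    (fun x y => by
      rw [profKernel, norm_mul, Complex.norm_real, Real.norm_of_nonneg (by positivity)]
      have h3 := hC (t ^ (-(1 : ℝ) / 2) • x) (s / t) (t ^ (-(1 : ℝ) / 2) • y) (by positivity)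
      refine (mul_le_mul_of_nonneg_left h3 (by positivity)).trans ?_
      have h4 := modulus_parabolic_le M hs ht.le y
      set ρ := √(s / t) + ‖t ^ (-(1 : ℝ) / 2) • y‖ with hρ
      have hρ2 : 1 / 2 ≤ ρ := by
        have h5 : 1 / 2 ≤ √(s / t) := by
          refine Real.le_sqrt_of_sq_le ?_
          rw [le_div_iff₀ ht]
          linarith
        linarith [norm_nonneg (t ^ (-(1 : ℝ) / 2) • y)]
      -- From `ρ ≥ 1/2`: `1 + ρ ≤ 3ρ` and `1 ≤ 2 min(1, ρ)`.
      have h6 : (1 + ρ) ^ M ≤ 3 ^ M * 2 * modulus M ρ := by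
        have h7 : 1 / 2 ≤ min 1 ρ := le_min (by norm_num) hρ2
        calc (1 + ρ) ^ M ≤ (3 * ρ) ^ M := by
              gcongr
              linarith
          _ = 3 ^ M * 2 * (ρ ^ M * (1 / 2)) := by
              rw [mul_pow]
              ring
          _ ≤ _ := by
              unfold modulus
              gcongr
      calc _ ≤ t ^ (-(n : ℝ) / 2) * (C * (3 ^ M * 2 * (2 ^ (M + 1) * (t ^ (-(M : ℝ) / 2) *
            (smod M t √s + smod M t ‖y‖)))) *
              (Real.exp (-(rate ν / 4 * ‖t ^ (-(1 : ℝ) / 2) • x‖ ^ 2)) +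
              Real.exp (-(rate ν / 4 * ‖t ^ (-(1 : ℝ) / 2) • (x - y)‖ ^ 2)))) := by
            have h8 := h6.trans (mul_le_mul_of_nonneg_left h4 (by positivity))
            have h9 := smod_nonneg M ht.le (Real.sqrt_nonneg s)
            have h10 := smod_nonneg M ht.le (norm_nonneg y)
            rw [mul_assoc C, mul_assoc C]
            gcongr
            exact le_add_of_nonneg_right (Real.exp_pos _).le
        _ = _ := by ring)
    g (profVec ν M t s g)
    (by
      filter_upwards [profVec_coeFn hν M ht s g] with x h3
      rw [h3, (integral_profKernel ν t s hg x).2])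
    (D * errB M t g s) (mul_nonneg hD0 (errB_nonneg M ht.le g s)) (wnorm_le_errB ht.le hD0 hg)
  convert! key using 1
  rw [hD]
  ring

end CGL

end

noncomputable section

namespace CGL

variable {n : ℕ}

/-! ### The remainder of the expansion -/

/-- Dominated convergence with majorant `|y|^M |g(y)|`. A finite `M`-th moment gives convergence to
zero, but no rate. -/
theorem tendsto_wnorm_smod (M : ℕ) {g : LOne n} (hg : wnorm (powWeight n M) g < ∞) :
    Tendsto (fun t => (wnorm (fun y => ENNReal.ofReal (smod M t ‖y‖)) g).toReal) atTop (𝓝 0) := by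
  have h : Tendsto (fun t => wnorm (fun y : Euc n => ENNReal.ofReal (smod M t ‖y‖)) g) atTop
      (𝓝 (∫⁻ _ : Euc n, 0)) := by
    refine tendsto_lintegral_filter_of_dominated_convergence (fun y => powWeight n M y * ‖g y‖ₑ)
      (Eventually.of_forall fun t => ?_) (Eventually.of_forall fun t => ?_) hg.ne ?_
    · exact ((continuous_smod M t).comp continuous_norm).measurable.ennreal_ofReal.mul
        (Lp.stronglyMeasurable g).measurable.enorm
    · refine Eventually.of_forall fun y => mul_le_mul_left ?_ _
      rw [powWeight, ← ofReal_norm, ← ENNReal.ofReal_pow (norm_nonneg _)]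
      exact ENNReal.ofReal_le_ofReal (smod_le M (norm_nonneg _) t)
    · refine Eventually.of_forall fun y => ?_
      have := ENNReal.Tendsto.mul_const (b := ‖g y‖ₑ)
        (ENNReal.tendsto_ofReal (tendsto_smod M ‖y‖)) (Or.inr enorm_ne_top)
      simpa using this
  rw [lintegral_zero] at h
  exact (ENNReal.tendsto_toReal ENNReal.zero_ne_top).comp h

theorem tendsto_errB (M : ℕ) {g : LOne n} (hg : wnorm (powWeight n M) g < ∞) (s : ℝ) :
    Tendsto (fun t => errB M t g s) atTop (𝓝 0) := by
  simpa [errB] using ((tendsto_smod M √s).mul_const ‖g‖).add (tendsto_wnorm_smod M hg)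

theorem Sized.wnorm_lt_top {M : ℕ} {t R : ℝ} {g : LOne n} (h : Sized M t R g) :
    wnorm (powWeight n M) g < ∞ :=
  h.wnorm_le.trans_lt ENNReal.ofReal_lt_top

theorem Sized.errB_le {M : ℕ} {s R : ℝ} (t : ℝ) (hs : 0 ≤ s) {g : LOne n} (h : Sized M s R g) :
    errB M t g s ≤ 2 * (R * (1 + s) ^ ((M : ℝ) / 2)) := by
  have hR := h.nonneg
  have h1 : smod M t √s ≤ (1 + s) ^ ((M : ℝ) / 2) := by
    refine (smod_le M (Real.sqrt_nonneg s) t).trans ?_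
    rw [Real.sqrt_eq_rpow, ← Real.rpow_natCast, ← Real.rpow_mul hs, one_div_mul_eq_div]
    gcongr
    linarith
  have h2 : (wnorm (fun y => ENNReal.ofReal (smod M t ‖y‖)) g).toReal ≤ R * (1 + s) ^ ((M : ℝ) / 2) :=
    ENNReal.toReal_le_of_le_ofReal (by positivity) ((wnorm_smod_le M t g).trans h.wnorm_le)
  have h3 : smod M t √s * ‖g‖ ≤ (1 + s) ^ ((M : ℝ) / 2) * R :=
    mul_le_mul h1 h.norm_le (norm_nonneg _) (by positivity)
  unfold errB
  linarith

theorem Sized.rescaledSize {M : ℕ} {t R : ℝ} (ht : 0 < t) {g : LOne n} (h : Sized M t R g) :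
    RescaledSize t R g where
  norm_le := h.norm_le
  ae_le := by
    have hR := h.nonneg
    filter_upwards [h.ae_le] with x hx
    refine hx.trans (mul_le_mul_of_nonneg_left ?_ hR)
    exact Real.rpow_le_rpow_of_nonpos ht (by linarith) (by
      have : (0 : ℝ) ≤ n := Nat.cast_nonneg n
      linarith)

/-- The integrand of the remainder in Duhamel's formula. -/
def remIntegrand (ν : ℂ) (M : ℕ) (w : ℝ → LOne n) (t s : ℝ) : LOne n :=
  (Ioc 0 t).indicator (fun s => heat ν (t - s) (w s)) s - profVec ν M t s (w s)

/-- The bound of the integrand of the remainder. -/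
def remBound (M : ℕ) (σ A : ℝ) (w : ℝ → LOne n) (t s : ℝ) : ℝ :=
  errB M t (w s) s + (Ioi (t / 2)).indicator (fun s => A * (1 + s) ^ (-(σ - (M : ℝ) / 2))) s

namespace DecaySource

variable {M : ℕ} {σ A : ℝ} {w : ℝ → LOne n}

/-- For late sources the factor `t^(-M/2)` comes from their own decay: `(1+s)^(-σ)` splits off
`(1+s)^(-M/2)`, which is comparable to `t^(-M/2)`, and leaves an integrable power. -/
theorem rescaledSize_heat {ν : ℂ} (hν : 0 < ν.re) (h : DecaySource M σ A w) {t s : ℝ} (ht : 0 < t)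
    (hts : t / 2 < s) (hst : s ≤ t) :
    RescaledSize t (t ^ (-(M : ℝ) / 2) *
      (heatConst n ν M * 2 ^ ((M : ℝ) / 2) * (A * (1 + s) ^ (-(σ - (M : ℝ) / 2)))))
      (heat ν (t - s) (w s)) := by
  have hA := h.nonneg
  have hs : 0 < s := by linarith
  have hH := heatConst_nonneg n ν M
  refine ((h.sized s hs.le).heat hν hs.le hst).rescaledSize ht |>.mono ht ?_
  have h1 : (1 + s) ^ (-σ) = (1 + s) ^ (-(M : ℝ) / 2) * (1 + s) ^ (-(σ - (M : ℝ) / 2)) := by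
    rw [← Real.rpow_add (by linarith)]
    congr 1
    ring
  have h2 : (1 + s) ^ (-(M : ℝ) / 2) ≤ 2 ^ ((M : ℝ) / 2) * t ^ (-(M : ℝ) / 2) := by
    calc (1 + s) ^ (-(M : ℝ) / 2) ≤ (t / 2) ^ (-(M : ℝ) / 2) :=
          Real.rpow_le_rpow_of_nonpos (by linarith) (by linarith) (by
            have : (0 : ℝ) ≤ M := Nat.cast_nonneg M
            linarith)
      _ = _ := by
          rw [Real.div_rpow ht.le two_pos.le, neg_div, Real.rpow_neg two_pos.le]
          field_simp
  rw [h1]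
  calc heatConst n ν M * (A * ((1 + s) ^ (-(M : ℝ) / 2) * (1 + s) ^ (-(σ - (M : ℝ) / 2))))
      ≤ heatConst n ν M * (A * (2 ^ ((M : ℝ) / 2) * t ^ (-(M : ℝ) / 2) *
        (1 + s) ^ (-(σ - (M : ℝ) / 2)))) := by
        gcongr
    _ = _ := by ring

theorem remBound_nonneg (h : DecaySource M σ A w) {t s : ℝ} (ht : 0 ≤ t) (hs : 0 ≤ s) :
    0 ≤ remBound M σ A w t s := by
  have hA := h.nonneg
  refine add_nonneg (errB_nonneg M ht _ s) (indicator_apply_nonneg fun _ => ?_)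
  positivity

/-- Early sources, `s ≤ t/2`, use the Taylor expansion of the kernel. For `s > t/2` the semigroup
term and the profile term are small separately, and beyond `s = t` only the profile term is present.
-/
theorem exists_rescaledSize_remIntegrand {ν : ℂ} (hν : 0 < ν.re) (h : DecaySource M σ A w) :
    ∃ C : ℝ, 0 ≤ C ∧ ∀ t s : ℝ, 0 < t → 0 < s →
      RescaledSize t (t ^ (-(M : ℝ) / 2) * (C * remBound M σ A w t s)) (remIntegrand ν M w t s) := by
  have hA := h.nonneg
  obtain ⟨C₁, hC₁, h1⟩ := exists_rescaledSize_heat_sub_profVec hν n M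
  obtain ⟨C₂, hC₂, h2⟩ := exists_rescaledSize_profVec hν n M
  have hH := heatConst_nonneg n ν M
  set C₃ := heatConst n ν M * 2 ^ ((M : ℝ) / 2) with hC₃
  have hC₃0 : 0 ≤ C₃ := by positivity
  refine ⟨C₁ + C₂ + C₃, by positivity, fun t s ht hs => ?_⟩
  have hw := (h.sized s hs.le).wnorm_lt_top
  have hB := h.remBound_nonneg ht.le hs.le
  have hE := errB_nonneg M ht.le (w s) s
  rcases le_or_gt s (t / 2) with hst | hst
  · have e : remIntegrand ν M w t s = heat ν (t - s) (w s) - profVec ν M t s (w s) := by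
      rw [remIntegrand, indicator_of_mem (show s ∈ Ioc 0 t from ⟨hs, by linarith⟩)]
    have e2 : remBound M σ A w t s = errB M t (w s) s := by
      rw [remBound, indicator_of_notMem (fun hm : s ∈ Ioi (t / 2) => not_lt.2 hst hm), add_zero]
    rw [e, e2]
    refine (h1 t s ht hs.le hst (w s) hw).mono ht ?_
    gcongr
    linarith
  · have e2 : remBound M σ A w t s = errB M t (w s) s + A * (1 + s) ^ (-(σ - (M : ℝ) / 2)) := by
      rw [remBound, indicator_of_mem (show s ∈ Ioi (t / 2) from hst)]
    have hD : 0 ≤ A * (1 + s) ^ (-(σ - (M : ℝ) / 2)) := by positivity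
    have h4 : RescaledSize t (t ^ (-(M : ℝ) / 2) * (C₃ * (A * (1 + s) ^ (-(σ - (M : ℝ) / 2)))))
        ((Ioc 0 t).indicator (fun s => heat ν (t - s) (w s)) s) := by
      rcases le_or_gt s t with hs' | hs'
      · rw [indicator_of_mem (show s ∈ Ioc 0 t from ⟨hs, hs'⟩)]
        exact h.rescaledSize_heat hν ht hst hs'
      · rw [indicator_of_notMem (fun hm : s ∈ Ioc 0 t => not_le.2 hs' hm.2)]
        exact RescaledSize.zero.mono ht (by positivity)
    refine (h4.sub (h2 t s ht hst.le (w s) hw)).mono ht ?_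
    rw [e2, ← mul_add]
    gcongr
    nlinarith [mul_nonneg hC₁ hE, mul_nonneg hC₁ hD, mul_nonneg hC₂ hD, mul_nonneg hC₃0 hE]

theorem aestronglyMeasurable_remBound (h : DecaySource M σ A w) (t : ℝ) :
    AEStronglyMeasurable (remBound M σ A w t) (volume.restrict (Ioi 0)) := by
  borelize ↥(LOne n)
  have h1 : AEMeasurable (fun s => (wnorm (fun y => ENNReal.ofReal (smod M t ‖y‖)) (w s)).toReal)
      (volume.restrict (Ioi 0)) :=
    ((measurable_wnorm ((continuous_smod M t).comp continuous_norm).measurable.ennreal_ofReal).comp_aemeasurable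
      h.aestronglyMeasurable.aemeasurable).ennreal_toReal
  have h2 : Continuous fun s : ℝ => smod M t √s := (continuous_smod M t).comp Real.continuous_sqrt
  have h3 : Measurable fun s : ℝ => A * (1 + s) ^ (-(σ - (M : ℝ) / 2)) := by fun_prop
  exact ((h2.aestronglyMeasurable.mul h.aestronglyMeasurable.norm).add h1.aestronglyMeasurable).add
    (h3.indicator measurableSet_Ioi).aestronglyMeasurable

theorem remBound_le (h : DecaySource M σ A w) (t : ℝ) {s : ℝ} (hs : 0 ≤ s) :
    remBound M σ A w t s ≤ 3 * A * (1 + s) ^ (-(σ - (M : ℝ) / 2)) := by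
  have hA := h.nonneg
  have h1 := (h.sized s hs).errB_le t hs
  have h2 : A * (1 + s) ^ (-σ) * (1 + s) ^ ((M : ℝ) / 2) = A * (1 + s) ^ (-(σ - (M : ℝ) / 2)) := by
    rw [mul_assoc, ← Real.rpow_add (by linarith)]
    congr 2
    ring
  rw [h2] at h1
  have h3 : (Ioi (t / 2)).indicator (fun s => A * (1 + s) ^ (-(σ - (M : ℝ) / 2))) s ≤
      A * (1 + s) ^ (-(σ - (M : ℝ) / 2)) :=
    indicator_apply_le' (fun _ => le_rfl) fun _ => by positivity
  unfold remBound
  linarith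

theorem integrableOn_remBound (h : DecaySource M σ A w) {t : ℝ} (ht : 0 ≤ t) :
    IntegrableOn (remBound M σ A w t) (Ioi 0) := by
  refine (h.integrableOn_weight.const_mul (3 * A)).mono' (h.aestronglyMeasurable_remBound t)
    ((ae_restrict_iff' measurableSet_Ioi).2 (Eventually.of_forall fun s hs => ?_))
  have hs : 0 < s := hs
  rw [Real.norm_of_nonneg (h.remBound_nonneg ht hs.le)]
  exact h.remBound_le t hs.le

/-- For fixed `s` the late-time indicator disappears once `t ≥ 2s` and the error functional tends to
zero; the integrable majorant is that of `remBound_le`. -/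
theorem tendsto_integral_remBound (h : DecaySource M σ A w) :
    Tendsto (fun t => ∫ s in Ioi (0 : ℝ), remBound M σ A w t s) atTop (𝓝 0) := by
  have hlim : Tendsto (fun t => ∫ s in Ioi (0 : ℝ), remBound M σ A w t s) atTop
      (𝓝 (∫ _ in Ioi (0 : ℝ), (0 : ℝ))) := by
    refine tendsto_integral_filter_of_dominated_convergence
      (fun s => 3 * A * (1 + s) ^ (-(σ - (M : ℝ) / 2)))
      (Eventually.of_forall fun t => h.aestronglyMeasurable_remBound t) ?_
      (h.integrableOn_weight.const_mul (3 * A)) ?_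
    · filter_upwards [eventually_ge_atTop 0] with t ht
      refine (ae_restrict_iff' measurableSet_Ioi).2 (Eventually.of_forall fun s hs => ?_)
      have hs : 0 < s := hs
      rw [Real.norm_of_nonneg (h.remBound_nonneg ht hs.le)]
      exact h.remBound_le t hs.le
    · refine (ae_restrict_iff' measurableSet_Ioi).2 (Eventually.of_forall fun s hs => ?_)
      have hs : 0 < s := hs
      have h1 := tendsto_errB M (h.sized s hs.le).wnorm_lt_top s
      refine h1.congr' ?_
      filter_upwards [eventually_ge_atTop (2 * s)] with t ht
      rw [remBound, indicator_of_notMem (fun hm : s ∈ Ioi (t / 2) => by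
        have : t / 2 < s := hm
        linarith), add_zero]
  simpa using hlim

/-- The functions `ψ_k` enter here: integrating `s^|γ|` times a moment of `w(s)` gives that moment
of `∫ s^|γ| w(s) ds`. -/
theorem integrableOn_profVec (h : DecaySource M σ A w) (ν : ℂ) (t : ℝ) :
    IntegrableOn (fun s => profVec ν M t s (w s)) (Ioi 0) ∧
    ∫ s in Ioi (0 : ℝ), profVec ν M t s (w s) = ∑ q ∈ taylorIdx n M,
      (taylorCoeff ν q * ((t : ℂ) ^ len q.1)⁻¹ * ((t ^ (-(1 : ℝ) / 2) : ℝ) : ℂ) ^ len q.2 *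
        ∫ y, monom q.2 y * (∫ s in Ioi (0 : ℝ), s ^ len q.1 • w s : LOne n) y) •
          toL1 (dilation t (taylorFun ν q)) := by
  have e : ∀ q s, profCoeff ν t s (w s) q = (taylorCoeff ν q * ((t : ℂ) ^ len q.1)⁻¹ *
      ((t ^ (-(1 : ℝ) / 2) : ℝ) : ℂ) ^ len q.2) * ((s : ℂ) ^ len q.1 * ∫ y, monom q.2 y * w s y) :=
    fun q s => by
      rw [profCoeff, Complex.ofReal_div, div_pow]
      ring
  have hi : ∀ q ∈ taylorIdx n M, IntegrableOn (fun s => profCoeff ν t s (w s) q •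
      toL1 (dilation t (taylorFun ν q))) (Ioi 0) := fun q hq => by
    rw [mem_taylorIdx] at hq
    simp_rw [e]
    exact ((h.moment_integral hq).1.const_mul _).smul_const _
  refine ⟨integrable_finsetSum _ hi, ?_⟩
  simp_rw [profVec]
  rw [integral_finsetSum _ hi]
  refine Finset.sum_congr rfl fun q hq => ?_
  rw [mem_taylorIdx] at hq
  simp_rw [e]
  rw [integral_smul_const, integral_const_mul, (h.moment_integral hq).2]

/-- The asymptotic expansion of the solution of the inhomogeneous heat equation. -/
theorem exists_rescaledSize_sub {ν : ℂ} (hν : 0 < ν.re) (h : DecaySource M σ A w) {g : LOne n}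
    (hg : wnorm (powWeight n M) g < ∞) :
    ∃ η : ℝ → ℝ, Tendsto η atTop (𝓝 0) ∧ ∀ t, 0 < t →
      RescaledSize t (t ^ (-(M : ℝ) / 2) * η t) (heat ν t g + duhamel ν w t -
        (profVec ν M t 0 g + ∫ s in Ioi (0 : ℝ), profVec ν M t s (w s))) := by
  obtain ⟨C₁, hC₁, h1⟩ := exists_rescaledSize_heat_sub_profVec hν n M
  obtain ⟨C₂, hC₂, h2⟩ := h.exists_rescaledSize_remIntegrand hν
  refine ⟨fun t => C₁ * errB M t g 0 + C₂ * ∫ s in Ioi (0 : ℝ), remBound M σ A w t s, ?_,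
    fun t ht => ?_⟩
  · simpa using ((tendsto_errB M hg 0).const_mul C₁).add (h.tendsto_integral_remBound.const_mul C₂)
  · have hheat : IntegrableOn (fun s => heat ν (t - s) (w s)) (Ioc 0 t) :=
      (intervalIntegrable_iff_integrableOn_Ioc_of_le ht.le).1
        (intervalIntegrable_heat hν ht.le (h.continuousOn.mono Icc_subset_Ici_self))
    have hind : IntegrableOn ((Ioc 0 t).indicator fun s => heat ν (t - s) (w s)) (Ioi 0) :=
      (hheat.integrable_indicator measurableSet_Ioc).integrableOn
    have hprof := (h.integrableOn_profVec ν t).1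
    -- The Duhamel integral runs over `(0, t]` and the profile over all of `(0, ∞)`; the indicator
    -- in `remIntegrand` puts both under one integral, tail included.
    have hR : ∫ s in Ioi (0 : ℝ), remIntegrand ν M w t s =
        duhamel ν w t - ∫ s in Ioi (0 : ℝ), profVec ν M t s (w s) := by
      simp only [remIntegrand]
      rw [integral_sub hind hprof, setIntegral_indicator measurableSet_Ioc,
        inter_eq_self_of_subset_right Ioc_subset_Ioi_self, duhamel,
        intervalIntegral.integral_of_le ht.le]
    have k1 := h1 t 0 ht le_rfl (by linarith) g hg
    have k2 := RescaledSize.integral (t := t) (ρ := volume.restrict (Ioi (0 : ℝ)))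
      (F := remIntegrand ν M w t) (hind.sub hprof)
      (b := fun s => t ^ (-(M : ℝ) / 2) * (C₂ * remBound M σ A w t s))
      (((h.integrableOn_remBound ht.le).const_mul C₂).const_mul _)
      ((ae_restrict_iff' measurableSet_Ioi).2 (Eventually.of_forall fun s hs => h2 t s ht hs))
    rw [hR, integral_const_mul, integral_const_mul] at k2
    rw [sub_zero] at k1
    have k := k1.add k2
    rw [← mul_add] at k
    convert! k using 1
    abel

end DecaySource

end CGL

end

noncomputable section

namespace CGL

variable {n : ℕ}

/-! ### The profile in terms of derivatives of the kernel -/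

theorem len_add (α β : Fin n → ℕ) : len (α + β) = len α + len β := by
  simp [len, Finset.sum_add_distrib]

theorem len_two_smul (α : Fin n → ℕ) : len (2 • α) = 2 * len α := by
  simp [len, Finset.mul_sum]

theorem len_zero : len (0 : Fin n → ℕ) = 0 := by simp [len]

theorem len_eq_zero {α : Fin n → ℕ} : len α = 0 ↔ α = 0 := by
  simp [len, funext_iff]

theorem multiIndices_zero : multiIndices n 0 = {0} := by
  ext α
  rw [mem_multiIndices, len_eq_zero, Finset.mem_singleton]

theorem dilation_hermite (ν : ℂ) (q : (Fin n → ℕ) × (Fin n → ℕ)) (t : ℝ) (x : Euc n) :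
    dilation t (fun z => hermite ν (2 • q.1 + q.2) z * gaussian ν z) x =
      (-2) ^ (2 * len q.1 + len q.2) * dilation t (taylorFun ν q) x := by
  have h : ((-2 : ℂ) ^ (2 * len q.1 + len q.2)) ≠ 0 := pow_ne_zero _ (by norm_num)
  rw [dilation, dilation, taylorFun, gaussDeriv_eq, len_add, len_two_smul]
  field_simp

/-- In terms of derivatives of `G_ν` the powers of two cancel: `(-2)^(-2|γ|) 2^(-|β|)
(-2)^(2|γ|+|β|) = (-1)^|β|`. -/
theorem Lam_two_smul (ν : ℂ) (γ : Fin n → ℕ) (N : ℕ) {t : ℝ} (ht : 0 < t) (φ : Euc n → ℂ) (x : Euc n) :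
    Lam ν (2 • γ) N t φ x = ∑ i ∈ Finset.range (N + 1), ∑ β ∈ multiIndices n i,
      ((-1) ^ len β / (mfact β : ℂ)) * (∫ y, monom β y * φ y) *
        (((t ^ (-(1 : ℝ) / 2) : ℝ) : ℂ) ^ (2 * len γ + len β) * dilation t (taylorFun ν (γ, β)) x) := by
  rw [Lam, Finset.mul_sum]
  refine Finset.sum_congr rfl fun i _ => ?_
  rw [Finset.mul_sum, Finset.mul_sum]
  refine Finset.sum_congr rfl fun β hβ => ?_
  rw [mem_multiIndices] at hβ
  rw [dilation_hermite ν (γ, β), len_two_smul, ← hβ, ← rpow_neg_half_pow ht.le, ← rpow_neg_half_pow ht.le,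
    moment, Complex.ofReal_pow, Complex.ofReal_pow, pow_add (-2 : ℂ), pow_add]
  have h2 : (-2 : ℂ) ^ len β = (-1) ^ len β * 2 ^ len β := by
    rw [← mul_pow]
    norm_num
  have h3 : (-2 : ℂ) ^ (2 * len γ) ≠ 0 := pow_ne_zero _ (by norm_num)
  rw [h2]
  field_simp

/-- The coefficients of the asymptotic profile. -/
def profileCoeff (ν : ℂ) (f : ℂ → ℂ) (u₀ : Euc n → ℂ) (u : ℝ → LOne n)
    (q : (Fin n → ℕ) × (Fin n → ℕ)) : ℂ :=
  taylorCoeff ν q * ((if q.1 = 0 then ∫ y, monom q.2 y * u₀ y else 0) +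
    ∫ y, monom q.2 y * psi f u (len q.1) y)

theorem sum_taylorIdx_ite (M : ℕ) (F : (Fin n → ℕ) × (Fin n → ℕ) → ℂ) :
    ∑ q ∈ taylorIdx n M, (if q.1 = 0 then F q else 0) =
      ∑ i ∈ Finset.range (M + 1), ∑ β ∈ multiIndices n i, F (0, β) := by
  rw [← sum_taylorIdx M (fun γ β => if γ = 0 then F (γ, β) else 0), Finset.sum_eq_single 0]
  · simp [multiIndices_zero]
  · intro k _ hk
    refine Finset.sum_eq_zero fun γ hγ => ?_
    have : γ ≠ 0 := by
      rintro rfl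
      rw [mem_multiIndices, len_zero] at hγ
      exact hk hγ.symm
    simp [this]
  · simp

/-- Displays the homogeneity of the profile: a term of parabolic degree `d` depends on time only
through `t^(-d/2) δ_t`. -/
theorem profile_eq (ν : ℂ) (f : ℂ → ℂ) (u₀ : Euc n → ℂ) (u : ℝ → LOne n) (M : ℕ) {t : ℝ}
    (ht : 0 < t) (x : Euc n) :
    profile ν f u₀ u M t x = ∑ q ∈ taylorIdx n M, profileCoeff ν f u₀ u q *
      (((t ^ (-(1 : ℝ) / 2) : ℝ) : ℂ) ^ (2 * len q.1 + len q.2) * dilation t (taylorFun ν q) x) := by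
  simp only [profileCoeff, mul_add, add_mul, Finset.sum_add_distrib]
  rw [profile]
  congr 1
  · have e := Lam_two_smul ν 0 M ht u₀ x
    rw [smul_zero] at e
    rw [e]
    have e2 := sum_taylorIdx_ite M (fun q : (Fin n → ℕ) × (Fin n → ℕ) =>
      taylorCoeff ν q * (∫ y, monom q.2 y * u₀ y) *
      (((t ^ (-(1 : ℝ) / 2) : ℝ) : ℂ) ^ (2 * len q.1 + len q.2) * dilation t (taylorFun ν q) x))
    simp only [mul_ite, mul_zero, ite_mul, zero_mul]
    rw [e2]
    refine Finset.sum_congr rfl fun i _ => Finset.sum_congr rfl fun β _ => ?_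
    simp [taylorCoeff, len_zero, mfact]
  · rw [← sum_taylorIdx M (fun γ β => taylorCoeff ν (γ, β) * (∫ y, monom β y * psi f u (len γ) y) *
      (((t ^ (-(1 : ℝ) / 2) : ℝ) : ℂ) ^ (2 * len γ + len β) * dilation t (taylorFun ν (γ, β)) x))]
    refine Finset.sum_congr rfl fun k _ => Finset.sum_congr rfl fun γ hγ => ?_
    rw [mem_multiIndices] at hγ
    subst hγ
    rw [Lam_two_smul ν γ _ ht, Finset.mul_sum]
    refine Finset.sum_congr rfl fun i _ => ?_
    rw [Finset.mul_sum]
    refine Finset.sum_congr rfl fun β _ => ?_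
    rw [taylorCoeff]
    ring

theorem DecaySource.profVec_add_coeFn {ν : ℂ} (hν : 0 < ν.re) {M : ℕ} {σ A : ℝ} {f : ℂ → ℂ}
    {u : ℝ → LOne n} (h : DecaySource M σ A fun s => toL1 fun x => f (u s x)) {u₀ : Euc n → ℂ}
    (hu₀ : Integrable u₀) {t : ℝ} (ht : 0 < t) :
    (profVec ν M t 0 (toL1 u₀) +
      ∫ s in Ioi (0 : ℝ), profVec ν M t s (toL1 fun x => f (u s x)) : LOne n) =ᵐ[volume]
        profile ν f u₀ u M t := by
  rw [(h.integrableOn_profVec ν t).2, profVec, ← Finset.sum_add_distrib]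
  simp_rw [← add_smul]
  refine (coeFn_finset_sum_smul _ _ _ _ fun q _ =>
    coeFn_toL1 (integrable_dilation ht (integrable_taylorFun hν q))).trans ?_
  refine Eventually.of_forall fun x => ?_
  dsimp only
  rw [profile_eq ν f u₀ u M ht x]
  refine Finset.sum_congr rfl fun q _ => ?_
  rw [← mul_assoc]
  congr 1
  have h1 : ∫ y, monom q.2 y * toL1 u₀ y = ∫ y, monom q.2 y * u₀ y := by
    refine integral_congr_ae ?_
    filter_upwards [coeFn_toL1 hu₀] with y hy
    rw [hy]
  have h2 : ((t : ℂ) ^ len q.1)⁻¹ = ((t ^ (-(1 : ℝ) / 2) : ℝ) : ℂ) ^ (2 * len q.1) := by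
    rw [pow_mul, ← Complex.ofReal_pow _ 2, ← inv_pow]
    congr 1
    rw [rpow_neg_half_pow ht.le, ← Complex.ofReal_inv]
    congr 1
    rw [← Real.rpow_neg_one]
    norm_num
  rw [profCoeff, profileCoeff, h1, h2, pow_add, zero_div, Complex.ofReal_zero]
  simp only [psi]
  -- The initial datum is a source at time `0`, so its coefficient carries `0^|γ|`; this is the `if`
  -- in `profileCoeff`.
  by_cases hq : q.1 = 0
  · rw [if_pos hq, hq, len_zero]
    ring
  · rw [if_neg hq, zero_pow (by rwa [Ne, len_eq_zero])]
    ring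

/-! ### The gap between consecutive profiles -/

/-- Pairs of multi-indices `(γ, β)` with `2|γ| + |β| = M`. -/
def topIdx (n M : ℕ) : Finset ((Fin n → ℕ) × (Fin n → ℕ)) :=
  (taylorIdx n M).filter fun q => 2 * len q.1 + len q.2 = M

theorem mem_topIdx {M : ℕ} {q : (Fin n → ℕ) × (Fin n → ℕ)} :
    q ∈ topIdx n M ↔ 2 * len q.1 + len q.2 = M := by
  rw [topIdx, Finset.mem_filter, mem_taylorIdx]
  omega

theorem sum_taylorIdx_succ {X : Type*} [AddCommMonoid X] (m : ℕ)
    (F : (Fin n → ℕ) × (Fin n → ℕ) → X) :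
    ∑ q ∈ taylorIdx n (m + 1), F q = ∑ q ∈ taylorIdx n m, F q + ∑ q ∈ topIdx n (m + 1), F q := by
  classical
  rw [← Finset.sum_union]
  · refine Finset.sum_congr ?_ fun _ _ => rfl
    ext q
    rw [Finset.mem_union, mem_taylorIdx, mem_taylorIdx, mem_topIdx]
    omega
  · rw [Finset.disjoint_left]
    intro q
    rw [mem_taylorIdx, mem_topIdx]
    omega

theorem dilation_one (φ : Euc n → ℂ) (x : Euc n) : dilation 1 φ x = φ x := by
  simp [dilation]

theorem profileGap_eq (ν : ℂ) (f : ℂ → ℂ) (u₀ : Euc n → ℂ) (u : ℝ → LOne n) (m : ℕ) (x : Euc n) :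
    profileGap ν f u₀ u m x = ∑ q ∈ topIdx n (m + 1), profileCoeff ν f u₀ u q * taylorFun ν q x := by
  rw [profileGap, profile_eq ν f u₀ u _ one_pos, profile_eq ν f u₀ u _ one_pos, sum_taylorIdx_succ,
    add_sub_cancel_left]
  simp [dilation_one]

/-- Only terms of degree exactly `m + 1` survive the subtraction, and these all scale alike. -/
theorem profile_succ_sub (ν : ℂ) (f : ℂ → ℂ) (u₀ : Euc n → ℂ) (u : ℝ → LOne n) (m : ℕ) {t : ℝ}
    (ht : 0 < t) (x : Euc n) :
    profile ν f u₀ u (m + 1) t x - profile ν f u₀ u m t x =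
      ((t ^ (-((m + 1 : ℕ) : ℝ) / 2) : ℝ) : ℂ) * dilation t (profileGap ν f u₀ u m) x := by
  rw [profile_eq ν f u₀ u _ ht, profile_eq ν f u₀ u _ ht, sum_taylorIdx_succ, add_sub_cancel_left,
    dilation, profileGap_eq, Finset.mul_sum, Finset.mul_sum]
  refine Finset.sum_congr rfl fun q hq => ?_
  rw [mem_topIdx] at hq
  rw [hq, ← rpow_neg_half_pow ht.le, dilation, Complex.ofReal_pow]
  ring

theorem continuous_profileGap (ν : ℂ) (f : ℂ → ℂ) (u₀ : Euc n → ℂ) (u : ℝ → LOne n) (m : ℕ) :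
    Continuous (profileGap ν f u₀ u m) := by
  rw [show profileGap ν f u₀ u m = fun x => _ from funext fun x => profileGap_eq ν f u₀ u m x]
  exact continuous_finsetSum _ fun q _ => continuous_const.mul (continuous_taylorFun ν q)

theorem exists_norm_profileGap_le {ν : ℂ} (hν : 0 < ν.re) (f : ℂ → ℂ) (u₀ : Euc n → ℂ)
    (u : ℝ → LOne n) (m : ℕ) : ∃ C : ℝ, 0 ≤ C ∧ ∀ x,
      ‖profileGap ν f u₀ u m x‖ ≤ C * Real.exp (-(rate ν / 4 * ‖x‖ ^ 2)) := by
  choose C hC0 hC using fun q : (Fin n → ℕ) × (Fin n → ℕ) => exists_norm_taylorFun_le hν q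
  refine ⟨∑ q ∈ topIdx n (m + 1), ‖profileCoeff ν f u₀ u q‖ * C q,
    Finset.sum_nonneg fun q _ => mul_nonneg (norm_nonneg _) (hC0 q), fun x => ?_⟩
  rw [profileGap_eq, Finset.sum_mul]
  refine norm_sum_le_of_le _ fun q _ => ?_
  rw [norm_mul, mul_assoc]
  gcongr
  exact hC q x

/-- `hermite ν α` as a polynomial. -/
def hermitePoly (ν : ℂ) (α : Fin n → ℕ) : MvPolynomial (Fin n) ℂ :=
  ∑ β ∈ Finset.Iic (fun j => α j / 2), MvPolynomial.monomial (Finsupp.equivFunOnFinite.symm (α - 2 • β))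
    ((-1) ^ len β * (mfact α : ℂ) / ((mfact β : ℂ) * (mfact (α - 2 • β) : ℂ)) * (ν ^ len (α - β))⁻¹)

theorem eval_hermitePoly (ν : ℂ) (α : Fin n → ℕ) (x : Euc n) :
    MvPolynomial.eval (fun j => (x j : ℂ)) (hermitePoly ν α) = hermite ν α x := by
  rw [hermitePoly, map_sum, hermite]
  refine Finset.sum_congr rfl fun β _ => ?_
  rw [MvPolynomial.eval_monomial, Finsupp.prod_fintype _ _ fun _ => pow_zero _]
  rfl

/-- Only the summand `β = 0` has full degree, so Hermite polynomials of equal degree have distinct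
single leading monomials. -/
theorem coeff_hermitePoly (ν : ℂ) {α α' : Fin n → ℕ} (h : len α' = len α) :
    MvPolynomial.coeff (Finsupp.equivFunOnFinite.symm α) (hermitePoly ν α') =
      if α' = α then (ν ^ len α)⁻¹ else 0 := by
  have hm : ∀ α : Fin n → ℕ, (mfact α : ℂ) ≠ 0 := fun α => by
    exact_mod_cast (Finset.prod_pos fun j _ => Nat.factorial_pos (α j)).ne'
  rw [hermitePoly, MvPolynomial.coeff_sum, Finset.sum_eq_single 0]
  · rw [MvPolynomial.coeff_monomial]
    simp only [smul_zero, tsub_zero, EmbeddingLike.apply_eq_iff_eq]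
    split_ifs with h'
    · subst h'
      have h0 : (mfact (0 : Fin n → ℕ) : ℂ) = 1 := by simp [mfact]
      rw [h0, len_zero, pow_zero, one_mul, div_self (hm _), one_mul]
    · rfl
  · intro β hβ hβ0
    rw [Finset.mem_Iic, Pi.le_def] at hβ
    rw [MvPolynomial.coeff_monomial, if_neg]
    intro he
    have he := Finsupp.equivFunOnFinite.symm.injective he
    have h1 : α' = α + 2 • β := by
      rw [← he]
      funext j
      have := hβ j
      simp only [Pi.add_apply, Pi.sub_apply, Pi.smul_apply, smul_eq_mul]
      omega
    have h2 := congrArg len h1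
    rw [len_add, len_two_smul, h] at h2
    exact hβ0 (len_eq_zero.1 (by omega))
  · intro h0
    exact absurd (Finset.mem_Iic.2 fun j => Nat.zero_le _) h0

/-- Dividing by the nowhere vanishing `G_ν` leaves a polynomial that is zero at all real points,
hence identically zero; the identity is its coefficient at `x^α`. -/
theorem sum_eq_zero_of_profileGap_eq_zero {ν : ℂ} (hν : 0 < ν.re) {f : ℂ → ℂ} {u₀ : Euc n → ℂ}
    {u : ℝ → LOne n} {m : ℕ} (h : ∀ x, profileGap ν f u₀ u m x = 0) {α : Fin n → ℕ}
    (hα : len α = m + 1) :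
    ∑ q ∈ topIdx n (m + 1), (if 2 • q.1 + q.2 = α then profileCoeff ν f u₀ u q else 0) = 0 := by
  have hν0 := ne_zero_of_re_pos hν
  have hP : ∑ q ∈ topIdx n (m + 1), profileCoeff ν f u₀ u q • hermitePoly ν (2 • q.1 + q.2) = 0 := by
    refine MvPolynomial.funext_set (fun _ : Fin n => range ((↑) : ℝ → ℂ))
      (fun _ => infinite_range_of_injective Complex.ofReal_injective) fun x hx => ?_
    choose y hy using fun j => hx j (mem_univ j)
    have hxy : x = fun j => ((WithLp.toLp 2 y : Euc n) j : ℂ) := by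
      funext j
      exact (hy j).symm
    rw [hxy, map_sum, map_zero]
    simp only [MvPolynomial.smul_eval, eval_hermitePoly]
    have h1 := h (WithLp.toLp 2 y)
    rw [profileGap_eq] at h1
    have hg : gaussian ν (WithLp.toLp 2 y : Euc n) ≠ 0 := by
      rw [gaussian]
      refine mul_ne_zero ?_ (Complex.exp_ne_zero _)
      rw [Complex.cpow_ne_zero_iff]
      left
      have : (Real.pi : ℂ) ≠ 0 := by exact_mod_cast Real.pi_ne_zero
      simp [hν0, this]
    have h2 : ((-2 : ℂ) ^ (m + 1))⁻¹ * gaussian ν (WithLp.toLp 2 y : Euc n) ≠ 0 :=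
      mul_ne_zero (inv_ne_zero (pow_ne_zero _ (by norm_num))) hg
    refine (mul_eq_zero.1 ?_).resolve_left h2
    rw [Finset.mul_sum, ← h1]
    refine Finset.sum_congr rfl fun q hq => ?_
    rw [mem_topIdx] at hq
    rw [taylorFun, gaussDeriv_eq, len_add, len_two_smul, hq]
    ring
  have hc := congrArg (MvPolynomial.coeff (Finsupp.equivFunOnFinite.symm α)) hP
  rw [MvPolynomial.coeff_sum, MvPolynomial.coeff_zero] at hc
  have h3 : ((ν ^ len α)⁻¹ : ℂ) ≠ 0 := inv_ne_zero (pow_ne_zero _ hν0)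
  refine (mul_eq_zero.1 ?_).resolve_left h3
  rw [Finset.mul_sum]
  refine (Finset.sum_congr rfl fun q hq => ?_).trans hc
  rw [mem_topIdx] at hq
  rw [MvPolynomial.coeff_smul, coeff_hermitePoly ν (by rw [len_add, len_two_smul, hq, hα]), smul_eq_mul]
  split_ifs
  · ring
  · ring

/-- Among the pairs with `2γ + β = α` the initial datum contributes only through `(0, α)`, by its
moment up to sign. Everything else comes from the nonlinear term and is too small to cancel it. -/
theorem exists_profileGap_ne_zero {ν : ℂ} (hν : 0 < ν.re) {f : ℂ → ℂ} {u₀ : Euc n → ℂ}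
    {u : ℝ → LOne n} {m : ℕ} {α : Fin n → ℕ} (hα : len α = m + 1) {b : ℝ}
    (hb : ∀ q ∈ topIdx n (m + 1), ‖∫ y, monom q.2 y * psi f u (len q.1) y‖ ≤ b)
    (hlt : (∑ q ∈ topIdx n (m + 1), ‖taylorCoeff ν q‖) * b < ‖moment α u₀‖) :
    ∃ x, profileGap ν f u₀ u m x ≠ 0 := by
  by_contra! h
  have h1 := sum_eq_zero_of_profileGap_eq_zero hν h hα
  have h2 : ∀ q : (Fin n → ℕ) × (Fin n → ℕ),
      (if 2 • q.1 + q.2 = α then profileCoeff ν f u₀ u q else 0) =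
      (if q = (0, α) then taylorCoeff ν (0, α) * ∫ y, monom α y * u₀ y else 0) +
      (if 2 • q.1 + q.2 = α then taylorCoeff ν q * ∫ y, monom q.2 y * psi f u (len q.1) y else 0) := by
    rintro ⟨γ, β⟩
    by_cases hq : 2 • γ + β = α
    · rw [if_pos hq, if_pos hq, profileCoeff, mul_add]
      congr 1
      by_cases hγ : γ = 0
      · subst hγ
        have hβ : β = α := by simpa using hq
        subst hβ
        simp
      · rw [if_neg hγ, if_neg (by simp [hγ]), mul_zero]
    · rw [if_neg hq, if_neg hq, if_neg, add_zero]
      rintro h0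
      obtain ⟨rfl, rfl⟩ := Prod.mk.inj h0
      simp at hq
  simp_rw [h2] at h1
  rw [Finset.sum_add_distrib, Finset.sum_ite_eq' , if_pos (by simp [mem_topIdx, len_zero, hα])] at h1
  have h3 : ‖taylorCoeff ν (0, α) * ∫ y, monom α y * u₀ y‖ = ‖moment α u₀‖ := by
    simp [taylorCoeff, moment, len_zero, mfact]
  have h4 := eq_neg_of_add_eq_zero_left h1
  rw [← h3, h4, norm_neg] at hlt
  refine absurd (norm_sum_le_of_le _ fun q hq => ?_) (not_le.2 (Finset.sum_mul _ _ b ▸ hlt))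
  split_ifs
  · rw [norm_mul]
    gcongr
    exact hb q hq
  · rw [norm_zero]
    exact mul_nonneg (norm_nonneg _) ((norm_nonneg _).trans (hb q hq))

end CGL

end

noncomputable section

namespace CGL

variable {n : ℕ}

/-! ### Estimates in `L^q` -/

/-- Interpolation between `L¹` and `L^∞`: `|h|^q ≤ |h| (ac)^(q-1)`. -/
theorem eLpNorm_le_of_rescaled {h : Euc n → ℂ} {a c : ℝ} (ha : 0 ≤ a) (hc : 0 < c)
    (h1 : ∫⁻ x, ‖h x‖ₑ ≤ ENNReal.ofReal a) (h2 : ∀ᵐ x, ‖h x‖ ≤ a * c) {q : ℝ≥0∞} (hq : 1 ≤ q) :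
    eLpNorm h q volume ≤ ENNReal.ofReal (a * c ^ (1 - (q⁻¹).toReal)) := by
  rcases eq_or_ne q ∞ with rfl | hqt
  · rw [eLpNorm_exponent_top]
    refine (eLpNormEssSup_le_of_ae_bound h2).trans_eq ?_
    simp
  have hq0 : q ≠ 0 := (one_pos.trans_le hq).ne'
  set r := q.toReal with hr
  have hr1 : 1 ≤ r := by
    have := ENNReal.toReal_mono hqt hq
    simpa using this
  have hr0 : 0 < r := by linarith
  rw [eLpNorm_eq_lintegral_rpow_enorm_toReal hq0 hqt, ENNReal.toReal_inv, ← hr]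
  have hac : 0 ≤ a * c := by positivity
  have h3 : ∫⁻ x, ‖h x‖ₑ ^ r ≤ ENNReal.ofReal (a * (a * c) ^ (r - 1)) := by
    calc ∫⁻ x, ‖h x‖ₑ ^ r ≤ ∫⁻ x, ‖h x‖ₑ * ENNReal.ofReal ((a * c) ^ (r - 1)) := by
          refine lintegral_mono_ae ?_
          filter_upwards [h2] with x hx
          have e : ‖h x‖ₑ ^ r = ‖h x‖ₑ * ‖h x‖ₑ ^ (r - 1) := by
            conv_lhs => rw [show r = 1 + (r - 1) by ring]
            rw [ENNReal.rpow_add_of_nonneg _ _ zero_le_one (by linarith), ENNReal.rpow_one]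
          rw [e, ← ENNReal.ofReal_rpow_of_nonneg hac (by linarith)]
          gcongr
          rw [← ofReal_norm]
          exact ENNReal.ofReal_le_ofReal hx
      _ = (∫⁻ x, ‖h x‖ₑ) * ENNReal.ofReal ((a * c) ^ (r - 1)) :=
          lintegral_mul_const' _ _ ENNReal.ofReal_ne_top
      _ ≤ ENNReal.ofReal a * ENNReal.ofReal ((a * c) ^ (r - 1)) := by gcongr
      _ = _ := (ENNReal.ofReal_mul ha).symm
  refine (ENNReal.rpow_le_rpow h3 (by positivity)).trans_eq ?_
  rw [ENNReal.ofReal_rpow_of_nonneg (by positivity) (by positivity)]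
  congr 1
  have h4 : a * (a * c) ^ (r - 1) = (a * c ^ (1 - r⁻¹)) ^ r := by
    rw [Real.mul_rpow ha hc.le, Real.mul_rpow ha (by positivity), ← Real.rpow_mul hc.le, ← mul_assoc]
    congr 1
    · rcases ha.eq_or_lt with rfl | ha'
      · rw [Real.zero_rpow hr0.ne', zero_mul]
      · rw [← Real.rpow_one_add' ha (by linarith)]
        congr 1
        ring
    · congr 1
      field_simp
  rw [h4, one_div, Real.rpow_rpow_inv (by positivity) hr0.ne']

/-- The scaling exponent of `L^q`. -/
def scalingExp (n : ℕ) (q : ℝ≥0∞) : ℝ := (n : ℝ) / 2 * (1 - (q⁻¹).toReal)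

theorem RescaledSize.eLpNorm_le {t a : ℝ} (ht : 0 < t) {h : LOne n} (hh : RescaledSize t a h)
    {q : ℝ≥0∞} (hq : 1 ≤ q) : eLpNorm h q volume ≤ ENNReal.ofReal (a * t ^ (-scalingExp n q)) := by
  have h1 : ∫⁻ x, ‖h x‖ₑ ≤ ENNReal.ofReal a := by
    have := wnorm_one h
    simp only [wnorm, Pi.one_apply, one_mul] at this
    rw [this]
    exact ENNReal.ofReal_le_ofReal hh.norm_le
  refine (eLpNorm_le_of_rescaled ((norm_nonneg _).trans hh.norm_le) (by positivity) h1 hh.ae_le hq).trans_eq ?_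
  rw [← Real.rpow_mul ht.le, scalingExp]
  congr 3
  ring

theorem eLpNorm_dilation {t : ℝ} (ht : 0 < t) {φ : Euc n → ℂ} (hφ : Continuous φ) (q : ℝ≥0∞) :
    eLpNorm (dilation t φ) q volume = ENNReal.ofReal (t ^ (-scalingExp n q)) * eLpNorm φ q volume := by
  have hr : t ^ (-(1 : ℝ) / 2) ≠ 0 := by positivity
  have hn : -(n : ℝ) / 2 ≤ 0 := by
    have : (0 : ℝ) ≤ n := Nat.cast_nonneg n
    linarith
  have e1 : dilation t φ = ((t ^ (-(n : ℝ) / 2) : ℝ) : ℂ) • (φ ∘ fun x => t ^ (-(1 : ℝ) / 2) • x) := by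
    funext x
    rfl
  have e2 : |((t ^ (-(1 : ℝ) / 2)) ^ n)⁻¹| = t ^ ((n : ℝ) / 2) := by
    rw [abs_of_nonneg (by positivity), rpow_neg_half_pow ht.le, ← Real.rpow_neg ht.le]
    congr 1
    ring
  rw [e1, eLpNorm_const_smul, ← eLpNorm_map_measure hφ.aestronglyMeasurable (by fun_prop),
    Measure.map_addHaar_smul volume hr, finrank_euclideanSpace_fin, e2,
    eLpNorm_smul_measure_of_ne_zero (by simpa using Real.rpow_pos_of_pos ht _), smul_eq_mul, ← mul_assoc,
    ← ofReal_norm, Complex.norm_real, Real.norm_of_nonneg (by positivity),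
    ENNReal.ofReal_rpow_of_pos (by positivity), ← ENNReal.ofReal_mul (by positivity),
    ← Real.rpow_mul ht.le, ← Real.rpow_add ht, one_div, scalingExp]
  congr 3
  ring

theorem eLpNorm_profileGap_lt_top {ν : ℂ} (hν : 0 < ν.re) (f : ℂ → ℂ) (u₀ : Euc n → ℂ)
    (u : ℝ → LOne n) (m : ℕ) {q : ℝ≥0∞} (hq : 1 ≤ q) :
    eLpNorm (profileGap ν f u₀ u m) q volume < ∞ := by
  obtain ⟨C, hC0, hC⟩ := exists_norm_profileGap_le hν f u₀ u m
  have hr := rate_pos hν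
  set J := ∫ x : Euc n, Real.exp (-(rate ν / 4 * ‖x‖ ^ 2)) with hJ
  have hJ0 : 0 ≤ J := integral_nonneg fun _ => (Real.exp_pos _).le
  have hi := integrable_exp_neg_norm_sq (n := n) (b := rate ν / 4) (by positivity)
  refine (eLpNorm_le_of_rescaled (a := C * (J + 1)) (c := 1) (by positivity) one_pos ?_ ?_ hq).trans_lt
    ENNReal.ofReal_lt_top
  · calc ∫⁻ x, ‖profileGap ν f u₀ u m x‖ₑ
        ≤ ∫⁻ x : Euc n, ENNReal.ofReal (C * Real.exp (-(rate ν / 4 * ‖x‖ ^ 2))) := by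
          refine lintegral_mono fun x => ?_
          rw [← ofReal_norm]
          exact ENNReal.ofReal_le_ofReal (hC x)
      _ = ENNReal.ofReal (C * J) := by
          rw [← ofReal_integral_eq_lintegral_ofReal (hi.const_mul C)
            (Eventually.of_forall fun x => by positivity), integral_const_mul]
      _ ≤ _ := by
          gcongr
          linarith
  · refine Eventually.of_forall fun x => (hC x).trans ?_
    have : Real.exp (-(rate ν / 4 * ‖x‖ ^ 2)) ≤ 1 := Real.exp_le_one_iff.2 (by
      have : 0 ≤ rate ν / 4 * ‖x‖ ^ 2 := by positivity
      linarith)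
    rw [mul_one]
    gcongr
    linarith

theorem eLpNorm_profileGap_pos {ν : ℂ} {f : ℂ → ℂ} {u₀ : Euc n → ℂ} {u : ℝ → LOne n} {m : ℕ}
    (h : ∃ x, profileGap ν f u₀ u m x ≠ 0) {q : ℝ≥0∞} (hq : 1 ≤ q) :
    0 < eLpNorm (profileGap ν f u₀ u m) q volume := by
  have hc := continuous_profileGap ν f u₀ u m
  rw [pos_iff_ne_zero]
  intro h0
  rw [eLpNorm_eq_zero_iff hc.aestronglyMeasurable (one_pos.trans_le hq).ne'] at h0
  obtain ⟨x, hx⟩ := h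
  exact hx (congrFun ((hc.ae_eq_iff_eq volume continuous_const).1 h0) x)

/-- The two-sided estimate of the rescaled remainder. -/
theorem scaledRemainder_bounds {ν : ℂ} {f : ℂ → ℂ} {u₀ : Euc n → ℂ} {u : ℝ → LOne n} {m : ℕ}
    {E : ℝ → LOne n} {η : ℝ → ℝ} (hη : Tendsto η atTop (𝓝 0))
    (hE : ∀ t, 0 < t → RescaledSize t (t ^ (-((m + 1 : ℕ) : ℝ) / 2) * η t) (E t))
    (hu : ∀ t, 0 < t → (fun x => u t x - profile ν f u₀ u (m + 1) t x) =ᵐ[volume] E t)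
    {q : ℝ≥0∞} (hq : 1 ≤ q) (hpos : 0 < eLpNorm (profileGap ν f u₀ u m) q volume)
    (hfin : eLpNorm (profileGap ν f u₀ u m) q volume < ∞) {δ : ℝ} (hδ : 0 < δ) (hδ1 : δ < 1) :
    ∃ t₀ : ℝ, 0 < t₀ ∧ ∀ t : ℝ, t₀ < t →
      ENNReal.ofReal (t ^ (-(1 : ℝ) / 2) * (1 - δ)) * eLpNorm (profileGap ν f u₀ u m) q volume ≤
        scaledRemainder ν f u₀ u m q t ∧
      scaledRemainder ν f u₀ u m q t ≤
        ENNReal.ofReal (t ^ (-(1 : ℝ) / 2) * (1 + δ)) * eLpNorm (profileGap ν f u₀ u m) q volume := by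
  set G := eLpNorm (profileGap ν f u₀ u m) q volume with hG
  have hGr : 0 < G.toReal := ENNReal.toReal_pos hpos.ne' hfin.ne
  have hev : ∀ᶠ t in atTop, η t ≤ δ * G.toReal := hη.eventually_le_const (by positivity)
  obtain ⟨T, hT⟩ := eventually_atTop.1 hev
  refine ⟨max T 1, by positivity, fun t ht => ?_⟩
  have ht0 : 0 < t := by linarith [le_max_right T 1]
  have hηt := hT t ((le_max_left T 1).trans ht.le)
  set e := scalingExp n q with he
  set c := t ^ (e + (m : ℝ) / 2) with hc
  set d := t ^ (-((m + 1 : ℕ) : ℝ) / 2) with hd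
  set r := t ^ (-(1 : ℝ) / 2) with hr
  have hc0 : 0 < c := by positivity
  have hd0 : 0 < d := by positivity
  have hr0 : 0 < r := by positivity
  -- The scaling exponents cancel and `m/2 - (m+1)/2 = -1/2` is left.
  have hcd : c * (d * t ^ (-e)) = r := by
    rw [hc, hd, hr, ← Real.rpow_add ht0, ← Real.rpow_add ht0]
    congr 1
    push_cast
    ring
  set P : Euc n → ℂ := fun x => (d : ℂ) * dilation t (profileGap ν f u₀ u m) x with hP
  have hcont := continuous_profileGap ν f u₀ u m
  have hPc : Continuous P := by
    simp only [hP, dilation]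
    fun_prop
  have hPn : ENNReal.ofReal c * eLpNorm P q volume = ENNReal.ofReal r * G := by
    have : P = (d : ℂ) • dilation t (profileGap ν f u₀ u m) := rfl
    rw [this, eLpNorm_const_smul, eLpNorm_dilation ht0 hcont, ← ofReal_norm, Complex.norm_real,
      Real.norm_of_nonneg hd0.le, ← mul_assoc, ← mul_assoc, ← ENNReal.ofReal_mul hc0.le,
      ← ENNReal.ofReal_mul (by positivity), mul_assoc, hcd]
  have hEn : ENNReal.ofReal c * eLpNorm (E t) q volume ≤ ENNReal.ofReal (r * δ) * G := by
    calc ENNReal.ofReal c * eLpNorm (E t) q volume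
        ≤ ENNReal.ofReal c * ENNReal.ofReal (d * η t * t ^ (-e)) := by
          gcongr
          exact (hE t ht0).eLpNorm_le ht0 hq
      _ = ENNReal.ofReal (r * η t) := by
          rw [← ENNReal.ofReal_mul hc0.le, ← hcd]
          congr 1
          ring
      _ ≤ ENNReal.ofReal (r * (δ * G.toReal)) := by gcongr
      _ = _ := by
          rw [← mul_assoc, ENNReal.ofReal_mul (by positivity), ENNReal.ofReal_toReal hfin.ne]
  have hrem : eLpNorm (fun x => u t x - profile ν f u₀ u m t x) q volume =
      eLpNorm ((E t : Euc n → ℂ) + P) q volume := by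
    refine eLpNorm_congr_ae ?_
    filter_upwards [hu t ht0] with x hx
    rw [Pi.add_apply, ← hx, hP]
    dsimp only
    rw [← profile_succ_sub ν f u₀ u m ht0]
    ring
  have hEm : AEStronglyMeasurable (E t : Euc n → ℂ) volume := Lp.aestronglyMeasurable _
  have hS : scaledRemainder ν f u₀ u m q t =
      ENNReal.ofReal c * eLpNorm ((E t : Euc n → ℂ) + P) q volume := by
    rw [scaledRemainder, hrem]
    rfl
  have hsum : ENNReal.ofReal (r * δ) * G + ENNReal.ofReal r * G = ENNReal.ofReal (r * (1 + δ)) * G := by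
    rw [← add_mul, ← ENNReal.ofReal_add (by positivity) hr0.le]
    congr 2
    ring
  constructor
  · have h1 : eLpNorm P q volume ≤ eLpNorm ((E t : Euc n → ℂ) + P) q volume + eLpNorm (E t) q volume := by
      have := eLpNorm_sub_le (hEm.add hPc.aestronglyMeasurable) hEm hq
      rwa [add_sub_cancel_left] at this
    have h2 : ENNReal.ofReal r * G ≤ scaledRemainder ν f u₀ u m q t + ENNReal.ofReal (r * δ) * G := by
      rw [← hPn, hS]
      refine (mul_le_mul_right h1 _).trans ?_
      rw [mul_add]
      gcongr
    have h3 : ENNReal.ofReal r * G =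
        ENNReal.ofReal (r * (1 - δ)) * G + ENNReal.ofReal (r * δ) * G := by
      rw [← add_mul, ← ENNReal.ofReal_add (mul_nonneg hr0.le (by linarith)) (by positivity)]
      congr 2
      ring
    rw [h3] at h2
    exact (ENNReal.add_le_add_iff_right (ENNReal.mul_ne_top ENNReal.ofReal_ne_top hfin.ne)).1 h2
  · rw [hS, ← hsum, ← hPn]
    refine (mul_le_mul_right (eLpNorm_add_le hEm hPc.aestronglyMeasurable hq) _).trans ?_
    rw [mul_add]
    gcongr

end CGL

end

noncomputable section

namespace CGL

variable {n : ℕ}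

/-! ### Initial data -/

/-- `L¹_M` is defined through monomials while the estimates use the weight `|x|^M`; the pure powers
`x_j^M` already control it, because `|x| ≤ n max_j |x_j|`. -/
theorem norm_pow_le_sum_monom (M : ℕ) (x : Euc n) (hM : M ≠ 0) :
    ‖x‖ ^ M ≤ (n : ℝ) ^ M * ∑ j, ‖monom (Pi.single j M) x‖ := by
  have hmon : ∀ j, ‖monom (Pi.single j M) x‖ = |x j| ^ M := fun j => by
    rw [monom, Finset.prod_eq_single j]
    · simp
    · intro i _ hi
      simp [Pi.single_eq_of_ne hi]
    · simp
  simp_rw [hmon]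
  have hsum : ‖x‖ ≤ ∑ j, |x j| := by
    rw [EuclideanSpace.norm_eq]
    refine Real.sqrt_le_iff.2 ⟨Finset.sum_nonneg fun _ _ => abs_nonneg _, ?_⟩
    simp only [Real.norm_eq_abs]
    exact Finset.sum_sq_le_sq_sum_of_nonneg fun _ _ => abs_nonneg _
  rcases isEmpty_or_nonempty (Fin n) with h | h
  · have : ‖x‖ = 0 := le_antisymm (by simpa using hsum) (norm_nonneg _)
    rw [this, zero_pow hM]
    positivity
  · obtain ⟨j, hj⟩ := Finite.exists_max fun j => |x j|
    have h1 : ‖x‖ ≤ n * |x j| := by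
      refine hsum.trans ((Finset.sum_le_sum fun i _ => hj i).trans_eq ?_)
      simp
    calc ‖x‖ ^ M ≤ (n * |x j|) ^ M := by gcongr
      _ = (n : ℝ) ^ M * |x j| ^ M := mul_pow _ _ _
      _ ≤ _ := by
          gcongr
          exact Finset.single_le_sum (f := fun j => |x j| ^ M) (fun _ _ => by positivity)
            (Finset.mem_univ j)

theorem len_single (j : Fin n) (M : ℕ) : len (Pi.single j M) = M := by
  simp [len]

theorem MemWeightedL1.wnorm_lt_top {M : ℕ} (hM : M ≠ 0) {φ : Euc n → ℂ} (hφ : MemWeightedL1 M φ) :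
    wnorm (powWeight n M) (toL1 φ) < ∞ := by
  have hi : Integrable fun x => ‖x‖ ^ M * ‖φ x‖ := by
    have h1 : Integrable fun x => (n : ℝ) ^ M * ∑ j : Fin n, ‖monom (Pi.single j M) x * φ x‖ :=
      (integrable_finsetSum _ fun j _ => (hφ.2 _ (len_single j M).le).norm).const_mul _
    refine h1.mono' (((continuous_norm.pow M).aestronglyMeasurable).mul hφ.1.aestronglyMeasurable.norm)
      (Eventually.of_forall fun x => ?_)
    rw [Real.norm_of_nonneg (by positivity)]
    simp only [norm_mul]
    rw [← Finset.sum_mul, ← mul_assoc]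
    gcongr
    exact norm_pow_le_sum_monom M x hM
  have h2 : wnorm (powWeight n M) (toL1 φ) = ∫⁻ x, ‖‖x‖ ^ M * ‖φ x‖‖ₑ := by
    refine lintegral_congr_ae ?_
    filter_upwards [coeFn_toL1 hφ.1] with x hx
    rw [hx, enorm_mul, enorm_pow, enorm_norm, enorm_norm, powWeight]
  rw [h2]
  exact hi.2

/-- Small multiples of admissible data. -/
theorem exists_sized_toL1 {M : ℕ} (hM : M ≠ 0) {φ : Euc n → ℂ} (hφ : MemWeightedL1 M φ) {B : ℝ}
    (hB : ∀ᵐ x, ‖φ x‖ ≤ B) :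
    ∃ a : ℝ, 0 < a ∧ ∀ ε : ℝ, 0 < ε → Sized M 0 (a * ε) (toL1 fun x => (ε : ℂ) * φ x) := by
  have hW := hφ.wnorm_lt_top hM
  set W := (wnorm (powWeight n M) (toL1 φ)).toReal with hWd
  have hW0 : 0 ≤ W := ENNReal.toReal_nonneg
  refine ⟨‖toL1 φ‖ + |B| + W + 1, by positivity, fun ε hε => ?_⟩
  have hN := norm_nonneg (toL1 φ)
  have hB0 := abs_nonneg B
  have e : toL1 (fun x => (ε : ℂ) * φ x) = (ε : ℂ) • toL1 φ := by
    refine Lp.ext ((coeFn_toL1 (hφ.1.const_mul _)).trans ?_)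
    filter_upwards [Lp.coeFn_smul (ε : ℂ) (toL1 φ), coeFn_toL1 hφ.1] with x h1 h2
    rw [h1, Pi.smul_apply, h2, smul_eq_mul]
  have hεn : ‖(ε : ℂ)‖ = ε := by rw [Complex.norm_real, Real.norm_of_nonneg hε.le]
  rw [e]
  refine ⟨?_, ?_, ?_⟩
  · rw [norm_smul, hεn, mul_comm]
    gcongr
    linarith
  · filter_upwards [Lp.coeFn_smul (ε : ℂ) (toL1 φ), coeFn_toL1 hφ.1, hB] with x h1 h2 h3
    rw [h1, Pi.smul_apply, h2, norm_smul, hεn, add_zero, Real.one_rpow, mul_one, mul_comm]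
    gcongr
    linarith [le_abs_self B]
  · rw [wnorm_smul, ← ofReal_norm, hεn, ← ENNReal.ofReal_toReal hW.ne, ← ENNReal.ofReal_mul hε.le,
      add_zero, Real.one_rpow, mul_one, mul_comm ε]
    gcongr
    linarith

/-! ### Small solutions -/

theorem Sized.ae_le_radius {M : ℕ} {t R : ℝ} (ht : 0 ≤ t) {g : LOne n} (h : Sized M t R g) :
    ∀ᵐ x, ‖g x‖ ≤ R := by
  filter_upwards [h.ae_le] with x hx
  refine hx.trans (mul_le_of_le_one_right h.nonneg ?_)
  refine Real.rpow_le_one_of_one_le_of_nonpos (by linarith) ?_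
  have : (0 : ℝ) ≤ n := Nat.cast_nonneg n
  linarith

theorem Sized.decaySource {p K : ℝ} {f : ℂ → ℂ} (hf : NonlinBound p K f) {M : ℕ} {R : ℝ}
    (hσ : (M : ℝ) / 2 + 1 < (n : ℝ) * (p - 1) / 2) {U u : ℝ → LOne n} (hU : Continuous U)
    (hUs : ∀ t, Sized M (max t 0) R (U t)) (hu : ∀ t, 0 ≤ t → u t = U t) :
    DecaySource M ((n : ℝ) * (p - 1) / 2) (K * R ^ p) fun s => toL1 fun x => f (u s x) := by
  have hsz : ∀ t, 0 ≤ t → Sized M t R (u t) := fun t ht => by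
    have := hUs t
    rwa [max_eq_left ht, ← hu t ht] at this
  refine ⟨?_, fun s hs => (hsz s hs).nonlin hf hs, hσ⟩
  have hcont : ContinuousOn u (Ici 0) := hU.continuousOn.congr fun t ht => hu t ht
  exact hf.continuousOn_nonlin hcont (B := R) fun t ht => (hsz t ht).ae_le_radius ht

theorem DecaySource.profileConverges {f : ℂ → ℂ} {u : ℝ → LOne n} {M m : ℕ} (hm : m ≤ M) {σ A : ℝ}
    (h : DecaySource M σ A fun s => toL1 fun x => f (u s x)) : ProfileConverges f u m := fun k hk =>
  ⟨h.integrableOn_pow_smul (by omega), memWeightedL1_of_wnorm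
    ((h.wnorm_integral_le (j := m - 2 * k) (k := k) (by omega)).trans_lt ENNReal.ofReal_lt_top)⟩

/-- The bound is linear in `A`, which for a solution of size `R` is `K R^p`: superlinear in the
data, hence eventually dominated by the moment of the datum. -/
theorem DecaySource.norm_moment_psi_le {f : ℂ → ℂ} {u : ℝ → LOne n} {M : ℕ} {σ A : ℝ}
    (h : DecaySource M σ A fun s => toL1 fun x => f (u s x)) {q : (Fin n → ℕ) × (Fin n → ℕ)}
    (hq : q ∈ topIdx n M) :
    ‖∫ y, monom q.2 y * psi f u (len q.1) y‖ ≤ 2 * A * decayMass (σ - (M : ℝ) / 2) := by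
  have hA := h.nonneg
  have hd := decayMass_nonneg (σ - (M : ℝ) / 2)
  rw [mem_topIdx] at hq
  have h1 := (wnorm_monom_le q.2 (psi f u (len q.1))).trans
    (h.wnorm_integral_le (j := len q.2) (k := len q.1) (by omega))
  have h2 : ‖∫ y, monom q.2 y * psi f u (len q.1) y‖ₑ ≤
      ENNReal.ofReal (2 * A * decayMass (σ - (M : ℝ) / 2)) := by
    refine (enorm_integral_le_lintegral_enorm _).trans ?_
    simpa only [enorm_mul, wnorm] using h1
  rw [← ofReal_norm] at h2
  exact (ENNReal.ofReal_le_ofReal_iff (by positivity)).1 h2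

theorem IsMild.exists_expansion {ν : ℂ} (hν : 0 < ν.re) {f : ℂ → ℂ} {u₀ : Euc n → ℂ}
    (hu₀ : Integrable u₀) {M : ℕ} (hw : wnorm (powWeight n M) (toL1 u₀) < ∞) {u : ℝ → LOne n}
    (hu : IsMild ν f (toL1 u₀) u) {σ A : ℝ}
    (h : DecaySource M σ A fun s => toL1 fun x => f (u s x)) :
    ∃ (E : ℝ → LOne n) (η : ℝ → ℝ), Tendsto η atTop (𝓝 0) ∧
      (∀ t, 0 < t → RescaledSize t (t ^ (-(M : ℝ) / 2) * η t) (E t)) ∧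
      ∀ t, 0 < t → (fun x => u t x - profile ν f u₀ u M t x) =ᵐ[volume] E t := by
  obtain ⟨η, hη, hE⟩ := h.exists_rescaledSize_sub hν hw
  refine ⟨_, η, hη, hE, fun t ht => ?_⟩
  have e : heat ν t (toL1 u₀) + duhamel ν (fun s => toL1 fun x => f (u s x)) t = u t := (hu t ht).symm
  rw [e]
  filter_upwards [Lp.coeFn_sub (u t) (profVec ν M t 0 (toL1 u₀) +
    ∫ s in Ioi (0 : ℝ), profVec ν M t s (toL1 fun x => f (u s x))), h.profVec_add_coeFn hν hu₀ ht]
    with x h1 h2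
  rw [h1, Pi.sub_apply, h2]

theorem eventually_mul_rpow_le {r : ℝ} (hr : 0 < r) (C : ℝ) {c : ℝ} (hc : 0 < c) :
    ∀ᶠ ε in 𝓝[>] (0 : ℝ), C * ε ^ r < c := by
  have h : Tendsto (fun ε : ℝ => C * ε ^ r) (𝓝 0) (𝓝 (C * 0 ^ r)) :=
    ((Real.continuousAt_rpow_const 0 r (Or.inr hr.le)).tendsto).const_mul C
  rw [Real.zero_rpow hr.ne', mul_zero] at h
  exact (h.eventually_lt_const hc).filter_mono nhdsWithin_le_nhds

end CGL

end

/-! ### Choice of the constants and conclusion -/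

theorem propositionA1
    (n : ℕ) (hn : 0 < n) (ν : ℂ) (hν : 0 < ν.re)
    (m : ℕ) (p : ℝ) (hp : 1 + ((m : ℝ) + 3) / (n : ℝ) < p)
    (f : ℂ → ℂ) (hf : CGL.IsNonlinearity p f)
    (φ : EuclideanSpace ℝ (Fin n) → ℂ)
    (hφ : CGL.MemWeightedL1 (m + 1) φ) (hφ_bdd : MemLp φ ∞ volume)
    (hmom : ∃ α : Fin n → ℕ, CGL.len α = m + 1 ∧ CGL.moment α φ ≠ 0) :
    ∃ ε₀ : ℝ, 0 < ε₀ ∧ ∀ ε : ℝ, 0 < ε → ε ≤ ε₀ →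
      -- there is a global solution with initial data `ε φ`, and it is unique
      (∃ u, CGL.IsGlobalSolution ν f (fun x => (ε : ℂ) * φ x) u) ∧
      (∀ u v, CGL.IsGlobalSolution ν f (fun x => (ε : ℂ) * φ x) u →
        CGL.IsGlobalSolution ν f (fun x => (ε : ℂ) * φ x) v → ∀ t, 0 ≤ t → u t = v t) ∧
      ∀ u, CGL.IsGlobalSolution ν f (fun x => (ε : ℂ) * φ x) u →
        -- the integrals defining the profiles of order `m` and `m + 1` converge
        CGL.ProfileConverges f u m ∧ CGL.ProfileConverges f u (m + 1) ∧
        -- the difference of the two profiles at time one does not vanish identically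
        (∃ x, CGL.profileGap ν f (fun x => (ε : ℂ) * φ x) u m x ≠ 0) ∧
        -- hence the rate `t ^ (-1/2)` is attained by the rescaled remainder, in every `L^q`
        ∀ q : ℝ≥0∞, 1 ≤ q →
          0 < eLpNorm (CGL.profileGap ν f (fun x => (ε : ℂ) * φ x) u m) q volume ∧
          eLpNorm (CGL.profileGap ν f (fun x => (ε : ℂ) * φ x) u m) q volume < ∞ ∧
          ∀ δ : ℝ, 0 < δ → δ < 1 → ∃ t₀ : ℝ, 0 < t₀ ∧ ∀ t : ℝ, t₀ < t →
            ENNReal.ofReal (t ^ (-(1 : ℝ) / 2) * (1 - δ)) *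
                eLpNorm (CGL.profileGap ν f (fun x => (ε : ℂ) * φ x) u m) q volume ≤
              CGL.scaledRemainder ν f (fun x => (ε : ℂ) * φ x) u m q t ∧
            CGL.scaledRemainder ν f (fun x => (ε : ℂ) * φ x) u m q t ≤
              ENNReal.ofReal (t ^ (-(1 : ℝ) / 2) * (1 + δ)) *
                eLpNorm (CGL.profileGap ν f (fun x => (ε : ℂ) * φ x) u m) q volume := by
  have hn' : (0 : ℝ) < n := by exact_mod_cast hn
  have hm3 : (m : ℝ) + 3 < n * (p - 1) := by
    have h : ((m : ℝ) + 3) / n < p - 1 := by linarith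
    rwa [div_lt_iff₀ hn', mul_comm] at h
  have hm0 : (0 : ℝ) ≤ m := Nat.cast_nonneg m
  have hp1 : 1 < p := by
    have : 0 < (n : ℝ) * (p - 1) := by linarith
    linarith [(pos_iff_pos_of_mul_pos this).1 hn']
  obtain ⟨K, hf⟩ := hf.exists_bound hp1
  obtain ⟨α, hα, hαm⟩ := hmom
  set σ := (n : ℝ) * (p - 1) / 2 with hσ
  have hσ1 : 1 < σ := by linarith
  -- This is the hypothesis on `p` rewritten; it permits the expansion up to order `m + 1`, one more
  -- than the profile under study.
  have hσM : ((m + 1 : ℕ) : ℝ) / 2 + 1 < σ := by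
    push_cast
    linarith
  have hbdd : ∀ᵐ x, ‖φ x‖ ≤ (eLpNormEssSup φ volume).toReal := by
    have hfin : eLpNormEssSup φ volume ≠ ∞ := by
      have := hφ_bdd.2.ne
      rwa [eLpNorm_exponent_top] at this
    filter_upwards [enorm_ae_le_eLpNormEssSup φ volume] with x hx
    simpa using ENNReal.toReal_mono hfin hx
  obtain ⟨a, ha, hsized⟩ := CGL.exists_sized_toL1 (Nat.succ_ne_zero m) hφ hbdd
  set H := CGL.heatConst n ν (m + 1) with hH
  have hH0 : 0 ≤ H := CGL.heatConst_nonneg n ν (m + 1)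
  -- The radius is `R = b ε`, so that the linear part, of size at most `H a ε`, is exactly `R/2`.
  set b := 2 * (H * a) with hb
  have hb0 : 0 ≤ b := by positivity
  set S := ∑ q ∈ CGL.topIdx n (m + 1), ‖CGL.taylorCoeff ν q‖ with hS
  have hr : 0 < p - 1 := by linarith
  -- Two smallness conditions on `ε^(p-1)`: this one makes the map a contraction, the next keeps the
  -- moments of the `ψ_k` below that of `φ`.
  have ev1 := CGL.eventually_mul_rpow_le hr (H * K * CGL.decayMass σ * b ^ (p - 1))
    (show (0 : ℝ) < 1 / 4 by norm_num)
  have ev2 := CGL.eventually_mul_rpow_le hr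
    (S * (2 * (K * b ^ p) * CGL.decayMass (σ - ((m + 1 : ℕ) : ℝ) / 2))) (norm_pos_iff.2 hαm)
  obtain ⟨ε₀, hε₀, hε₀s⟩ := mem_nhdsGT_iff_exists_Ioc_subset.1 (ev1.and ev2)
  refine ⟨ε₀, hε₀, fun ε hε hεε₀ => ?_⟩
  obtain ⟨c1, c2⟩ := hε₀s ⟨hε, hεε₀⟩
  have hg := hsized ε hε
  have hu₀ : Integrable fun x => (ε : ℂ) * φ x := hφ.1.const_mul _
  obtain ⟨U, hU, hUs, hUm⟩ := CGL.exists_fixedPoint hν hf hσ1 hg (R := b * ε)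
    (by
      rw [hb]
      exact le_of_eq (by ring))
    (by
      rw [Real.mul_rpow hb0 hε.le, ← mul_assoc]
      exact c1.le)
  have hsol : CGL.IsGlobalSolution ν f (fun x => (ε : ℂ) * φ x) U :=
    CGL.isGlobalSolution_of_isMild hν hf hu₀ (A := ε * (eLpNormEssSup φ volume).toReal)
      (hbdd.mono fun x hx => by
        rw [norm_mul, Complex.norm_real, Real.norm_of_nonneg hε.le]
        gcongr) hU (fun t => (hUs t).norm_le)
      (fun t => (hUs t).ae_le_radius (le_max_right t 0)) fun t ht => hUm t ht.le
  refine ⟨⟨U, hsol⟩, fun u v hu hv => hu.unique hν hf hv, fun u hu => ?_⟩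
  have huU := hu.unique hν hf hsol
  -- An arbitrary global solution agrees with the constructed one for `t ≥ 0`, so it inherits the
  -- decay although its definition does not require any.
  have hD := CGL.Sized.decaySource hf hσM hU hUs huU
  have hmild : CGL.IsMild ν f (CGL.toL1 fun x => (ε : ℂ) * φ x) u := fun t ht => by
    rw [huU t ht.le, hUm t ht.le]
    congr 1
    refine intervalIntegral.integral_congr fun s hs => ?_
    rw [uIcc_of_le ht.le] at hs
    dsimp only
    rw [huU s hs.1]
  have hgap : ∃ x, CGL.profileGap ν f (fun x => (ε : ℂ) * φ x) u m x ≠ 0 := by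
    refine CGL.exists_profileGap_ne_zero hν hα (fun q hq => hD.norm_moment_psi_le hq) ?_
    have e1 : CGL.moment α (fun x => (ε : ℂ) * φ x) = ε * CGL.moment α φ := by
      simp only [CGL.moment]
      rw [mul_left_comm, ← integral_const_mul (ε : ℂ)]
      simp only [mul_left_comm (ε : ℂ)]
    -- One factor `ε` is matched with the moment of `ε φ`; the remaining `ε^(p-1)` is the smallness
    -- provided by `ev2`.
    have e2 : (b * ε) ^ p = b ^ p * ε ^ (p - 1) * ε := by
      rw [Real.mul_rpow hb0 hε.le, mul_assoc, Real.rpow_sub_one hε.ne', div_mul_cancel₀ _ hε.ne']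
    rw [e1, norm_mul, Complex.norm_real, Real.norm_of_nonneg hε.le, e2]
    calc S * (2 * (K * (b ^ p * ε ^ (p - 1) * ε)) * CGL.decayMass (σ - ((m + 1 : ℕ) : ℝ) / 2))
        = ε * (S * (2 * (K * b ^ p) * CGL.decayMass (σ - ((m + 1 : ℕ) : ℝ) / 2)) * ε ^ (p - 1)) := by ring
      _ < _ := mul_lt_mul_of_pos_left c2 hε
  refine ⟨hD.profileConverges m.le_succ, hD.profileConverges le_rfl, hgap, fun q hq => ?_⟩
  have hpos := CGL.eLpNorm_profileGap_pos hgap hq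
  have hfin := CGL.eLpNorm_profileGap_lt_top hν f (fun x => (ε : ℂ) * φ x) u m hq
  obtain ⟨E, η, hη, hE, huE⟩ := hmild.exists_expansion hν hu₀ hg.wnorm_lt_top hD
  exact ⟨hpos, hfin, fun δ hδ hδ1 => CGL.scaledRemainder_bounds hη hE huE hq hpos hfin hδ hδ1⟩
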